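/- **Definitions.** A *skew monoidal category* is a category $\mathcal C$ with a functor $\otimes\colon\mathcal C\times\mathcal C\to\mathcal C$, an object $i$, and natural transformations $\alpha\colon(a\otimes b)\otimes c\to a\otimes(b\otimes c)$, $\lambda\colon i\otimes a\to a$, $\rho\colon a\to a\otimes i$ (not necessarily invertible) such that $\alpha_{a,b,c\otimes d}\,\alpha_{a\otimes b,c,d}=(1\otimes\alpha_{b,c,d})\,\alpha_{a,b\otimes c,d}\,(\alpha_{a,b,c}\otimes 1)$, $\lambda_{a\otimes b}\,\alpha_{i,a,b}=\lambda_a\otimes 1$, $(1\otimes\lambda_b)\,\alpha_{a,i,b}\,(\rho_a\otimes 1)=1$, $\alpha_{a,b,i}\,\rho_{a\otimes b}=1\otimes\rho_b$ and $\lambda_i\rho_i=1$. Let $\mathbf{Skew}_\ell$ be the 2-category of skew monoidal categories, lax monoidal functors (functors $F$ with natural maps $Fa\otimes Fb\to F(a\otimes b)$ and a map $i\to Fi$ compatible with $\alpha,\lambda,\rho$) and monoidal natural transformations. Let $\mathcal R_0$ be the category with the single object $\ell$ and only its identity, and for $n>0$ let $\mathcal R_n$ be the category with two objects $t,\ell$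 and one non-identity arrow $t\to\ell$. Put $x(x_1,\dots,x_n)=t$ if $n>0$ and $x=x_1=t$, and $x(x_1,\dots,x_n)=\ell$ otherwise. A *skew multicategory* $\mathbb A$ consists of a set of objects; for each list $a_1,\dots,a_n$ of objects and each object $b$ a functor $x\mapsto\mathbb A_x(a_1,\dots,a_n;b)$ from $\mathcal R_n$ to sets; identities $1_a\in\mathbb A_t(a;a)$; and substitution maps $$\mathbb A_x(b_1,\dots,b_n;c)\times\prod_{r=1}^n\mathbb A_{x_r}(\overline a_r;b_r)\to\mathbb A_{x(x_1,\dots,x_n)}(\overline a_1,\dots,\overline a_n;c),\qquad (g,f_1,\dots,f_n)\mapsto g(f_1,\dots,f_n),$$ natural in $x,x_1,\dots,x_n$, associative, and unital with respect to the $1_a$. A *morphism* $F\colon\mathbb A\to\mathbb B$ is a map $a\mapsto Fa$ on objects with maps $\mathbb A_x(a_1,\dots,a_n;b)\to\mathbb B_x(Fa_1,\dots,Fa_n;Fb)$, natural in $x$, preserving identities and substitution. A *2-cell* $\varphi\colon F\to G$ is a family $\varphi_a\in\mathbb B_t(Fa;Ga)$ with $\varphi_b(Ff)=(Gf)(\varphi_{a_1},\dots,\varphi_{a_n})$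 for all $f\in\mathbb A_x(a_1,\dots,a_n;b)$. These form a 2-category $\mathcal R\text{-}\mathbf{Mult}$. A multimap $\theta\in\mathbb A_x(\overline a;m)$ is *universal* if $g\mapsto g(\theta)$, $\mathbb A_t(m;b)\to\mathbb A_x(\overline a;b)$, is a bijection for every object $b$. The skew multicategory $\mathbb A$ is *left representable* if (i) for every $n\ge 0$, every $x\in\mathcal R_n$ and all $a_1,\dots,a_n$ there are an object $m$ and a universal $\theta\in\mathbb A_x(a_1,\dots,a_n;m)$, and (ii) for every universal $\theta\in\mathbb A_x(\overline a;m)$, all objects $b_1,\dots,b_k$ and every object $c$, the map $g\mapsto g(\theta,1_{b_1},\dots,1_{b_k})$, $\mathbb A_t(m,b_1,\dots,b_k;c)\to\mathbb A_x(\overline a,b_1,\dots,b_k;c)$, is a bijection. **Theorem.** There is a 2-equivalence between the 2-category $\mathbf{Skew}_\ell$ and the full sub-2-category of $\mathcal R\text{-}\mathbf{Mult}$ consisting of the left representable skew multicategories; that is, there are 2-functors in both directions whose two composites are 2-naturally isomorphic to the identity 2-functors. -/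

import Mathlib

open CategoryTheory

universe w w₁ w₂ v₁ v₂ u₁ u₂ v u

/-! ## Skew monoidal categories and the 2-category `Skew_ℓ` -/

/-- A skew monoidal category: a category with a functor `⊗ : C × C ⥤ C`, an object `i` and natural
families `α : (a ⊗ b) ⊗ c ⟶ a ⊗ (b ⊗ c)`, `λ : i ⊗ a ⟶ a`, `ρ : a ⟶ a ⊗ i`, none of which need be
invertible, subject to the five axioms corresponding to Mac Lane's axioms for a monoidal
category. -/
structure SkewMonCat : Type (max (u + 1) (v + 1)) where
  carrier : Type u
  [category : Category.{v} carrier]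
  tensorObj : carrier → carrier → carrier
  tensorHom : ∀ {a a' b b' : carrier}, (a ⟶ a') → (b ⟶ b') → (tensorObj a b ⟶ tensorObj a' b')
  unit : carrier
  assoc : ∀ a b c : carrier, tensorObj (tensorObj a b) c ⟶ tensorObj a (tensorObj b c)
  left : ∀ a : carrier, tensorObj unit a ⟶ a
  right : ∀ a : carrier, a ⟶ tensorObj a unit
  tensor_id : ∀ a b : carrier, tensorHom (𝟙 a) (𝟙 b) = 𝟙 (tensorObj a b)
  tensor_comp : ∀ {a a' a'' b b' b'' : carrier} (f : a ⟶ a') (f' : a' ⟶ a'') (g : b ⟶ b')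
    (g' : b' ⟶ b''), tensorHom (f ≫ f') (g ≫ g') = tensorHom f g ≫ tensorHom f' g'
  assoc_natural : ∀ {a a' b b' c c' : carrier} (f : a ⟶ a') (g : b ⟶ b') (h : c ⟶ c'),
    tensorHom (tensorHom f g) h ≫ assoc a' b' c' = assoc a b c ≫ tensorHom f (tensorHom g h)
  left_natural : ∀ {a a' : carrier} (f : a ⟶ a'), tensorHom (𝟙 unit) f ≫ left a' = left a ≫ f
  right_natural : ∀ {a a' : carrier} (f : a ⟶ a'), f ≫ right a' = right a ≫ tensorHom f (𝟙 unit)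
  pentagon : ∀ a b c d : carrier,
    assoc (tensorObj a b) c d ≫ assoc a b (tensorObj c d) =
      tensorHom (assoc a b c) (𝟙 d) ≫ assoc a (tensorObj b c) d ≫ tensorHom (𝟙 a) (assoc b c d)
  assoc_left : ∀ a b : carrier,
    assoc unit a b ≫ left (tensorObj a b) = tensorHom (left a) (𝟙 b)
  triangle : ∀ a b : carrier,
    tensorHom (right a) (𝟙 b) ≫ assoc a unit b ≫ tensorHom (𝟙 a) (left b) = 𝟙 (tensorObj a b)
  right_assoc : ∀ a b : carrier,
    right (tensorObj a b) ≫ assoc a b unit = tensorHom (𝟙 a) (right b)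
  right_left : right unit ≫ left unit = 𝟙 unit

namespace SkewMonCat

attribute [instance] SkewMonCat.category

/-- A (lax) monoidal functor between skew monoidal categories. -/
structure LaxFunctor (C D : SkewMonCat.{v, u}) extends C.carrier ⥤ D.carrier where
  ε : D.unit ⟶ obj C.unit
  μ : ∀ a b : C.carrier, D.tensorObj (obj a) (obj b) ⟶ obj (C.tensorObj a b)
  μ_natural : ∀ {a a' b b' : C.carrier} (f : a ⟶ a') (g : b ⟶ b'),
    D.tensorHom (map f) (map g) ≫ μ a' b' = μ a b ≫ map (C.tensorHom f g)
  associativity : ∀ a b c : C.carrier,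
    D.tensorHom (μ a b) (𝟙 (obj c)) ≫ μ (C.tensorObj a b) c ≫ map (C.assoc a b c) =
      D.assoc (obj a) (obj b) (obj c) ≫ D.tensorHom (𝟙 (obj a)) (μ b c) ≫ μ a (C.tensorObj b c)
  left_unitality : ∀ a : C.carrier,
    D.tensorHom ε (𝟙 (obj a)) ≫ μ C.unit a ≫ map (C.left a) = D.left (obj a)
  right_unitality : ∀ a : C.carrier,
    D.right (obj a) ≫ D.tensorHom (𝟙 (obj a)) ε ≫ μ a C.unit = map (C.right a)

namespace LaxFunctor

/-- The identity monoidal functor. -/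
@[simps! toFunctor ε μ]
def id (C : SkewMonCat.{v, u}) : LaxFunctor C C where
  toFunctor := 𝟭 C.carrier
  ε := 𝟙 _
  μ _ _ := 𝟙 _
  μ_natural := by simp
  associativity := by simp [C.tensor_id]
  left_unitality := by simp [C.tensor_id]
  right_unitality := by simp [C.tensor_id]

lemma tensor_comp_id (C : SkewMonCat.{v, u}) {a a' a'' : C.carrier} (b : C.carrier)
    (f : a ⟶ a') (f' : a' ⟶ a'') :
    C.tensorHom (f ≫ f') (𝟙 b) = C.tensorHom f (𝟙 b) ≫ C.tensorHom f' (𝟙 b) := by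
  rw [← C.tensor_comp, Category.id_comp]

lemma tensor_id_comp (C : SkewMonCat.{v, u}) {a a' a'' : C.carrier} (b : C.carrier)
    (f : a ⟶ a') (f' : a' ⟶ a'') :
    C.tensorHom (𝟙 b) (f ≫ f') = C.tensorHom (𝟙 b) f ≫ C.tensorHom (𝟙 b) f' := by
  rw [← C.tensor_comp, Category.id_comp]

/-- Composition of monoidal functors. -/
@[simps! toFunctor ε μ]
def comp {C D E : SkewMonCat.{v, u}} (F : LaxFunctor C D) (G : LaxFunctor D E) :
    LaxFunctor C E where
  toFunctor := F.toFunctor ⋙ G.toFunctor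
  ε := G.ε ≫ G.map F.ε
  μ a b := G.μ (F.obj a) (F.obj b) ≫ G.map (F.μ a b)
  μ_natural f g := by
    have h := G.μ_natural (F.map f) (F.map g)
    simp only [Functor.comp_map, Functor.comp_obj]
    rw [← Category.assoc, h, Category.assoc, Category.assoc, ← G.map_comp, ← G.map_comp,
      F.μ_natural]
  associativity a b c := by
    simp only [Functor.comp_map, Functor.comp_obj]
    have h1 := G.μ_natural (F.μ a b) (𝟙 (F.obj c))
    have h2 := G.μ_natural (𝟙 (F.obj a)) (F.μ b c)
    have h3 := congrArg G.map (F.associativity a b c)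
    have h4 := G.associativity (F.obj a) (F.obj b) (F.obj c)
    simp only [G.map_id, G.map_comp] at h1 h2 h3
    rw [tensor_comp_id, tensor_id_comp]
    simp only [Category.assoc]
    rw [reassoc_of% h1, h3, reassoc_of% h4, reassoc_of% h2]
  left_unitality a := by
    simp only [Functor.comp_map, Functor.comp_obj]
    have h1 := G.μ_natural F.ε (𝟙 (F.obj a))
    have h3 := congrArg G.map (F.left_unitality a)
    simp only [G.map_id, G.map_comp] at h1 h3
    rw [tensor_comp_id]
    simp only [Category.assoc]
    rw [reassoc_of% h1, h3, G.left_unitality]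
  right_unitality a := by
    simp only [Functor.comp_map, Functor.comp_obj]
    have h1 := G.μ_natural (𝟙 (F.obj a)) F.ε
    have h3 := congrArg G.map (F.right_unitality a)
    have h4 := G.right_unitality (F.obj a)
    simp only [G.map_id, G.map_comp] at h1 h3
    rw [tensor_id_comp]
    simp only [Category.assoc]
    rw [reassoc_of% h1, ← h3, ← h4]
    simp only [Category.assoc]

end LaxFunctor

/-- A monoidal natural transformation. -/
@[ext]
structure Transformation {C D : SkewMonCat.{v, u}} (F G : LaxFunctor C D) where
  app : ∀ a : C.carrier, F.obj a ⟶ G.obj a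
  natural : ∀ {a b : C.carrier} (f : a ⟶ b), F.map f ≫ app b = app a ≫ G.map f
  unit : F.ε ≫ app C.unit = G.ε
  tensor : ∀ a b : C.carrier,
    F.μ a b ≫ app (C.tensorObj a b) = D.tensorHom (app a) (app b) ≫ G.μ a b

namespace Transformation

/-- The identity monoidal transformation. -/
def id {C D : SkewMonCat.{v, u}} (F : LaxFunctor C D) : Transformation F F where
  app a := 𝟙 (F.obj a)
  natural := by simp
  unit := by simp
  tensor := by simp [D.tensor_id]

/-- Vertical composition of monoidal transformations. -/
def comp {C D : SkewMonCat.{v, u}} {F G H : LaxFunctor C D} (φ : Transformation F G)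
    (ψ : Transformation G H) : Transformation F H where
  app a := φ.app a ≫ ψ.app a
  natural f := by rw [← Category.assoc, φ.natural, Category.assoc, ψ.natural, Category.assoc]
  unit := by rw [← Category.assoc, φ.unit, ψ.unit]
  tensor a b := by
    rw [← Category.assoc, φ.tensor, Category.assoc, ψ.tensor, D.tensor_comp, Category.assoc]

/-- Left whiskering of a monoidal transformation by a monoidal functor. -/
def whiskerLeft {C D E : SkewMonCat.{v, u}} (F : LaxFunctor C D) {G H : LaxFunctor D E}
    (φ : Transformation G H) : Transformation (F.comp G) (F.comp H) where
  app a := φ.app (F.obj a)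
  natural f := φ.natural (F.map f)
  unit := by
    change (G.ε ≫ G.map F.ε) ≫ φ.app (F.obj C.unit) = H.ε ≫ H.map F.ε
    rw [Category.assoc, φ.natural, ← Category.assoc, φ.unit]
  tensor a b := by
    change (G.μ _ _ ≫ G.map (F.μ a b)) ≫ φ.app (F.obj _) =
      E.tensorHom (φ.app (F.obj a)) (φ.app (F.obj b)) ≫ H.μ _ _ ≫ H.map (F.μ a b)
    rw [Category.assoc, φ.natural, ← Category.assoc, φ.tensor, Category.assoc]

/-- Right whiskering of a monoidal transformation by a monoidal functor. -/
def whiskerRight {C D E : SkewMonCat.{v, u}} {F G : LaxFunctor C D} (φ : Transformation F G)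
    (H : LaxFunctor D E) : Transformation (F.comp H) (G.comp H) where
  app a := H.map (φ.app a)
  natural f := by
    change H.map (F.map f) ≫ _ = _ ≫ H.map (G.map f)
    rw [← H.map_comp, φ.natural, H.map_comp]
  unit := by
    change (H.ε ≫ H.map F.ε) ≫ H.map (φ.app C.unit) = H.ε ≫ H.map G.ε
    rw [Category.assoc, ← H.map_comp, φ.unit]
  tensor a b := by
    change (H.μ _ _ ≫ H.map (F.μ a b)) ≫ H.map (φ.app _) =
      E.tensorHom (H.map (φ.app a)) (H.map (φ.app b)) ≫ H.μ _ _ ≫ H.map (G.μ a b)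
    rw [Category.assoc, ← H.map_comp, φ.tensor, H.map_comp, ← Category.assoc,
      ← H.μ_natural, Category.assoc]

end Transformation

instance : CategoryStruct SkewMonCat.{v, u} where
  Hom := LaxFunctor
  id := LaxFunctor.id
  comp := LaxFunctor.comp

instance (C D : SkewMonCat.{v, u}) : Category (C ⟶ D) where
  Hom F G := Transformation F G
  id F := Transformation.id F
  comp φ ψ := Transformation.comp φ ψ
  id_comp _ := Transformation.ext (funext fun _ => Category.id_comp _)
  comp_id _ := Transformation.ext (funext fun _ => Category.comp_id _)
  assoc _ _ _ := Transformation.ext (funext fun _ => Category.assoc _ _ _)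

lemma laxFunctor_ext {C D : SkewMonCat.{v, u}} {F G : LaxFunctor C D}
    (h : F.toFunctor = G.toFunctor) (hε : F.ε ≍ G.ε) (hμ : F.μ ≍ G.μ) : F = G := by
  rcases F with ⟨F, _, _⟩
  rcases G with ⟨G, _, _⟩
  cases h
  cases hε
  cases hμ
  rfl

lemma comp_id' {C D : SkewMonCat.{v, u}} (F : C ⟶ D) : F ≫ 𝟙 D = F :=
  laxFunctor_ext rfl (heq_of_eq (Category.id_comp F.ε))
    (heq_of_eq (funext fun a => funext fun b => Category.id_comp (F.μ a b)))

lemma id_comp' {C D : SkewMonCat.{v, u}} (F : C ⟶ D) : 𝟙 C ≫ F = F :=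
  laxFunctor_ext rfl
    (heq_of_eq ((congrArg (F.ε ≫ ·) (F.map_id _)).trans (Category.comp_id F.ε)))
    (heq_of_eq (funext fun a => funext fun b =>
      (congrArg (F.μ a b ≫ ·) (F.map_id _)).trans (Category.comp_id (F.μ a b))))

lemma assoc' {C₁ C₂ C₃ C₄ : SkewMonCat.{v, u}} (F : C₁ ⟶ C₂) (G : C₂ ⟶ C₃) (H : C₃ ⟶ C₄) :
    (F ≫ G) ≫ H = F ≫ G ≫ H :=
  laxFunctor_ext rfl
    (heq_of_eq ((congrArg (H.ε ≫ ·) (H.map_comp G.ε (G.map F.ε))).trans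
      (Category.assoc _ _ _).symm))
    (heq_of_eq (funext fun a => funext fun b =>
      ((congrArg (H.μ _ _ ≫ ·) (H.map_comp (G.μ _ _) (G.map (F.μ a b)))).trans
        (Category.assoc _ _ _).symm)))

lemma whiskerLeft_eqToHom' {C D E : SkewMonCat.{v, u}} (F : C ⟶ D) {G H : D ⟶ E} (h : G = H) :
    Transformation.whiskerLeft F (eqToHom h) = eqToHom (congrArg (F ≫ ·) h) := by
  subst h
  rfl

lemma whiskerRight_eqToHom' {C D E : SkewMonCat.{v, u}} {F G : C ⟶ D} (h : F = G) (H : D ⟶ E) :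
    Transformation.whiskerRight (eqToHom h) H = eqToHom (congrArg (· ≫ H) h) := by
  subst h
  exact Transformation.ext (funext fun _ => CategoryTheory.Functor.map_id (LaxFunctor.toFunctor H) _)

lemma eq_conj {C D : SkewMonCat.{v, u}} {F F' G G' : C ⟶ D} (h : F = F') (h' : G' = G)
    (φ : F ⟶ G) (ψ : F' ⟶ G') (H : ∀ a, Transformation.app φ a ≍ Transformation.app ψ a) :
    φ = eqToHom h ≫ ψ ≫ eqToHom h' := by
  subst h h'
  rw [eqToHom_refl, eqToHom_refl, Category.comp_id, Category.id_comp]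
  exact Transformation.ext (funext fun a => eq_of_heq (H a))

/-- The 2-category of skew monoidal categories, monoidal functors and monoidal natural
transformations; whiskering and composition are those of functors and natural transformations. -/
instance : Bicategory SkewMonCat.{v, u} where
  whiskerLeft F _ _ φ := Transformation.whiskerLeft F φ
  whiskerRight φ H := Transformation.whiskerRight φ H
  associator F G H := eqToIso (assoc' F G H)
  leftUnitor F := eqToIso (id_comp' F)
  rightUnitor F := eqToIso (comp_id' F)
  whiskerLeft_id _ _ := rfl
  whiskerLeft_comp _ _ _ _ _ _ := rfl
  id_whiskerLeft η := eq_conj (id_comp' _) (id_comp' _).symm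
    (Transformation.whiskerLeft (LaxFunctor.id _) η) η fun _ => HEq.rfl
  comp_whiskerLeft F G _ _ η := eq_conj (assoc' _ _ _) (assoc' _ _ _).symm
    (Transformation.whiskerLeft (LaxFunctor.comp F G) η)
    (Transformation.whiskerLeft F (Transformation.whiskerLeft G η)) fun _ => HEq.rfl
  id_whiskerRight _ G := Transformation.ext (funext fun _ => G.map_id _)
  comp_whiskerRight _ _ H := Transformation.ext (funext fun _ => H.map_comp _ _)
  whiskerRight_id η := eq_conj (comp_id' _) (comp_id' _).symm
    (Transformation.whiskerRight η (LaxFunctor.id _)) η fun _ => HEq.rfl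
  whiskerRight_comp η G H := eq_conj (assoc' _ _ _).symm (assoc' _ _ _)
    (Transformation.whiskerRight η (LaxFunctor.comp G H))
    (Transformation.whiskerRight (Transformation.whiskerRight η G) H) fun _ => HEq.rfl
  whisker_assoc F _ _ η H := eq_conj (assoc' _ _ _) (assoc' _ _ _).symm
    (Transformation.whiskerRight (Transformation.whiskerLeft F η) H)
    (Transformation.whiskerLeft F (Transformation.whiskerRight η H)) fun _ => HEq.rfl
  whisker_exchange η θ := Transformation.ext (funext fun _ =>
    (Transformation.natural θ (Transformation.app η _)).symm)
  pentagon _ _ _ _ := by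
    simp only [eqToIso.hom, whiskerLeft_eqToHom', whiskerRight_eqToHom', eqToHom_trans]
  triangle _ _ := by
    simp only [eqToIso.hom, whiskerLeft_eqToHom', whiskerRight_eqToHom', eqToHom_trans]

instance : Bicategory.Strict SkewMonCat.{v, u} where
  id_comp := id_comp'
  comp_id := comp_id'
  assoc := assoc'
  leftUnitor_eqToIso _ := rfl
  rightUnitor_eqToIso _ := rfl
  associator_eqToIso _ _ _ := rfl

end SkewMonCat

/-! ## Skew multicategories and the 2-category `R-Mult` -/

/-- The two objects `t` and `ℓ` of the categories `R_n`. -/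
inductive Tightness : Type
  | tight
  | loose

namespace Tightness

/-- The order `t ≤ ℓ`; its only nonidentity arrow is `λ : t ⟶ ℓ`. -/
instance : PartialOrder Tightness where
  le x y := x = loose → y = loose
  le_refl _ h := h
  le_trans _ _ _ h h' k := h' (h k)
  le_antisymm x y h h' := by
    cases x <;> cases y <;> first
      | rfl | exact absurd (h rfl) (by simp) | exact absurd (h' rfl) (by simp)

/-- Operadic substitution `x(x₁,…,xₙ)`: this is `t` if `x = x₁ = t`, and `ℓ` otherwise. -/
def comp : Tightness → List Tightness → Tightness
  | tight, x :: _ => x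
  | tight, [] => loose
  | loose, _ => loose

lemma comp_mono {x y : Tightness} {xs ys : List Tightness} (h : x ≤ y)
    (hs : List.Forall₂ (· ≤ ·) xs ys) : comp x xs ≤ comp y ys := by
  intro hc
  cases x with
  | loose => rw [h rfl]; rfl
  | tight =>
    cases y with
    | loose => rfl
    | tight =>
      cases hs with
      | nil => rfl
      | cons h _ => exact h hc

end Tightness

/-- Given `P i j k` (for instance "multimaps of type `i` from the list `j` to `k`"),
`Family P [i₁,…,iₙ] [j₁,…,jₙ] [k₁,…,kₙ]` is the product of the `P iᵣ jᵣ kᵣ`: its elements are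
the tuples `(f₁,…,fₙ)` with `fᵣ : P iᵣ jᵣ kᵣ`. -/
inductive Family {I : Type u₁} {J : Type u₂} {K : Type v₁} (P : I → J → K → Type v₂) :
    List I → List J → List K → Type (max u₁ u₂ v₁ v₂)
  | nil : Family P [] [] []
  | cons {i : I} {j : J} {k : K} {is : List I} {js : List J} {ks : List K} :
      P i j k → Family P is js ks → Family P (i :: is) (j :: js) (k :: ks)

namespace Family

section

variable {I : Type u₁} {J : Type u₂} {K : Type v₁} {P : I → J → K → Type v₂}

/-- Concatenation of tuples. -/
def append : ∀ {is is' : List I} {js js' : List J} {ks ks' : List K},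
    Family P is js ks → Family P is' js' ks' → Family P (is ++ is') (js ++ js') (ks ++ ks')
  | _, _, _, _, _, _, nil, gs => gs
  | _, _, _, _, _, _, cons f fs, gs => cons f (append fs gs)

/-- Concatenation of a tuple of tuples. -/
def flatten : ∀ {iss : List (List I)} {jss : List (List J)} {kss : List (List K)},
    Family (Family P) iss jss kss → Family P iss.flatten jss.flatten kss.flatten
  | _, _, _, nil => nil
  | _, _, _, cons fs fss => append fs (flatten fss)

/-- The tuple `(f a₁,…,f aₙ)` indexed by a list `a₁,…,aₙ`. -/
def ofList {A : Type u} {i : A → I} {j : A → J} {k : A → K} (f : ∀ a, P (i a) (j a) (k a)) :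
    ∀ as : List A, Family P (as.map i) (as.map j) (as.map k)
  | [] => nil
  | a :: as => cons (f a) (ofList f as)

/-- Apply a map to each entry of a tuple. -/
def map {J' : Type w₁} {K' : Type w₂} {Q : I → J' → K' → Type v} (φ : J → J') (ψ : K → K')
    (m : ∀ {i j k}, P i j k → Q i (φ j) (ψ k)) :
    ∀ {is : List I} {js : List J} {ks : List K},
      Family P is js ks → Family Q is (js.map φ) (ks.map ψ)
  | _, _, _, nil => nil
  | _, _, _, cons f fs => cons (m f) (map φ ψ m fs)

end

section

variable {A : Type u} {H : Tightness → List A → A → Type v}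

/-- The tuple of identities `(1_{b₁},…,1_{bₙ})`. -/
def ids (one : ∀ a, H .tight [a] a) :
    ∀ bs : List A, Family H (bs.map fun _ => .tight) (bs.map fun a => [a]) bs
  | [] => nil
  | b :: bs => cons (one b) (ids one bs)

/-- Change the types of the entries of a tuple along arrows `xᵣ ≤ yᵣ`. -/
def relax (r : ∀ {x y : Tightness} {as : List A} {b : A}, x ≤ y → H x as b → H y as b) :
    ∀ {xs ys : List Tightness} {ass : List (List A)} {bs : List A},
      List.Forall₂ (· ≤ ·) xs ys → Family H xs ass bs → Family H ys ass bs
  | _, [], _, _, _, nil => nil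
  | _, _ :: _, _, _, hs, cons f fs =>
    cons (r (List.forall₂_cons.1 hs).1 f) (relax r (List.forall₂_cons.1 hs).2 fs)
  | _, _ :: _, _, _, hs, nil => absurd hs (by simp)
  | _, [], _, _, hs, cons _ _ => absurd hs (by simp)

/-- Given `fᵣ` and a tuple `hᵣ` of multimaps into the inputs of `fᵣ`, for each `r`, the tuple of
the substitutions `fᵣ(hᵣ)`. -/
def subst (s : ∀ {x : Tightness} {xs : List Tightness} {ass : List (List A)} {bs : List A} {c : A},
      H x bs c → Family H xs ass bs → H (x.comp xs) ass.flatten c) :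
    ∀ {xs : List Tightness} {yss : List (List Tightness)} {zsss : List (List (List A))}
      {ass : List (List A)} {bs : List A},
      Family H xs ass bs → Family (Family H) yss zsss ass →
        Family H (List.zipWith Tightness.comp xs yss) (zsss.map List.flatten) bs
  | _, _, _, _, _, nil, nil => nil
  | _, _, _, _, _, cons f fs, cons h hs => cons (s f h) (subst s fs hs)

end

end Family

/-- Equality of multimaps whose types and source lists need not be syntactically equal:
`Same f g` says that `f : H x as b` and `g : H y as' b` satisfy `x = y`, `as = as'` and `f = g`. -/
inductive Same {A : Type u} {H : Tightness → List A → A → Type v} {b : A} {x : Tightness}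
    {as : List A} (f : H x as b) : ∀ {y : Tightness} {as' : List A}, H y as' b → Prop
  | refl : Same f f

/-- A skew multicategory: a set of objects, functors
`Hom _ as b : R_n ⥤ Set` for `as` of length `n` (with `relax` the action on arrows, so that
`j = relax (t ≤ ℓ)`), identities and substitution. Since `R_0 = {ℓ}` while `R_n = {t ⟶ ℓ}` for
`n > 0`, there are no tight nullary maps. -/
structure SkewMulticat : Type (max (u + 1) (v + 1)) where
  Obj : Type u
  /-- `Hom x [a₁,…,aₙ] b` is the set of multimaps `a₁,…,aₙ → b` of type `x`. -/
  Hom : Tightness → List Obj → Obj → Type v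
  isEmpty_tight_nil : ∀ b : Obj, IsEmpty (Hom .tight [] b)
  relax : ∀ {x y : Tightness} {as : List Obj} {b : Obj}, x ≤ y → Hom x as b → Hom y as b
  one : ∀ a : Obj, Hom .tight [a] a
  /-- Substitution `(g, (f₁,…,fₙ)) ↦ g(f₁,…,fₙ)`. -/
  subst : ∀ {x : Tightness} {xs : List Tightness} {ass : List (List Obj)} {bs : List Obj} {c : Obj},
    Hom x bs c → Family Hom xs ass bs → Hom (x.comp xs) ass.flatten c
  relax_refl : ∀ {x : Tightness} {as : List Obj} {b : Obj} (f : Hom x as b),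
    relax (le_refl x) f = f
  relax_trans : ∀ {x y z : Tightness} {as : List Obj} {b : Obj} (h : x ≤ y) (h' : y ≤ z)
    (f : Hom x as b), relax (h.trans h') f = relax h' (relax h f)
  /-- Naturality of substitution in `x, x₁, …, xₙ`. -/
  subst_relax : ∀ {x y : Tightness} {xs ys : List Tightness} {ass : List (List Obj)}
    {bs : List Obj} {c : Obj} (h : x ≤ y) (hs : List.Forall₂ (· ≤ ·) xs ys) (g : Hom x bs c)
    (f : Family Hom xs ass bs),
    subst (relax h g) (Family.relax (H := Hom) relax hs f) = relax (Tightness.comp_mono h hs) (subst g f)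
  one_subst : ∀ {x : Tightness} {as : List Obj} {b : Obj} (f : Hom x as b),
    Same (H := Hom) (subst (one b) (.cons f .nil)) f
  subst_one : ∀ {x : Tightness} {as : List Obj} {b : Obj} (f : Hom x as b),
    Same (H := Hom) (subst f (Family.ids (H := Hom) one as)) f
  subst_assoc : ∀ {x : Tightness} {xs : List Tightness} {yss : List (List Tightness)}
    {zsss : List (List (List Obj))} {ass : List (List Obj)} {bs : List Obj} {c : Obj}
    (g : Hom x bs c) (f : Family Hom xs ass bs) (h : Family (Family Hom) yss zsss ass),
    Same (H := Hom) (subst (subst g f) h.flatten)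
      (subst g (Family.subst (H := Hom) subst f h))

namespace SkewMulticat

/-- A morphism of skew multicategories: a map on objects and maps on multimaps of each type,
natural in the type (so commuting with `j`) and preserving identities and substitution. -/
structure Morphism (A B : SkewMulticat.{v, u}) where
  obj : A.Obj → B.Obj
  map : ∀ {x : Tightness} {as : List A.Obj} {b : A.Obj},
    A.Hom x as b → B.Hom x (as.map obj) (obj b)
  map_relax : ∀ {x y : Tightness} {as : List A.Obj} {b : A.Obj} (h : x ≤ y) (f : A.Hom x as b),
    map (A.relax h f) = B.relax h (map f)
  map_one : ∀ a : A.Obj, map (A.one a) = B.one (obj a)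
  map_subst : ∀ {x : Tightness} {xs : List Tightness} {ass : List (List A.Obj)} {bs : List A.Obj}
    {c : A.Obj} (g : A.Hom x bs c) (f : Family A.Hom xs ass bs),
    Same (H := B.Hom) (map (A.subst g f)) (B.subst (map g) (f.map (Q := B.Hom) (List.map obj) obj map))

/-- A 2-cell between morphisms of skew multicategories: tight unary maps `φ_a : F a → G a` with
`φ_b(F f) = (G f)(φ_{a₁},…,φ_{aₙ})` for every multimap `f : a₁,…,aₙ → b` of any type. -/
@[ext]
structure Transformation {A B : SkewMulticat.{v, u}} (F G : Morphism A B) where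
  app : ∀ a : A.Obj, B.Hom .tight [F.obj a] (G.obj a)
  natural : ∀ {x : Tightness} {as : List A.Obj} {b : A.Obj} (f : A.Hom x as b),
    Same (H := B.Hom) (B.subst (app b) (.cons (F.map f) .nil))
      (B.subst (G.map f) (.ofList (P := B.Hom) (i := fun _ => .tight)
        (j := fun a => [F.obj a]) (k := G.obj) app as))

end SkewMulticat

/-! ### Auxiliary facts on equality of multimaps and of tuples of multimaps -/

/-- Equality of tuples whose indices need not be syntactically equal. -/
inductive FSame {I : Type u₁} {J : Type u₂} {K : Type v₁} {P : I → J → K → Type v₂}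
    {is : List I} {js : List J} {ks : List K} (f : Family P is js ks) :
    ∀ {is' : List I} {js' : List J} {ks' : List K}, Family P is' js' ks' → Prop
  | refl : FSame f f

section

variable {A : Type u} {H : Tightness → List A → A → Type v}

lemma Same.symm {x y : Tightness} {as as' : List A} {b : A} {f : H x as b} {g : H y as' b}
    (h : Same f g) : Same g f := by
  cases h; exact .refl

lemma Same.trans {x y z : Tightness} {as as' as'' : List A} {b : A} {f : H x as b}
    {g : H y as' b} {k : H z as'' b} (h : Same f g) (h' : Same g k) : Same f k := by
  cases h; exact h'

lemma Same.eq {x : Tightness} {as : List A} {b : A} {f g : H x as b} (h : Same f g) : f = g := by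
  cases h; rfl

lemma Same.heq {x y : Tightness} {as as' : List A} {b : A} {f : H x as b} {g : H y as' b}
    (h : Same f g) : f ≍ g := by
  cases h; rfl

lemma Same.of_eq {x : Tightness} {as : List A} {b : A} {f g : H x as b} (h : f = g) :
    Same f g := by
  cases h; exact .refl

/-- Transport of a multimap along an equality of source lists. -/
def castObjs {x : Tightness} {as as' : List A} {b : A} (h : as = as') (f : H x as b) : H x as' b :=
  h ▸ f

lemma same_cast {x : Tightness} {as as' : List A} {b : A} (h : as = as') (f : H x as b) :
    Same (castObjs h f) f := by
  subst h; exact .refl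

lemma FSame.cons {x y : Tightness} {as as' : List A} {b : A} {xs ys : List Tightness}
    {ass bss : List (List A)} {bs cs : List A} {f : H x as b} {g : H y as' b}
    {fs : Family H xs ass bs} {gs : Family H ys bss cs} (h : Same f g) (hs : FSame fs gs) :
    FSame (Family.cons f fs) (Family.cons g gs) := by
  cases h; cases hs; exact .refl

end

section

variable {I : Type u₁} {J : Type u₂} {K : Type v₁} {P : I → J → K → Type v₂}

lemma FSame.symm {is is' : List I} {js js' : List J} {ks ks' : List K} {f : Family P is js ks}
    {g : Family P is' js' ks'} (h : FSame f g) : FSame g f := by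
  cases h; exact .refl

lemma FSame.trans {is is' is'' : List I} {js js' js'' : List J} {ks ks' ks'' : List K}
    {f : Family P is js ks} {g : Family P is' js' ks'} {k : Family P is'' js'' ks''}
    (h : FSame f g) (h' : FSame g k) : FSame f k := by
  cases h; exact h'

lemma FSame.cons' {i : I} {j : J} {k : K} {is is' : List I} {js js' : List J} {ks ks' : List K}
    (p : P i j k) {f : Family P is js ks} {g : Family P is' js' ks'} (h : FSame f g) :
    FSame (Family.cons p f) (Family.cons p g) := by
  cases h; exact .refl

lemma Family.append_nil {is : List I} {js : List J} {ks : List K} (f : Family P is js ks) :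
    FSame (f.append .nil) f := by
  induction f with
  | nil => exact .refl
  | cons p f ih => exact .cons' p ih

lemma Family.flatten_ofList {A : Type u} {i : A → I} {j : A → J} {k : A → K}
    (f : ∀ a, P (i a) (j a) (k a)) (as : List A) :
    FSame (Family.flatten (Family.ofList (P := Family P) (i := fun a => [i a])
      (j := fun a => [j a]) (k := fun a => [k a]) (fun a => .cons (f a) .nil) as))
      (Family.ofList f as) := by
  induction as with
  | nil => exact .refl
  | cons a as ih => exact .cons' (f a) ih

lemma Family.ofList_map {A : Type u} {B : Type v} (φ : A → B) {i : B → I} {j : B → J} {k : B → K}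
    (f : ∀ a, P (i a) (j a) (k a)) (as : List A) :
    FSame (Family.ofList f (as.map φ))
      (Family.ofList (i := fun a => i (φ a)) (j := fun a => j (φ a)) (k := fun a => k (φ a))
        (fun a => f (φ a)) as) := by
  induction as with
  | nil => exact .refl
  | cons a as ih => exact .cons' (f (φ a)) ih

end

namespace SkewMulticat

variable {A B C D : SkewMulticat.{v, u}}

lemma subst_congr {x y : Tightness} {xs ys : List Tightness} {ass ass' : List (List A.Obj)}
    {bs bs' : List A.Obj} {c : A.Obj} {g : A.Hom x bs c} {g' : A.Hom y bs' c}
    {f : Family A.Hom xs ass bs} {f' : Family A.Hom ys ass' bs'}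
    (hg : Same g g') (hf : FSame f f') :
    Same (H := A.Hom) (A.subst g f) (A.subst g' f') := by
  cases hf; cases hg; exact .refl

lemma castObjs_relax {x y : Tightness} {as as' : List A.Obj} {b : A.Obj} (e : as = as')
    (h : x ≤ y) (f : A.Hom x as b) :
    castObjs (H := A.Hom) e (A.relax h f) = A.relax h (castObjs (H := A.Hom) e f) := by
  subst e; rfl

lemma ofList_one (F : B.Obj → A.Obj) (as : List B.Obj) :
    FSame (Family.ofList (P := A.Hom) (i := fun _ => .tight) (j := fun a => [F a]) (k := F)
      (fun a => A.one (F a)) as) (Family.ids (H := A.Hom) A.one (as.map F)) := by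
  induction as with
  | nil => exact .refl
  | cons a as ih => exact .cons' _ ih

namespace Morphism

lemma map_same (F : Morphism A B) {x y : Tightness} {as as' : List A.Obj} {b : A.Obj}
    {f : A.Hom x as b} {g : A.Hom y as' b} (h : Same f g) :
    Same (H := B.Hom) (F.map f) (F.map g) := by
  cases h; exact .refl

/-- The identity morphism. -/
def id (A : SkewMulticat.{v, u}) : Morphism A A where
  obj a := a
  map {_ as _} f := castObjs (H := A.Hom) (List.map_id' as).symm f
  map_relax h f := castObjs_relax _ h f
  map_one _ := rfl
  map_subst {_ _ _ _ _} g f := by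
    refine (same_cast _ _).trans (subst_congr (same_cast _ _).symm ?_)
    clear g
    induction f with
    | nil => exact .refl
    | cons f fs ih => exact .cons (same_cast _ _).symm ih

/-- Composition of morphisms. -/
def comp (F : Morphism A B) (G : Morphism B C) : Morphism A C where
  obj a := G.obj (F.obj a)
  map f := castObjs (H := C.Hom) List.map_map (G.map (F.map f))
  map_relax h f := by rw [F.map_relax, G.map_relax, castObjs_relax]
  map_one a := (same_cast (H := C.Hom) _ _).eq.trans (by rw [F.map_one, G.map_one])
  map_subst g f := by
    refine (same_cast _ _).trans ((G.map_same (F.map_subst g f)).trans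
      ((G.map_subst _ _).trans (subst_congr (same_cast _ _).symm ?_)))
    clear g
    induction f with
    | nil => exact .refl
    | cons f fs ih => exact .cons (same_cast _ _).symm ih

lemma ext_heq {F G : Morphism A B} (h : ∀ a, F.obj a = G.obj a)
    (hm : ∀ {x : Tightness} {as : List A.Obj} {b : A.Obj} (f : A.Hom x as b),
      F.map f ≍ G.map f) : F = G := by
  rcases F with ⟨F, Fm, _, _, _⟩
  rcases G with ⟨G, Gm, _, _, _⟩
  obtain rfl : F = G := funext h
  have : @Fm = @Gm := by
    funext x as b f
    exact eq_of_heq (hm f)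
  subst this
  rfl

end Morphism

namespace Transformation

/-- The identity 2-cell. -/
def id (F : Morphism A B) : Transformation F F where
  app a := B.one (F.obj a)
  natural f := (B.one_subst _).trans ((B.subst_one _).symm.trans
    (subst_congr .refl (ofList_one F.obj _).symm))

/-- Vertical composition of 2-cells. -/
def comp {F G H : Morphism A B} (φ : Transformation F G) (ψ : Transformation G H) :
    Transformation F H where
  app a := B.subst (ψ.app a) (.cons (φ.app a) .nil)
  natural {x as b} f := by
    refine (B.subst_assoc (ψ.app b) (.cons (φ.app b) .nil)
      (.cons (.cons (F.map f) .nil) .nil)).trans ?_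
    refine (subst_congr .refl (.cons (φ.natural f) .refl)).trans ?_
    refine (B.subst_assoc (ψ.app b) (.cons (G.map f) .nil) (.cons (.ofList φ.app as) .nil)).symm.trans ?_
    refine (subst_congr (ψ.natural f) ((Family.append_nil _).trans
      (Family.flatten_ofList φ.app as).symm)).trans ?_
    refine (B.subst_assoc _ _ _).trans (subst_congr .refl ?_)
    clear f
    induction as with
    | nil => exact .refl
    | cons a as ih => exact .cons .refl ih

/-- Left whiskering. -/
def whiskerLeft (F : Morphism A B) {G H : Morphism B C} (φ : Transformation G H) :
    Transformation (F.comp G) (F.comp H) where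
  app a := φ.app (F.obj a)
  natural f := (subst_congr .refl (.cons (same_cast _ _) .refl)).trans
    ((φ.natural (F.map f)).trans (subst_congr (same_cast _ _).symm
      (Family.ofList_map F.obj φ.app _)))

/-- Right whiskering. -/
def whiskerRight {F G : Morphism A B} (φ : Transformation F G) (H : Morphism B C) :
    Transformation (F.comp H) (G.comp H) where
  app a := H.map (φ.app a)
  natural {x as b} f := by
    refine (subst_congr .refl (.cons (same_cast _ _) .refl)).trans
      ((H.map_subst (φ.app b) (.cons (F.map f) .nil)).symm.trans
        ((H.map_same (φ.natural f)).trans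
          ((H.map_subst _ _).trans (subst_congr (same_cast _ _).symm ?_))))
    clear f
    induction as with
    | nil => exact .refl
    | cons a as ih => exact .cons .refl ih

end Transformation

instance : CategoryStruct SkewMulticat.{v, u} where
  Hom := Morphism
  id := Morphism.id
  comp := Morphism.comp

instance (A B : SkewMulticat.{v, u}) : Category (A ⟶ B) where
  Hom F G := Transformation F G
  id F := Transformation.id F
  comp φ ψ := Transformation.comp φ ψ
  id_comp φ := Transformation.ext (funext fun a =>
    (B.subst_one (Transformation.app φ a)).eq)
  comp_id φ := Transformation.ext (funext fun a =>
    (B.one_subst (Transformation.app φ a)).eq)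
  assoc φ ψ χ := Transformation.ext (funext fun a =>
    (B.subst_assoc (Transformation.app χ a) (.cons (Transformation.app ψ a) .nil)
      (.cons (.cons (Transformation.app φ a) .nil) .nil)).eq.symm)

lemma comp_id' (F : A ⟶ B) : F ≫ 𝟙 B = F :=
  Morphism.ext_heq (fun _ => rfl) fun _ => ((same_cast _ _).trans (same_cast _ _)).heq

lemma id_comp' (F : A ⟶ B) : 𝟙 A ≫ F = F :=
  Morphism.ext_heq (fun _ => rfl) fun _ =>
    ((same_cast _ _).trans (Morphism.map_same F (same_cast _ _))).heq

lemma assoc' (F : A ⟶ B) (G : B ⟶ C) (H : C ⟶ D) : (F ≫ G) ≫ H = F ≫ G ≫ H :=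
  Morphism.ext_heq (fun _ => rfl) fun _ =>
    ((same_cast _ _).trans ((Morphism.map_same H (same_cast _ _)).trans
      ((same_cast _ _).trans (same_cast _ _)).symm)).heq

lemma whiskerLeft_eqToHom' (F : A ⟶ B) {G H : B ⟶ C} (h : G = H) :
    Transformation.whiskerLeft F (eqToHom h) = eqToHom (congrArg (F ≫ ·) h) := by
  subst h
  rfl

lemma whiskerRight_eqToHom' {F G : A ⟶ B} (h : F = G) (H : B ⟶ C) :
    Transformation.whiskerRight (eqToHom h) H = eqToHom (congrArg (· ≫ H) h) := by
  subst h
  exact Transformation.ext (funext fun _ => Morphism.map_one H _)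

lemma eq_conj {F F' G G' : A ⟶ B} (h : F = F') (h' : G' = G) (φ : F ⟶ G) (ψ : F' ⟶ G')
    (H : ∀ a, Transformation.app φ a ≍ Transformation.app ψ a) : φ = eqToHom h ≫ ψ ≫ eqToHom h' := by
  subst h h'
  rw [eqToHom_refl, eqToHom_refl, Category.comp_id, Category.id_comp]
  exact Transformation.ext (funext fun a => eq_of_heq (H a))

/-- The 2-category of skew multicategories, their morphisms and their 2-cells. -/
instance : Bicategory SkewMulticat.{v, u} where
  whiskerLeft F _ _ φ := Transformation.whiskerLeft F φ
  whiskerRight φ H := Transformation.whiskerRight φ H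
  associator F G H := eqToIso (assoc' F G H)
  leftUnitor F := eqToIso (id_comp' F)
  rightUnitor F := eqToIso (comp_id' F)
  whiskerLeft_id _ _ := rfl
  whiskerLeft_comp _ _ _ _ _ _ := rfl
  id_whiskerLeft η := eq_conj (id_comp' _) (id_comp' _).symm
    (Transformation.whiskerLeft (Morphism.id _) η) η fun _ => HEq.rfl
  comp_whiskerLeft F G _ _ η := eq_conj (assoc' _ _ _) (assoc' _ _ _).symm
    (Transformation.whiskerLeft (Morphism.comp F G) η)
    (Transformation.whiskerLeft F (Transformation.whiskerLeft G η)) fun _ => HEq.rfl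
  id_whiskerRight _ G := Transformation.ext (funext fun _ => Morphism.map_one G _)
  comp_whiskerRight _ _ H := Transformation.ext (funext fun _ => (Morphism.map_subst H _ _).eq)
  whiskerRight_id η := eq_conj (comp_id' _) (comp_id' _).symm
    (Transformation.whiskerRight η (Morphism.id _)) η fun _ => HEq.rfl
  whiskerRight_comp η G H := eq_conj (assoc' _ _ _).symm (assoc' _ _ _)
    (Transformation.whiskerRight η (Morphism.comp G H))
    (Transformation.whiskerRight (Transformation.whiskerRight η G) H) fun _ => HEq.rfl
  whisker_assoc F _ _ η H := eq_conj (assoc' _ _ _) (assoc' _ _ _).symm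
    (Transformation.whiskerRight (Transformation.whiskerLeft F η) H)
    (Transformation.whiskerLeft F (Transformation.whiskerRight η H)) fun _ => HEq.rfl
  whisker_exchange η θ := Transformation.ext (funext fun _ =>
    (Transformation.natural θ (Transformation.app η _)).eq.symm)
  pentagon _ _ _ _ := by
    simp only [eqToIso.hom, whiskerLeft_eqToHom', whiskerRight_eqToHom', eqToHom_trans]
  triangle _ _ := by
    simp only [eqToIso.hom, whiskerLeft_eqToHom', whiskerRight_eqToHom', eqToHom_trans]

instance : Bicategory.Strict SkewMulticat.{v, u} where
  id_comp := id_comp'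
  comp_id := comp_id'
  assoc := assoc'
  leftUnitor_eqToIso _ := rfl
  rightUnitor_eqToIso _ := rfl
  associator_eqToIso _ _ _ := rfl

/-! ### Left representability -/

/-- `θ : a₁,…,aₙ → m` is universal: `- ∘₁ θ : A_t(m; b) → A_x(a₁,…,aₙ; b)` is a bijection
for all `b`. -/
def IsUniversal (A : SkewMulticat.{v, u}) {x : Tightness} {as : List A.Obj} {m : A.Obj}
    (θ : A.Hom x as m) : Prop :=
  ∀ b : A.Obj, Function.Bijective fun g : A.Hom .tight [m] b =>
    A.subst g (.cons θ .nil)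

/-- `θ : a₁,…,aₙ → m` is left universal: the function
`- ∘₁ θ : A_t(m, b₁, …, bₖ; c) → A_x(a₁, …, aₙ, b₁, …, bₖ; c)`, sending `g` to
`g(θ, 1, …, 1)`, is a bijection for all `b₁, …, bₖ` and `c`. -/
def IsLeftUniversal (A : SkewMulticat.{v, u}) {x : Tightness} {as : List A.Obj} {m : A.Obj}
    (θ : A.Hom x as m) : Prop :=
  ∀ (bs : List A.Obj) (c : A.Obj), Function.Bijective fun g : A.Hom .tight (m :: bs) c =>
    A.subst g (.cons θ (.ids A.one bs))

/-- Every `x ∈ R_n` and `a₁,…,aₙ` admit a universal multimap of type `x`. (If `n = 0`, then `x`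
can only be `ℓ`.) -/
def WeaklyRepresentable (A : SkewMulticat.{v, u}) : Prop :=
  ∀ (x : Tightness) (as : List A.Obj), (as = [] → x = .loose) →
    ∃ (m : A.Obj) (θ : A.Hom x as m), A.IsUniversal θ

/-- A skew multicategory is left representable if it is weakly representable and all universal
multimaps are left universal. -/
def LeftRepresentable (A : SkewMulticat.{v, u}) : Prop :=
  A.WeaklyRepresentable ∧
    ∀ (x : Tightness) (as : List A.Obj) (m : A.Obj) (θ : A.Hom x as m),
      A.IsUniversal θ → A.IsLeftUniversal θ

end SkewMulticat

/-- The full sub-2-category of skew multicategories on the left representable ones. -/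
abbrev LeftRepSkewMulticat : Type (max (u + 1) (v + 1)) :=
  Bicategory.InducedBicategory SkewMulticat.{v, u}
    (Subtype.val : {A : SkewMulticat.{v, u} // A.LeftRepresentable} → SkewMulticat.{v, u})

/-! ## 2-equivalences -/

section

open Bicategory

variable {K : Type u₁} [Bicategory.{w₁, v₁} K] {L : Type u₂} [Bicategory.{w₂, v₂} L]

/-- A 2-natural isomorphism between 2-functors: a family of isomorphisms
`F X ≅ G X`, strictly natural with respect to 1-cells and 2-cells. -/
structure TwoNatIso (F G : StrictPseudofunctor K L) where
  hom : ∀ X : K, F.obj X ⟶ G.obj X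
  inv : ∀ X : K, G.obj X ⟶ F.obj X
  hom_inv : ∀ X : K, hom X ≫ inv X = 𝟙 (F.obj X)
  inv_hom : ∀ X : K, inv X ≫ hom X = 𝟙 (G.obj X)
  naturality : ∀ {X Y : K} (f : X ⟶ Y), F.map f ≫ hom Y = hom X ≫ G.map f
  naturality₂ : ∀ {X Y : K} {f g : X ⟶ Y} (η : f ⟶ g),
    F.map₂ η ▷ hom Y ≫ eqToHom (naturality g) = eqToHom (naturality f) ≫ hom X ◁ G.map₂ η

/-- A 2-equivalence between 2-categories: 2-functors in both directions whose composites are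
2-naturally isomorphic to the identities. -/
structure TwoEquivalence (K : Type u₁) [Bicategory.{w₁, v₁} K] [Bicategory.Strict K]
    (L : Type u₂) [Bicategory.{w₂, v₂} L] [Bicategory.Strict L] where
  functor : StrictPseudofunctor K L
  inverse : StrictPseudofunctor L K
  unit : TwoNatIso (StrictPseudofunctor.id K) (functor.comp inverse)
  counit : TwoNatIso (inverse.comp functor) (StrictPseudofunctor.id L)

end

/-! From monoidal to multi. Left-bracketed products make lists of objects act on `C` from the right.
Tight multimaps `a₁,…,aₙ → b` are maps out of the left-bracketed product of the `aᵣ`; loose ones are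
maps out of the same product begun with `i`. A multimap of either type induces a family `c ⊗ ā ⟶ c ⊗
b` (`Multimap.ext`), built from `α`, and from `ρ` in the loose case. This family is natural in `c`,
compatible with `α` (`ext_assoc`) and unchanged by relaxation, by the triangle axiom (`ext_relax`);
evaluated at `i` and followed by `λ` it gives back the underlying loose map (`ext_unit_left`).
Substitution becomes composition of these actions (`ext_subst`, `famExt_flatten`), and the
multicategory axioms follow. A universal multimap is exactly an invertible map of `C`; tensoring on
the right keeps it invertible, so it is left universal.

From multi to monoidal. Choose universal maps `a,b → a ⊗ b` (tight) and `() → i` (loose). Left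
universal maps are closed under substitution into the first input (`LeftUniv.head`), so every
left-bracketed product of these is left universal. Hence `α` and `λ` can be defined, and all axioms
checked, by precomposing with universal multimaps. Each constraint is computed on a product of
arbitrary multimaps (`post_assoc`, `post_left`, `post_right`), after which both sides of an axiom
become the same multimap. Morphisms give lax functors in the same way.

Round trips. The identities of `a ⊗ b` and `i` represent the multicategory of `C` and return `C`
itself; two representations of one multicategory are isomorphic through the lax functors induced by
the identity morphism. Conversely, precomposition with `1 ⊗ … ⊗ 1`, or with `point ⊗ 1 ⊗ … ⊗ 1`, is
a bijection by left universality, and it respects substitution (`toHom_subst`). All comparisons are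
the identity on objects, so naturality is strict.

Source lists such as `ass.flatten` often agree only propositionally. `Same` hides this for multimaps
and `eqToHom` carries it for maps of `C`. -/

lemma Tightness.le_loose (x : Tightness) : x ≤ .loose := fun _ => rfl

namespace SkewMonCat

/-! ### Left-bracketed products and their coherence maps -/

section Action

variable (C : SkewMonCat.{v, u})

/-- The left-bracketed tensor product `(…((c ⊗ a₁) ⊗ a₂) … ) ⊗ aₙ`. -/
@[reducible] def act : C.carrier → List C.carrier → C.carrier
  | c, [] => c
  | c, a :: as => act (C.tensorObj c a) as

variable {C}

@[simp] lemma act_nil (c : C.carrier) : C.act c [] = c := rfl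

@[simp] lemma act_cons (c a : C.carrier) (as : List C.carrier) :
    C.act c (a :: as) = C.act (C.tensorObj c a) as := rfl

lemma act_append (c : C.carrier) (as bs : List C.carrier) :
    C.act c (as ++ bs) = C.act (C.act c as) bs := by
  induction as generalizing c with
  | nil => rfl
  | cons a as ih => exact ih _

lemma act_congr (c : C.carrier) {as bs : List C.carrier} (h : as = bs) :
    C.act c as = C.act c bs := by rw [h]

/-- Functoriality of `act` in its first variable. -/
def actHom : ∀ {c c' : C.carrier} (_ : c ⟶ c') (as : List C.carrier), C.act c as ⟶ C.act c' as
  | _, _, f, [] => f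
  | _, _, f, a :: as => actHom (C.tensorHom f (𝟙 a)) as

@[simp] lemma actHom_nil {c c' : C.carrier} (f : c ⟶ c') : actHom f [] = f := rfl

@[simp] lemma actHom_cons {c c' : C.carrier} (f : c ⟶ c') (a : C.carrier) (as : List C.carrier) :
    actHom f (a :: as) = actHom (C.tensorHom f (𝟙 a)) as := rfl

@[simp] lemma actHom_id (c : C.carrier) (as : List C.carrier) : actHom (𝟙 c) as = 𝟙 _ := by
  induction as generalizing c with
  | nil => rfl
  | cons a as ih => rw [actHom_cons, C.tensor_id, ih]

lemma actHom_comp {c c' c'' : C.carrier} (f : c ⟶ c') (g : c' ⟶ c'') (as : List C.carrier) :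
    actHom (f ≫ g) as = actHom f as ≫ actHom g as := by
  induction as generalizing c c' c'' with
  | nil => rfl
  | cons a as ih => rw [actHom_cons, LaxFunctor.tensor_comp_id, ih]; rfl

lemma actHom_eqToHom {c c' : C.carrier} (h : c = c') (as : List C.carrier) :
    actHom (eqToHom h) as = eqToHom (by rw [h]) := by
  subst h; simp

lemma tensorHom_eqToHom (a : C.carrier) {c c' : C.carrier} (h : c = c') :
    C.tensorHom (𝟙 a) (eqToHom h) = eqToHom (by rw [h]) := by
  subst h; simp [C.tensor_id]

lemma eqToHom_actHom {c c' : C.carrier} (f : c ⟶ c') {as bs : List C.carrier} (h : as = bs) :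
    eqToHom (act_congr c h) ≫ actHom f bs = actHom f as ≫ eqToHom (act_congr c' h) := by
  subst h; simp

lemma actHom_congr {c c' : C.carrier} (f : c ⟶ c') {as bs : List C.carrier} (h : as = bs) :
    actHom f as = eqToHom (act_congr c h) ≫ actHom f bs ≫ eqToHom (act_congr c' h).symm := by
  subst h; simp

lemma actHom_append {c c' : C.carrier} (f : c ⟶ c') (as bs : List C.carrier) :
    actHom f (as ++ bs) =
      eqToHom (act_append c as bs) ≫ actHom (actHom f as) bs ≫
        eqToHom (act_append c' as bs).symm := by
  induction as generalizing c c' with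
  | nil => simp
  | cons a as ih => exact ih _

variable (C) in
/-- The comparison `(d ⊗ c) ⊗ a₁ ⊗ … ⊗ aₙ ⟶ d ⊗ (c ⊗ a₁ ⊗ … ⊗ aₙ)`, all products bracketed to
the left. -/
def assocAct : ∀ (d c : C.carrier) (as : List C.carrier),
    C.act (C.tensorObj d c) as ⟶ C.tensorObj d (C.act c as)
  | _, _, [] => 𝟙 _
  | d, c, a :: as => actHom (C.assoc d c a) as ≫ assocAct d (C.tensorObj c a) as

@[simp] lemma assocAct_nil (d c : C.carrier) : C.assocAct d c [] = 𝟙 _ := rfl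

@[simp] lemma assocAct_cons (d c a : C.carrier) (as : List C.carrier) :
    C.assocAct d c (a :: as) = actHom (C.assoc d c a) as ≫ C.assocAct d (C.tensorObj c a) as := rfl

lemma assocAct_natural {d d' c c' : C.carrier} (f : d ⟶ d') (g : c ⟶ c') (as : List C.carrier) :
    actHom (C.tensorHom f g) as ≫ C.assocAct d' c' as =
      C.assocAct d c as ≫ C.tensorHom f (actHom g as) := by
  induction as generalizing c c' with
  | nil => simp
  | cons a as ih =>
    simp only [actHom_cons, assocAct_cons, Category.assoc, ← ih, ← reassoc_of% @actHom_comp,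
      C.assoc_natural]

/-- Each letter of the list costs one use of the pentagon axiom; the rest is naturality. -/
lemma assocAct_pentagon (d c b : C.carrier) (as : List C.carrier) :
    C.assocAct (C.tensorObj d c) b as ≫ C.assoc d c (C.act b as) =
      actHom (C.assoc d c b) as ≫ C.assocAct d (C.tensorObj c b) as ≫
        C.tensorHom (𝟙 d) (C.assocAct c b as) := by
  induction as generalizing b with
  | nil => simp [C.tensor_id]
  | cons a as ih =>
    simp only [actHom_cons, assocAct_cons, Category.assoc, LaxFunctor.tensor_id_comp]
    rw [ih, ← reassoc_of% @actHom_comp, C.pentagon, reassoc_of% @actHom_comp,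
      reassoc_of% @actHom_comp, reassoc_of% @assocAct_natural]

/-- Iterates the axiom `λ_{a⊗b} α = λ_a ⊗ 1` along the list. -/
lemma assocAct_left (a : C.carrier) (as : List C.carrier) :
    C.assocAct C.unit a as ≫ C.left (C.act a as) = actHom (C.left a) as := by
  induction as generalizing a with
  | nil => simp
  | cons b as ih =>
    simp only [actHom_cons, assocAct_cons, Category.assoc]
    rw [ih, ← actHom_comp, C.assoc_left]

lemma assocAct_append (d c : C.carrier) (as bs : List C.carrier) :
    C.assocAct d c (as ++ bs) =
      eqToHom (act_append _ as bs) ≫ actHom (C.assocAct d c as) bs ≫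
        C.assocAct d (C.act c as) bs ≫
          C.tensorHom (𝟙 d) (eqToHom (act_append c as bs).symm) := by
  induction as generalizing c with
  | nil => simp [C.tensor_id]
  | cons a as ih =>
    simp only [List.cons_append, assocAct_cons]
    rw [ih, actHom_append]
    simp [actHom_comp]

end Action

/-! ### Multimaps of a skew monoidal category and their action -/

section Multimaps

variable (C : SkewMonCat.{v, u})

/-- The multimaps of the skew multicategory associated to a skew monoidal category: a tight
multimap `a₁,…,aₙ → b` (with `n > 0`) is a map `a₁ ⊗ … ⊗ aₙ ⟶ b` and a loose one is a map
`i ⊗ a₁ ⊗ … ⊗ aₙ ⟶ b`, products being bracketed to the left. -/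
@[reducible] def Multimap : Tightness → List C.carrier → C.carrier → Type v
  | .tight, [], _ => PEmpty
  | .tight, a :: as, b => C.act a as ⟶ b
  | .loose, as, b => C.act C.unit as ⟶ b

variable {C}

namespace Multimap

/-- The loose multimap underlying a multimap. -/
def relax : ∀ {x y : Tightness} {as : List C.carrier} {b : C.carrier},
    x ≤ y → C.Multimap x as b → C.Multimap y as b
  | .tight, .tight, _, _, _, f => f
  | .loose, .loose, _, _, _, f => f
  | .tight, .loose, a :: as, _, _, f => actHom (C.left a) as ≫ f
  | .loose, .tight, _, _, h, _ => absurd (h rfl) (by simp)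

/-- A multimap `f : a₁,…,aₙ → b` acts by maps `c ⊗ a₁ ⊗ … ⊗ aₙ ⟶ c ⊗ b`. -/
def ext : ∀ {x : Tightness} {as : List C.carrier} {b : C.carrier},
    C.Multimap x as b → ∀ c : C.carrier, C.act c as ⟶ C.tensorObj c b
  | .tight, a :: as, _, f, c => C.assocAct c a as ≫ C.tensorHom (𝟙 c) f
  -- The map `ρ_c` opens a slot `i` to the right of `c`, which is where a loose map starts.
  | .loose, as, _, f, c => actHom (C.right c) as ≫ C.assocAct c C.unit as ≫ C.tensorHom (𝟙 c) f

lemma ext_tight {a : C.carrier} {as : List C.carrier} {b : C.carrier} (f : C.act a as ⟶ b)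
    (c : C.carrier) :
    ext (C := C) (x := .tight) (as := a :: as) f c = C.assocAct c a as ≫ C.tensorHom (𝟙 c) f := rfl

lemma ext_loose {as : List C.carrier} {b : C.carrier} (f : C.act C.unit as ⟶ b) (c : C.carrier) :
    ext (C := C) (x := .loose) (as := as) f c =
      actHom (C.right c) as ≫ C.assocAct c C.unit as ≫ C.tensorHom (𝟙 c) f := rfl

lemma tensorHom_right_comm {a a' b b' : C.carrier} (f : a ⟶ a') (g : b ⟶ b') :
    C.tensorHom f (𝟙 b) ≫ C.tensorHom (𝟙 a') g = C.tensorHom (𝟙 a) g ≫ C.tensorHom f (𝟙 b') := by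
  simp only [← C.tensor_comp, Category.id_comp, Category.comp_id]

lemma ext_natural {x : Tightness} {as : List C.carrier} {b : C.carrier} (f : C.Multimap x as b)
    {c c' : C.carrier} (h : c ⟶ c') :
    actHom h as ≫ f.ext c' = f.ext c ≫ C.tensorHom h (𝟙 b) := by
  match x, as, f with
  | .tight, a :: as, f =>
    simp only [ext_tight, Category.assoc, actHom_cons]
    rw [reassoc_of% @assocAct_natural, actHom_id, tensorHom_right_comm]
  | .loose, as, f =>
    simp only [ext_loose, Category.assoc]
    rw [← reassoc_of% @actHom_comp, C.right_natural, reassoc_of% @actHom_comp,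
      reassoc_of% @assocAct_natural, actHom_id, tensorHom_right_comm]

/-- The pentagon settles tight maps; a loose map needs in addition the axiom relating `ρ_{d⊗c}` to
`1 ⊗ ρ_c`. -/
lemma ext_assoc {x : Tightness} {as : List C.carrier} {b : C.carrier} (f : C.Multimap x as b)
    (d c : C.carrier) :
    f.ext (C.tensorObj d c) ≫ C.assoc d c b = C.assocAct d c as ≫ C.tensorHom (𝟙 d) (f.ext c) := by
  -- The part common to both types: a loose map is treated as starting from `a = i`.
  have key (a : C.carrier) (as : List C.carrier) (f : C.act a as ⟶ b) :
      C.assocAct (C.tensorObj d c) a as ≫ C.tensorHom (𝟙 (C.tensorObj d c)) f ≫ C.assoc d c b =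
        actHom (C.assoc d c a) as ≫ C.assocAct d (C.tensorObj c a) as ≫
          C.tensorHom (𝟙 d) (C.assocAct c a as ≫ C.tensorHom (𝟙 c) f) := by
    rw [← C.tensor_id, C.assoc_natural, reassoc_of% @assocAct_pentagon, LaxFunctor.tensor_id_comp]
  match x, as, f with
  | .tight, a :: as, f =>
    simp only [ext_tight, Category.assoc]
    rw [key, assocAct_cons, Category.assoc]
  | .loose, as, f =>
    simp only [ext_loose, Category.assoc]
    rw [key, ← reassoc_of% @actHom_comp, C.right_assoc, reassoc_of% @assocAct_natural,
      ← LaxFunctor.tensor_id_comp]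

/-- The unit inserted by `ρ` is removed again by the `λ` of the relaxation: this is the triangle
axiom. Consequently inputs other than the first do not see the type of what is substituted into
them. -/
lemma ext_relax {x y : Tightness} (h : x ≤ y) {as : List C.carrier} {b : C.carrier}
    (f : C.Multimap x as b) (c : C.carrier) : (f.relax h).ext c = f.ext c := by
  match x, y, as, f, h with
  | .tight, .tight, _, f, _ => rfl
  | .loose, .loose, _, f, _ => rfl
  | .tight, .loose, a :: as, f, _ =>
    change ext (C := C) (x := .loose) (as := a :: as) (actHom (C.left a) as ≫ f) c = _
    rw [ext_tight, ext_loose, LaxFunctor.tensor_id_comp, assocAct_cons, Category.assoc,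
      actHom_cons, ← reassoc_of% @assocAct_natural, ← reassoc_of% @actHom_comp,
      ← reassoc_of% @actHom_comp, Category.assoc, C.triangle, actHom_id]
    exact Category.id_comp _
  | .loose, .tight, _, _, h => exact absurd (h rfl) (by simp)

/-- Substitution into the first input of a tight multimap. -/
def pre : ∀ {x : Tightness} {as : List C.carrier} {b c : C.carrier} (_ : C.Multimap x as b)
    {bs : List C.carrier} (_ : C.act b bs ⟶ c), C.Multimap x (as ++ bs) c
  | .tight, a :: as, _, _, f, bs, k => eqToHom (act_append a as bs) ≫ actHom f bs ≫ k
  | .loose, as, _, _, f, bs, k => eqToHom (act_append C.unit as bs) ≫ actHom f bs ≫ k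

/-- Splits the action of a composite into that of `f`, tensored with `bs`, followed by that of `k`;
this is the tight case of `ext_subst` in the making. -/
lemma ext_pre {x : Tightness} {as : List C.carrier} {b c : C.carrier} (f : C.Multimap x as b)
    {bs : List C.carrier} (k : C.act b bs ⟶ c) (d : C.carrier) :
    (f.pre k).ext d = eqToHom (act_append d as bs) ≫ actHom (f.ext d) bs ≫
      C.assocAct d b bs ≫ C.tensorHom (𝟙 d) k := by
  match x, as, f with
  | .tight, a :: as, f =>
    change C.assocAct d a (as ++ bs) ≫
      C.tensorHom (𝟙 d) (eqToHom (act_append a as bs) ≫ actHom f bs ≫ k) = _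
    simp only [LaxFunctor.tensor_id_comp, assocAct_append, ext_tight, Category.assoc,
      actHom_comp, reassoc_of% @assocAct_natural, tensorHom_eqToHom,
      eqToHom_trans_assoc, eqToHom_refl, Category.id_comp]
  | .loose, as, f =>
    change actHom (C.right d) (as ++ bs) ≫ C.assocAct d C.unit (as ++ bs) ≫
      C.tensorHom (𝟙 d) (eqToHom (act_append C.unit as bs) ≫ actHom f bs ≫ k) = _
    simp only [LaxFunctor.tensor_id_comp, assocAct_append, ext_loose, Category.assoc, actHom_append,
      actHom_comp, reassoc_of% @assocAct_natural, tensorHom_eqToHom,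
      eqToHom_trans_assoc, eqToHom_refl, Category.id_comp]

end Multimap

/-- A tuple of multimaps `fᵣ : āᵣ → bᵣ` acts by maps `c ⊗ ā₁ ⊗ … ⊗ āₙ ⟶ c ⊗ b₁ ⊗ … ⊗ bₙ`. -/
def famExt : ∀ {xs : List Tightness} {ass : List (List C.carrier)} {bs : List C.carrier},
    Family C.Multimap xs ass bs → ∀ c : C.carrier, C.act c ass.flatten ⟶ C.act c bs
  | _, _, _, .nil, c => 𝟙 c
  | _, as :: ass, _ :: _, .cons f fs, c =>
    eqToHom (act_append c as ass.flatten) ≫ actHom (f.ext c) ass.flatten ≫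
      famExt fs _

@[simp] lemma famExt_nil (c : C.carrier) : famExt (C := C) .nil c = 𝟙 c := rfl

lemma famExt_cons {x : Tightness} {as : List C.carrier} {b : C.carrier} (f : C.Multimap x as b)
    {xs : List Tightness} {ass : List (List C.carrier)} {bs : List C.carrier}
    (fs : Family C.Multimap xs ass bs) (c : C.carrier) :
    famExt (.cons f fs) c = eqToHom (act_append c as ass.flatten) ≫
      actHom (f.ext c) ass.flatten ≫ famExt fs (C.tensorObj c b) := rfl

lemma famExt_natural {xs : List Tightness} {ass : List (List C.carrier)} {bs : List C.carrier}
    (fs : Family C.Multimap xs ass bs) {c c' : C.carrier} (h : c ⟶ c') :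
    actHom h ass.flatten ≫ famExt fs c' = famExt fs c ≫ actHom h bs := by
  induction fs generalizing c c' with
  | nil => simp
  | @cons x as b xs ass bs f fs ih =>
    change actHom h (as ++ ass.flatten) ≫ _ = _
    simp only [famExt_cons, actHom_append, Category.assoc, eqToHom_trans_assoc, eqToHom_refl,
      Category.id_comp, ← reassoc_of% @actHom_comp, Multimap.ext_natural, actHom_cons]
    simp only [actHom_comp, ih, Category.assoc]

/-- Tuple version of `ext_assoc`: the action commutes with tensoring by `d` on the left. -/
lemma famExt_assoc {xs : List Tightness} {ass : List (List C.carrier)} {bs : List C.carrier}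
    (fs : Family C.Multimap xs ass bs) (d c : C.carrier) :
    famExt fs (C.tensorObj d c) ≫ C.assocAct d c bs =
      C.assocAct d c ass.flatten ≫ C.tensorHom (𝟙 d) (famExt fs c) := by
  induction fs generalizing c with
  | nil => simp [C.tensor_id]
  | @cons x as b xs ass bs f fs ih =>
    change _ = C.assocAct d c (as ++ ass.flatten) ≫ _
    simp only [famExt_cons, assocAct_append, assocAct_cons, Category.assoc,
      LaxFunctor.tensor_id_comp, tensorHom_eqToHom, eqToHom_trans_assoc, eqToHom_refl,
      Category.id_comp]
    rw [← reassoc_of% @famExt_natural, ih, ← reassoc_of% @actHom_comp, Multimap.ext_assoc,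
      reassoc_of% @actHom_comp, reassoc_of% @assocAct_natural]

lemma famExt_append {xs xs' : List Tightness} {ass ass' : List (List C.carrier)}
    {bs bs' : List C.carrier} (fs : Family C.Multimap xs ass bs)
    (gs : Family C.Multimap xs' ass' bs') (c : C.carrier) :
    famExt (fs.append gs) c =
      eqToHom (by rw [List.flatten_append, act_append]) ≫ actHom (famExt fs c) ass'.flatten ≫
        famExt gs (C.act c bs) ≫ eqToHom (act_append c bs bs').symm := by
  induction fs generalizing c with
  | nil => simp; rfl
  | @cons x as b xs ass bs f fs ih =>
    change famExt (.cons f (fs.append gs)) c = _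
    rw [famExt_cons, famExt_cons, ih]
    simp only [actHom_comp, actHom_eqToHom, Category.assoc, eqToHom_trans_assoc]
    rw [actHom_congr _ List.flatten_append, actHom_append]
    simp only [Category.assoc, eqToHom_trans_assoc, eqToHom_refl, Category.id_comp]

end Multimaps

/-! ### Substitution and the skew multicategory of a skew monoidal category -/

variable {C : SkewMonCat.{v, u}}

namespace Multimap

/-- Substitution of a tuple of multimaps into a multimap. -/
def subst : ∀ {x : Tightness} {xs : List Tightness} {ass : List (List C.carrier)}
    {bs : List C.carrier} {c : C.carrier},
    C.Multimap x bs c → Family C.Multimap xs ass bs → C.Multimap (x.comp xs) ass.flatten c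
  | .loose, _, _, _, _, g, fs => famExt fs C.unit ≫ g
  | .tight, _, _, b :: _, _, g, .cons f fs => f.pre (famExt fs b ≫ g)
  | .tight, _, _, [], _, g, _ => g.elim

/-- Sliding the tuple past `α` and `ρ` by `famExt_assoc` and `famExt_natural` shows that acting
turns substitution into composition. Associativity of substitution rests on this. -/
lemma ext_subst {x : Tightness} {xs : List Tightness} {ass : List (List C.carrier)}
    {bs : List C.carrier} {c : C.carrier} (g : C.Multimap x bs c) (fs : Family C.Multimap xs ass bs)
    (d : C.carrier) : (g.subst fs).ext d = famExt fs d ≫ g.ext d := by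
  match x, xs, ass, bs, g, fs with
  | .loose, xs, ass, bs, g, fs =>
    change ext (x := .loose) (as := ass.flatten) (famExt fs C.unit ≫ g) d = _
    rw [ext_loose, ext_loose, LaxFunctor.tensor_id_comp, ← reassoc_of% @famExt_assoc,
      reassoc_of% @famExt_natural]
  | .tight, _, _, b :: _, g, .cons f fs =>
    change (f.pre (famExt fs b ≫ g)).ext d = _
    rw [ext_pre, famExt_cons, ext_tight, LaxFunctor.tensor_id_comp, ← reassoc_of% @famExt_assoc]
    simp only [Category.assoc]

/-- Bridge from equations in `C` with explicit transports to `Same`. -/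
lemma same_of_loose {as as' : List C.carrier} {b : C.carrier} (h : as = as')
    {f : C.act C.unit as ⟶ b} {g : C.act C.unit as' ⟶ b}
    (e : f = eqToHom (act_congr _ h) ≫ g) :
    Same (H := C.Multimap) (x := .loose) (as := as) (b := b) f (y := .loose) (as' := as') g := by
  subst h
  rw [eqToHom_refl, Category.id_comp] at e
  exact .of_eq e

lemma same_of_tight {a : C.carrier} {as as' : List C.carrier} {b : C.carrier} (h : as = as')
    {f : C.act a as ⟶ b} {g : C.act a as' ⟶ b}
    (e : f = eqToHom (act_congr _ h) ≫ g) :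
    Same (H := C.Multimap) (x := .tight) (as := a :: as) (b := b) f
      (y := .tight) (as' := a :: as') g := by
  subst h
  rw [eqToHom_refl, Category.id_comp] at e
  exact .of_eq e

lemma pre_same {x : Tightness} {as : List C.carrier} {b c : C.carrier} (f : C.Multimap x as b)
    {bs bs' : List C.carrier} (h : bs = bs') {k : C.act b bs ⟶ c} {k' : C.act b bs' ⟶ c}
    (e : k = eqToHom (act_congr _ h) ≫ k') :
    Same (H := C.Multimap) (f.pre k) (f.pre k') := by
  subst h
  rw [eqToHom_refl, Category.id_comp] at e
  exact .of_eq (by rw [e])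

lemma pre_tight {a : C.carrier} {as : List C.carrier} {b c : C.carrier} (f : C.act a as ⟶ b)
    {bs : List C.carrier} (k : C.act b bs ⟶ c) :
    pre (C := C) (x := .tight) (as := a :: as) f k =
      eqToHom (act_append a as bs) ≫ actHom f bs ≫ k := rfl

lemma pre_loose {as : List C.carrier} {b c : C.carrier} (f : C.act C.unit as ⟶ b)
    {bs : List C.carrier} (k : C.act b bs ⟶ c) :
    pre (C := C) (x := .loose) (as := as) f k =
      eqToHom (act_append C.unit as bs) ≫ actHom f bs ≫ k := rfl

lemma pre_pre {x : Tightness} {as : List C.carrier} {b c d : C.carrier} (f : C.Multimap x as b)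
    {bs cs : List C.carrier} (k : C.act b bs ⟶ c) (l : C.act c cs ⟶ d) :
    Same (H := C.Multimap) ((f.pre k).pre l)
      (f.pre (eqToHom (act_append b bs cs) ≫ actHom k cs ≫ l)) := by
  match x, as, f with
  | .loose, as, f =>
    refine same_of_loose (List.append_assoc _ _ _) ?_
    rw [pre_loose, pre_loose, pre_loose]
    simp only [actHom_comp, actHom_append, actHom_eqToHom, Category.assoc,
      eqToHom_trans_assoc, eqToHom_refl, Category.id_comp]
  | .tight, a :: as, f =>
    refine same_of_tight (List.append_assoc _ _ _) ?_
    change eqToHom _ ≫ actHom (eqToHom (act_append a as bs) ≫ actHom f bs ≫ k) cs ≫ l =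
      eqToHom _ ≫ eqToHom (act_append a as (bs ++ cs)) ≫ actHom f (bs ++ cs) ≫
        eqToHom (act_append b bs cs) ≫ actHom k cs ≫ l
    simp only [actHom_comp, actHom_append, actHom_eqToHom, Category.assoc,
      eqToHom_trans_assoc, eqToHom_refl, Category.id_comp]

/-- The map `g` is kept variable because substituting into an identity produces a composite of
identities, not `𝟙 b` itself. -/
lemma pre_id {x : Tightness} {as : List C.carrier} {b : C.carrier} (f : C.Multimap x as b)
    {g : b ⟶ b} (hg : g = 𝟙 b) : Same (H := C.Multimap) (f.pre (bs := []) g) f := by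
  subst hg
  match x, as, f with
  | .loose, as, f =>
    refine same_of_loose (List.append_nil _) ?_
    rw [pre_loose]
    simp
  | .tight, a :: as, f =>
    refine same_of_tight (List.append_nil _) ?_
    rw [pre_tight]
    simp

lemma pre_relax {x y : Tightness} (h : x ≤ y) {as : List C.carrier} {b c : C.carrier}
    (f : C.Multimap x as b) {bs : List C.carrier} (k : C.act b bs ⟶ c) :
    (f.relax h).pre k = (f.pre k).relax h := by
  match x, y, as, f, h with
  | .tight, .tight, _ :: _, f, _ => rfl
  | .loose, .loose, _, f, _ => rfl
  | .tight, .loose, a :: as, f, _ =>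
    change eqToHom _ ≫ actHom (actHom (C.left a) as ≫ f) bs ≫ k =
      actHom (C.left a) (as ++ bs) ≫ eqToHom _ ≫ actHom f bs ≫ k
    simp only [actHom_comp, actHom_append, Category.assoc, eqToHom_trans_assoc, eqToHom_refl,
      Category.id_comp]
  | .loose, .tight, _, _, h => exact absurd (h rfl) (by simp)

/-- The action at `i` followed by `λ` remembers the loose multimap. The loose case uses `λ_i ρ_i =
1`; both cases use `assocAct_left`. -/
lemma ext_unit_left {x : Tightness} {as : List C.carrier} {b : C.carrier} (f : C.Multimap x as b) :
    f.ext C.unit ≫ C.left b = f.relax (Tightness.le_loose x) := by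
  match x, as, f with
  | .loose, as, f =>
    change _ = f
    rw [ext_loose]
    simp only [Category.assoc, C.left_natural, reassoc_of% @assocAct_left]
    rw [← reassoc_of% @actHom_comp, C.right_left, actHom_id, Category.id_comp]
  | .tight, a :: as, f =>
    change _ = actHom (C.left a) as ≫ f
    rw [ext_tight]
    simp only [Category.assoc, C.left_natural, reassoc_of% @assocAct_left]

end Multimap

lemma flatten_map_singleton {A : Type*} (as : List A) : (as.map fun a => [a]).flatten = as := by
  induction as with
  | nil => rfl
  | cons a as ih => exact congrArg _ ih

/-- Applies `ext_subst` entry by entry, with naturality moving the later inner tuples past the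
earlier outer maps. -/
lemma famExt_flatten {yss : List (List Tightness)} {zsss : List (List (List C.carrier))}
    {xs : List Tightness} {ass : List (List C.carrier)} {bs : List C.carrier}
    (f : Family C.Multimap xs ass bs) (h : Family (Family C.Multimap) yss zsss ass)
    (c : C.carrier) :
    famExt h.flatten c ≫ famExt f c =
      eqToHom (act_congr c List.flatten_flatten) ≫
        famExt (Family.subst (H := C.Multimap) Multimap.subst f h) c := by
  induction f generalizing yss zsss c with
  | nil => cases h; simp [Family.flatten, Family.subst]
  | @cons x as b xs ass bs f fs ih =>
    cases h with
    | @cons ys zss _ yss zsss _ h hs =>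
      change famExt (h.append hs.flatten) c ≫ _ =
        eqToHom _ ≫ famExt (xs := x.comp ys :: List.zipWith Tightness.comp xs yss)
          (ass := zss.flatten :: zsss.map List.flatten) (.cons (f.subst h)
            (Family.subst (H := C.Multimap) Multimap.subst fs hs)) c
      rw [famExt_append, famExt_cons, famExt_cons, Multimap.ext_subst]
      simp only [Category.assoc, eqToHom_trans_assoc, eqToHom_refl, Category.id_comp]
      rw [← reassoc_of% @famExt_natural, ih, reassoc_of% @actHom_comp,
        ← reassoc_of% (eqToHom_actHom _ List.flatten_flatten),
        ← reassoc_of% (eqToHom_actHom _ List.flatten_flatten)]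
      simp only [eqToHom_trans_assoc]

lemma famExt_ids (bs : List C.carrier) (c : C.carrier) :
    famExt (Family.ids (H := C.Multimap) (fun a => 𝟙 a) bs) c =
      eqToHom (act_congr c (flatten_map_singleton bs)) := by
  induction bs generalizing c with
  | nil => rfl
  | cons b bs ih =>
    refine (famExt_cons _ _ _).trans ?_
    rw [ih]
    erw [Multimap.ext_tight]
    simp [C.tensor_id]

lemma famExt_relax {xs ys : List Tightness} (h : List.Forall₂ (· ≤ ·) xs ys)
    {ass : List (List C.carrier)} {bs : List C.carrier} (fs : Family C.Multimap xs ass bs)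
    (c : C.carrier) :
    famExt (Family.relax (H := C.Multimap) Multimap.relax h fs) c = famExt fs c := by
  induction fs generalizing ys c with
  | nil => cases h; rfl
  | cons f fs ih =>
    cases h with
    | cons h hs =>
      simp only [Family.relax]
      rw [famExt_cons, famExt_cons, Multimap.ext_relax, ih]

/-- Substitution into a multimap of the form `f.pre k`. -/
lemma Multimap.pre_subst {x : Tightness} {as : List C.carrier} {b : C.carrier}
    (f : C.Multimap x as b) {bs : List C.carrier} {c : C.carrier} (k : C.act b bs ⟶ c)
    {xs : List Tightness} {ass : List (List C.carrier)} (hs : Family C.Multimap xs ass as)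
    {ys : List Tightness} {bss : List (List C.carrier)} (hs' : Family C.Multimap ys bss bs) :
    Same (H := C.Multimap) (Multimap.subst (f.pre k) (hs.append hs'))
      (Multimap.pre (f.subst hs) (famExt hs' b ≫ k)) := by
  match x, as, f, hs with
  | .loose, as, f, hs =>
    refine same_of_loose List.flatten_append ?_
    change famExt (hs.append hs') C.unit ≫ eqToHom _ ≫ actHom f bs ≫ k =
      eqToHom _ ≫ eqToHom _ ≫ actHom (famExt hs C.unit ≫ f) bss.flatten ≫ famExt hs' b ≫ k
    simp only [famExt_append, actHom_comp, Category.assoc, eqToHom_trans_assoc, eqToHom_refl,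
      Category.id_comp, reassoc_of% @famExt_natural]
  | .tight, a :: as, f, .cons h hs =>
    change Same (Multimap.pre h (famExt (hs.append hs') a ≫
        eqToHom (act_append a as bs) ≫ actHom f bs ≫ k))
      (Multimap.pre (Multimap.pre h (famExt hs a ≫ f)) (famExt hs' b ≫ k))
    refine Same.trans ?_ (pre_pre h _ _).symm
    refine pre_same h List.flatten_append ?_
    simp only [famExt_append, actHom_comp, Category.assoc, eqToHom_trans_assoc, eqToHom_refl,
      Category.id_comp, reassoc_of% @famExt_natural]

/-- For loose `g` this is `famExt_flatten` at `i`; for tight `g` the first inner tuple is separated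
by `pre_subst`, leaving `famExt_flatten` for the rest. -/
lemma Multimap.subst_assoc {x : Tightness} {xs : List Tightness} {yss : List (List Tightness)}
    {zsss : List (List (List C.carrier))} {ass : List (List C.carrier)} {bs : List C.carrier}
    {c : C.carrier} (g : C.Multimap x bs c) (f : Family C.Multimap xs ass bs)
    (h : Family (Family C.Multimap) yss zsss ass) :
    Same (H := C.Multimap) (Multimap.subst (Multimap.subst g f) h.flatten)
      (Multimap.subst g (Family.subst (H := C.Multimap) Multimap.subst f h)) := by
  match x, xs, ass, bs, g, f with
  | .loose, xs, ass, bs, g, f =>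
    refine same_of_loose List.flatten_flatten ?_
    change famExt h.flatten C.unit ≫ famExt f C.unit ≫ g = eqToHom _ ≫ famExt _ C.unit ≫ g
    rw [← Category.assoc, famExt_flatten, Category.assoc]
  | .tight, _, _, b :: _, g, .cons f fs =>
    cases h with
    | @cons ys zss as yss zsss ass h hs =>
      change Same (Multimap.subst (Multimap.pre f (famExt fs b ≫ g)) (h.append hs.flatten))
        (Multimap.pre (Multimap.subst f h)
          (famExt (Family.subst (H := C.Multimap) Multimap.subst fs hs) b ≫ g))
      refine (pre_subst f _ h _).trans (pre_same _ List.flatten_flatten ?_)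
      rw [← Category.assoc, famExt_flatten, Category.assoc]

lemma Multimap.one_subst {x : Tightness} {as : List C.carrier} {b : C.carrier}
    (f : C.Multimap x as b) :
    Same (H := C.Multimap)
      (Multimap.subst (C := C) (x := .tight) (bs := [b]) (𝟙 b) (.cons f .nil)) f :=
  Multimap.pre_id f (Category.id_comp _)

lemma Multimap.subst_one {x : Tightness} {as : List C.carrier} {b : C.carrier}
    (f : C.Multimap x as b) :
    Same (H := C.Multimap)
      (Multimap.subst f (Family.ids (H := C.Multimap) (fun a => 𝟙 a) as)) f := by
  match x, as, f with
  | .loose, as, f =>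
    refine same_of_loose (flatten_map_singleton as) ?_
    refine congrArg (· ≫ f) (famExt_ids _ _)
  | .tight, a :: as, f =>
    refine same_of_tight (flatten_map_singleton as) ?_
    refine (pre_tight _ _).trans ?_
    rw [famExt_ids]
    simp

lemma Multimap.subst_relax {x y : Tightness} {xs ys : List Tightness} {ass : List (List C.carrier)}
    {bs : List C.carrier} {c : C.carrier} (h : x ≤ y) (hs : List.Forall₂ (· ≤ ·) xs ys)
    (g : C.Multimap x bs c) (f : Family C.Multimap xs ass bs) :
    Multimap.subst (g.relax h) (Family.relax (H := C.Multimap) Multimap.relax hs f) =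
      (Multimap.subst g f).relax (Tightness.comp_mono h hs) := by
  match x, y, bs, g, h with
  | .loose, .loose, bs, g, _ =>
    change famExt _ C.unit ≫ g = famExt _ C.unit ≫ g
    rw [famExt_relax]
  | .tight, .tight, b :: bs, g, _ =>
    cases f with | cons f fs =>
    cases hs with | cons h hs =>
    change (f.relax h).pre (famExt (Family.relax (H := C.Multimap) Multimap.relax hs fs) b ≫ g) =
      (f.pre (famExt fs b ≫ g)).relax h
    rw [famExt_relax, pre_relax]
  -- Here `λ_b` comes after the first entry has acted on `i`, and `ext_unit_left` turns the two into
  -- the loose form of that entry.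
  | .tight, .loose, b :: bs, g, _ =>
    cases f with | cons f fs =>
    cases hs with | cons h hs =>
    change famExt (.cons (f.relax h) (Family.relax (H := C.Multimap) Multimap.relax hs fs)) C.unit ≫
      actHom (C.left b) bs ≫ g = (f.pre (famExt fs b ≫ g)).relax (Tightness.le_loose _)
    rw [famExt_cons, famExt_relax, ← pre_relax, Multimap.ext_relax, ← ext_unit_left, pre_loose]
    simp only [Category.assoc, ← reassoc_of% @famExt_natural, actHom_comp]
  | .loose, .tight, _, _, h => exact absurd (h rfl) (by simp)

variable (C) in
/-- The skew multicategory associated to a skew monoidal category. -/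
def toMulticat : SkewMulticat.{v, u} where
  Obj := C.carrier
  Hom := C.Multimap
  isEmpty_tight_nil _ := inferInstanceAs (IsEmpty PEmpty)
  relax := Multimap.relax
  one a := 𝟙 a
  subst := Multimap.subst
  relax_refl {x as b} f := by
    match x, as, f with
    | .loose, _, _ => rfl
    | .tight, _ :: _, _ => rfl
  relax_trans {x y z as b} h h' f := by
    match x, y, z, as, f, h, h' with
    | .loose, .loose, .loose, _, _, _, _ => rfl
    | .tight, .tight, .tight, _ :: _, _, _, _ => rfl
    | .tight, .tight, .loose, _ :: _, _, _, _ => rfl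
    | .tight, .loose, .loose, _ :: _, _, _, _ => rfl
    | .loose, .tight, _, _, _, h, _ => exact absurd (h rfl) (by simp)
    | .loose, .loose, .tight, _, _, _, h => exact absurd (h rfl) (by simp)
    | .tight, .loose, .tight, _, _, _, h => exact absurd (h rfl) (by simp)
  subst_relax := Multimap.subst_relax
  one_subst := Multimap.one_subst
  subst_one := Multimap.subst_one
  subst_assoc := Multimap.subst_assoc

/-! ### Left representability -/

instance isIso_actHom {a b : C.carrier} (f : a ⟶ b) [IsIso f] (as : List C.carrier) :
    IsIso (actHom f as) :=
  ⟨actHom (inv f) as, by simp [← actHom_comp], by simp [← actHom_comp]⟩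

lemma precomp_bijective {D : Type u₁} [Category.{v₁} D] {a b : D} (f : a ⟶ b) [IsIso f] (c : D) :
    Function.Bijective fun h : b ⟶ c => f ≫ h :=
  ⟨fun _ _ e => (cancel_epi f).1 e, fun k => ⟨inv f ≫ k, by simp⟩⟩

/-- Yoneda. The hypothesis has the shape to which universality unfolds in `C.toMulticat`, the `𝟙 c`
being the action of the empty tuple. -/
lemma isIso_of_eqToHom_comp_bijective {D : Type u₁} [Category.{v₁} D] {a b c : D} (e : a = b)
    (f : b ⟶ c) (h : ∀ d, Function.Bijective fun g : c ⟶ d => eqToHom e ≫ f ≫ 𝟙 c ≫ g) :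
    IsIso f := by
  subst e
  refine isIso_of_coyoneda_map_bijective f fun d => ?_
  simpa using h d

/-- Universality makes `θ` invertible in `C`, hence also `θ ⊗ b₁ ⊗ … ⊗ bₖ`; substituting `θ` into
the first input is then precomposition with isomorphisms. -/
lemma Multimap.isLeftUniversal {x : Tightness} {as : List C.carrier} {m : C.carrier}
    (θ : C.Multimap x as m) (h : C.toMulticat.IsUniversal (x := x) (as := as) (m := m) θ) :
    C.toMulticat.IsLeftUniversal (x := x) (as := as) (m := m) θ := by
  intro (bs : List C.carrier) c
  -- The tuple of identities acts by a transport along an equality of lists.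
  have hids : IsIso (famExt (Family.ids C.toMulticat.one bs) m) := by
    have h' := famExt_ids (C := C) bs m
    have : IsIso (famExt (Family.ids (H := C.Multimap) (fun a => 𝟙 a) bs) m) := by
      rw [h']; infer_instance
    exact this
  match x, as, θ, h with
  | .loose, as, θ, h =>
    have : IsIso θ := isIso_of_eqToHom_comp_bijective (act_append C.unit as []) θ h
    exact (precomp_bijective (eqToHom (act_append C.unit as _)) _).comp
      ((precomp_bijective (actHom θ _) _).comp (@precomp_bijective _ _ _ _ (famExt _ m) hids c))
  | .tight, a :: as, θ, h =>
    have : IsIso θ := isIso_of_eqToHom_comp_bijective (act_append a as []) θ h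
    exact (precomp_bijective (eqToHom (act_append a as _)) _).comp
      ((precomp_bijective (actHom θ _) _).comp (@precomp_bijective _ _ _ _ (famExt _ m) hids c))

variable (C) in
-- The identity of a left-bracketed product is a universal multimap of either type.
lemma leftRepresentable_toMulticat : C.toMulticat.LeftRepresentable := by
  refine ⟨fun x as h => ?_, fun x as m θ => Multimap.isLeftUniversal θ⟩
  match x, as, h with
  | .loose, as, _ =>
    exact ⟨C.act C.unit as, 𝟙 (C.act C.unit as), fun (b : C.carrier) =>
      (precomp_bijective (eqToHom (act_append C.unit as [])) _).comp
        ((precomp_bijective (𝟙 (C.act C.unit as)) _).comp (precomp_bijective (𝟙 _) b))⟩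
  | .tight, [], h => exact Tightness.noConfusion (h rfl)
  | .tight, a :: as, _ =>
    exact ⟨C.act a as, 𝟙 (C.act a as), fun (b : C.carrier) =>
      (precomp_bijective (eqToHom (act_append a as [])) _).comp
        ((precomp_bijective (𝟙 (C.act a as)) _).comp (precomp_bijective (𝟙 _) b))⟩

/-! ### Lax monoidal functors induce morphisms -/

variable {D E : SkewMonCat.{v, u}}

namespace LaxFunctor

variable (F : LaxFunctor C D)

/-- The structure map `F c ⊗ F a₁ ⊗ … ⊗ F aₙ ⟶ F (c ⊗ a₁ ⊗ … ⊗ aₙ)` of a lax monoidal functor. -/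
def mapAct : ∀ (c : C.carrier) (as : List C.carrier),
    D.act (F.obj c) (as.map F.obj) ⟶ F.obj (C.act c as)
  | _, [] => 𝟙 _
  | c, a :: as => actHom (F.μ c a) (as.map F.obj) ≫ mapAct (C.tensorObj c a) as

@[simp] lemma mapAct_nil (c : C.carrier) : F.mapAct c [] = 𝟙 _ := rfl

lemma mapAct_cons (c a : C.carrier) (as : List C.carrier) :
    F.mapAct c (a :: as) =
      actHom (F.μ c a) (as.map F.obj) ≫ F.mapAct (C.tensorObj c a) as := rfl

lemma mapAct_natural {c c' : C.carrier} (h : c ⟶ c') (as : List C.carrier) :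
    actHom (F.map h) (as.map F.obj) ≫ F.mapAct c' as =
      F.mapAct c as ≫ F.map (actHom h as) := by
  induction as generalizing c c' with
  | nil => exact (Category.comp_id _).trans (Category.id_comp _).symm
  | cons a as ih =>
    have hn := F.μ_natural h (𝟙 a)
    rw [F.map_id] at hn
    change actHom (D.tensorHom (F.map h) (𝟙 (F.obj a))) (as.map F.obj) ≫ _ = _
    rw [mapAct_cons, mapAct_cons, ← reassoc_of% @actHom_comp, hn, reassoc_of% @actHom_comp, ih,
      Category.assoc]
    rfl

lemma mapAct_append (c : C.carrier) (as bs : List C.carrier) :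
    F.mapAct c (as ++ bs) =
      eqToHom (by rw [List.map_append, act_append]) ≫
        actHom (F.mapAct c as) (bs.map F.obj) ≫ F.mapAct (C.act c as) bs ≫
          F.map (eqToHom (act_append c as bs).symm) := by
  induction as generalizing c with
  | nil => simp
  | cons a as ih =>
    simp only [List.cons_append, mapAct_cons]
    rw [ih, actHom_congr _ List.map_append, actHom_append]
    simp [actHom_comp]

/-- The associativity axiom of `F`, used once for each letter of the list. -/
lemma mapAct_assoc (c a : C.carrier) (as : List C.carrier) :
    D.assocAct (F.obj c) (F.obj a) (as.map F.obj) ≫ D.tensorHom (𝟙 _) (F.mapAct a as) ≫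
        F.μ c (C.act a as) =
      actHom (F.μ c a) (as.map F.obj) ≫ F.mapAct (C.tensorObj c a) as ≫
        F.map (C.assocAct c a as) := by
  induction as generalizing a with
  | nil =>
    change 𝟙 _ ≫ D.tensorHom (𝟙 _) (𝟙 (F.obj a)) ≫ F.μ c a = F.μ c a ≫ 𝟙 _ ≫ F.map (𝟙 _)
    simp [D.tensor_id]
  | cons b as ih =>
    change (actHom (D.assoc (F.obj c) (F.obj a) (F.obj b)) (as.map F.obj) ≫
      D.assocAct (F.obj c) (D.tensorObj (F.obj a) (F.obj b)) (as.map F.obj)) ≫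
        D.tensorHom (𝟙 _) (actHom (F.μ a b) (as.map F.obj) ≫ F.mapAct (C.tensorObj a b) as) ≫ _ =
      actHom (D.tensorHom (F.μ c a) (𝟙 (F.obj b))) (as.map F.obj) ≫
        (actHom (F.μ (C.tensorObj c a) b) (as.map F.obj) ≫ F.mapAct _ as) ≫
          F.map (actHom (C.assoc c a b) as ≫ C.assocAct c (C.tensorObj a b) as)
    simp only [tensor_id_comp, Category.assoc, F.map_comp]
    rw [← reassoc_of% @mapAct_natural,
      ← reassoc_of% @actHom_comp, ← reassoc_of% @actHom_comp, Category.assoc, F.associativity]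
    simp only [actHom_comp, Category.assoc]
    rw [← ih, reassoc_of% @assocAct_natural]

/-- The action of a lax monoidal functor on multimaps. -/
def mapMultimap : ∀ {x : Tightness} {as : List C.carrier} {b : C.carrier},
    C.Multimap x as b → D.Multimap x (as.map F.obj) (F.obj b)
  | .tight, a :: as, _, f => F.mapAct a as ≫ F.map f
  | .loose, as, _, f => actHom F.ε (as.map F.obj) ≫ F.mapAct C.unit as ≫ F.map f

lemma mapMultimap_loose {as : List C.carrier} {b : C.carrier} (f : C.act C.unit as ⟶ b) :
    F.mapMultimap (x := .loose) (as := as) f =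
      actHom F.ε (as.map F.obj) ≫ F.mapAct C.unit as ≫ F.map f := rfl

/-- The induced map on multimaps respects their actions: tight maps need only associativity of `F`,
loose ones also its right unitality. Preservation of substitution comes from this. -/
lemma ext_mapMultimap {x : Tightness} {as : List C.carrier} {b : C.carrier}
    (f : C.Multimap x as b) (c : C.carrier) :
    (F.mapMultimap f).ext (F.obj c) ≫ F.μ c b = F.mapAct c as ≫ F.map (f.ext c) := by
  have hμ {b' : C.carrier} (g : b' ⟶ b) := F.μ_natural (𝟙 c) g
  simp only [F.map_id] at hμ
  match x, as, f with
  | .tight, a :: as, f =>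
    change (D.assocAct (F.obj c) (F.obj a) (as.map F.obj) ≫
      D.tensorHom (𝟙 _) (F.mapAct a as ≫ F.map f)) ≫ F.μ c b = _
    rw [Multimap.ext_tight, tensor_id_comp]
    simp only [Category.assoc, hμ, F.map_comp]
    rw [reassoc_of% @mapAct_assoc, mapAct_cons, Category.assoc]
  | .loose, as, f =>
    rw [Multimap.ext_loose, mapMultimap_loose, Multimap.ext_loose]
    simp only [Category.assoc, tensor_id_comp, hμ, F.map_comp]
    rw [← reassoc_of% @assocAct_natural, reassoc_of% @mapAct_assoc, ← reassoc_of% @mapAct_natural,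
      ← F.right_unitality]
    simp only [actHom_comp, Category.assoc]

/-- The passage from tight to loose is precomposition with `λ`, so this is left unitality of `F`
tensored with the remaining inputs. -/
lemma map_relax {x y : Tightness} (h : x ≤ y) {as : List C.carrier} {b : C.carrier}
    (f : C.Multimap x as b) : F.mapMultimap (f.relax h) = (F.mapMultimap f).relax h := by
  match x, y, as, f, h with
  | .tight, .tight, _ :: _, f, _ => rfl
  | .loose, .loose, _, f, _ => rfl
  | .tight, .loose, a :: as, f, _ =>
    change actHom (D.tensorHom F.ε (𝟙 (F.obj a))) (as.map F.obj) ≫ F.mapAct C.unit (a :: as) ≫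
      F.map (actHom (C.left a) as ≫ f) =
        actHom (D.left (F.obj a)) (as.map F.obj) ≫ F.mapAct a as ≫ F.map f
    rw [mapAct_cons, F.map_comp, Category.assoc, ← reassoc_of% @mapAct_natural,
      ← reassoc_of% @actHom_comp, ← reassoc_of% @actHom_comp, Category.assoc, F.left_unitality]
  | .loose, .tight, _, _, h => exact absurd (h rfl) (by simp)

lemma map_pre {x : Tightness} {as : List C.carrier} {b c : C.carrier} (f : C.Multimap x as b)
    {bs : List C.carrier} (k : C.act b bs ⟶ c) :
    Same (H := D.Multimap) (F.mapMultimap (f.pre k))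
      ((F.mapMultimap f).pre (F.mapAct b bs ≫ F.map k)) := by
  match x, as, f with
  | .tight, a :: as, f =>
    refine Multimap.same_of_tight List.map_append ?_
    change F.mapAct a (as ++ bs) ≫ F.map (eqToHom (act_append a as bs) ≫ actHom f bs ≫ k) =
      eqToHom _ ≫ eqToHom (act_append _ _ _) ≫ actHom (F.mapAct a as ≫ F.map f) (bs.map F.obj) ≫
        F.mapAct b bs ≫ F.map k
    rw [mapAct_append]
    simp only [actHom_comp, F.map_comp, reassoc_of% @mapAct_natural, eqToHom_trans_assoc,
      Category.assoc, eqToHom_map, eqToHom_refl, Category.id_comp]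
  | .loose, as, f =>
    refine Multimap.same_of_loose List.map_append ?_
    change actHom F.ε ((as ++ bs).map F.obj) ≫ F.mapAct C.unit (as ++ bs) ≫
        F.map (eqToHom (act_append C.unit as bs) ≫ actHom f bs ≫ k) =
      eqToHom _ ≫ eqToHom (act_append _ _ _) ≫
        actHom (actHom F.ε (as.map F.obj) ≫ F.mapAct C.unit as ≫ F.map f) (bs.map F.obj) ≫
        F.mapAct b bs ≫ F.map k
    rw [mapAct_append, actHom_congr _ List.map_append, actHom_append]
    simp only [actHom_comp, F.map_comp, reassoc_of% @mapAct_natural, eqToHom_trans_assoc,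
      Category.assoc, eqToHom_map, eqToHom_refl, Category.id_comp]

lemma famExt_map {xs : List Tightness} {ass : List (List C.carrier)} {bs : List C.carrier}
    (fs : Family C.Multimap xs ass bs) (c : C.carrier) :
    famExt (fs.map (Q := D.Multimap) (List.map F.obj) F.obj F.mapMultimap) (F.obj c) ≫
        F.mapAct c bs =
      eqToHom (act_congr _ List.map_flatten.symm) ≫ F.mapAct c ass.flatten ≫
        F.map (famExt fs c) := by
  induction fs generalizing c with
  | nil => exact (Category.comp_id _).trans (by simp; rfl)
  | @cons x as b xs ass bs f fs ih =>
    change famExt (ass := as.map F.obj :: ass.map (List.map F.obj)) (.cons (F.mapMultimap f)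
      (fs.map (Q := D.Multimap) (List.map F.obj) F.obj F.mapMultimap)) _ ≫ _ =
        _ ≫ F.mapAct c (as ++ ass.flatten) ≫ _
    rw [famExt_cons, famExt_cons, mapAct_cons, mapAct_append]
    simp only [Category.assoc, F.map_comp, eqToHom_map, eqToHom_trans_assoc, eqToHom_refl,
      Category.id_comp]
    rw [← reassoc_of% @famExt_natural, ih, ← reassoc_of% @mapAct_natural,
      ← reassoc_of% @actHom_comp, ext_mapMultimap,
      ← reassoc_of% (eqToHom_actHom _ List.map_flatten.symm), reassoc_of% @actHom_comp]
    simp only [eqToHom_trans_assoc]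

/-- Reduces to `famExt_map`: at `i` for loose `g`, where naturality moves the tuple past `F.ε`, and
at the first target for tight `g`. -/
lemma map_subst {x : Tightness} {xs : List Tightness} {ass : List (List C.carrier)}
    {bs : List C.carrier} {c : C.carrier} (g : C.Multimap x bs c)
    (f : Family C.Multimap xs ass bs) :
    Same (H := D.Multimap) (F.mapMultimap (g.subst f)) (Multimap.subst (F.mapMultimap g)
      (f.map (Q := D.Multimap) (List.map F.obj) F.obj F.mapMultimap)) := by
  match x, xs, ass, bs, g, f with
  | .loose, xs, ass, bs, g, f =>
    refine Multimap.same_of_loose (C := D) List.map_flatten ?_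
    change actHom F.ε _ ≫ F.mapAct C.unit _ ≫ F.map (famExt f C.unit ≫ g) =
      eqToHom _ ≫ famExt _ D.unit ≫ actHom F.ε (bs.map F.obj) ≫ F.mapAct C.unit bs ≫ F.map g
    rw [← reassoc_of% @famExt_natural, reassoc_of% @famExt_map, F.map_comp,
      ← reassoc_of% (eqToHom_actHom _ List.map_flatten.symm), eqToHom_trans_assoc, eqToHom_refl,
      Category.id_comp]
  | .tight, _, _, b :: bs, g, .cons f fs =>
    refine (F.map_pre f _).trans (Multimap.pre_same _ List.map_flatten ?_)
    change _ = _ ≫ _ ≫ F.mapAct b bs ≫ F.map g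
    rw [F.map_comp, reassoc_of% @famExt_map, eqToHom_trans_assoc, eqToHom_refl, Category.id_comp]

/-- The morphism of skew multicategories induced by a lax monoidal functor. -/
def toMorphism : SkewMulticat.Morphism C.toMulticat D.toMulticat where
  obj := F.obj
  map := F.mapMultimap
  map_relax h f := F.map_relax h f
  map_one a := (Category.id_comp _).trans (F.map_id a)
  map_subst := F.map_subst

end LaxFunctor

lemma flatten_map_singleton_comp {A B : Type*} (f : A → B) (as : List A) :
    (as.map fun a => [f a]).flatten = as.map f := by
  induction as with
  | nil => rfl
  | cons a as ih => exact congrArg _ ih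

/-! ### Monoidal transformations induce 2-cells -/

namespace Transformation

variable {F G : LaxFunctor C D} (φ : Transformation F G)

/-- The components of a transformation, as tight unary multimaps. -/
def multimapApp (a : C.carrier) : D.Multimap .tight [F.obj a] (G.obj a) := φ.app a

/-- The tensor axiom of `φ` handles one letter at a time, once `φ_c ⊗ φ_a` is split as `φ_c ⊗ 1`
followed by `1 ⊗ φ_a`, the latter being the action of a unary multimap. -/
lemma mapAct_app (c : C.carrier) (as : List C.carrier) :
    F.mapAct c as ≫ φ.app (C.act c as) =
      actHom (φ.app c) (as.map F.obj) ≫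
        eqToHom (act_congr _ (flatten_map_singleton_comp _ _).symm) ≫
        famExt (Family.ofList (P := D.Multimap) (i := fun _ => .tight) (j := fun a => [F.obj a])
          (k := G.obj) φ.multimapApp as) (G.obj c) ≫ G.mapAct c as := by
  induction as generalizing c with
  | nil =>
    change 𝟙 _ ≫ φ.app c = φ.app c ≫ 𝟙 _ ≫ 𝟙 _ ≫ 𝟙 _
    simp
  | cons a as ih =>
    change _ = actHom (D.tensorHom (φ.app c) (𝟙 (F.obj a))) (as.map F.obj) ≫ eqToHom _ ≫
      famExt (ass := [F.obj a] :: as.map fun a => [F.obj a]) (.cons (φ.multimapApp a)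
        (Family.ofList (P := D.Multimap) (i := fun _ => .tight) (j := fun a => [F.obj a])
          (k := G.obj) φ.multimapApp as)) (G.obj c) ≫ _
    have he : (φ.multimapApp a).ext (G.obj c) = D.tensorHom (𝟙 (G.obj c)) (φ.app a) :=
      Category.id_comp _
    rw [LaxFunctor.mapAct_cons, LaxFunctor.mapAct_cons, famExt_cons, Category.assoc, ih, he,
      ← reassoc_of% @actHom_comp, φ.tensor]
    have ht : D.tensorHom (φ.app c) (φ.app a) =
        D.tensorHom (φ.app c) (𝟙 _) ≫ D.tensorHom (𝟙 _) (φ.app a) := by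
      rw [← D.tensor_comp, Category.comp_id, Category.id_comp]
    rw [ht]
    simp only [actHom_comp, Category.assoc, eqToHom_trans_assoc]
    rw [← reassoc_of% @famExt_natural]
    rw [← reassoc_of% (eqToHom_actHom _ (flatten_map_singleton_comp _ _).symm),
      ← reassoc_of% (eqToHom_actHom _ (flatten_map_singleton_comp _ _).symm),
      ← reassoc_of% (eqToHom_actHom _ (flatten_map_singleton_comp _ _).symm)]

/-- Tight maps need naturality and the tensor axiom; the unit axiom of `φ` enters only for loose
maps. -/
lemma multimapApp_natural {x : Tightness} {as : List C.carrier} {b : C.carrier}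
    (f : C.Multimap x as b) :
    Same (H := D.Multimap) ((F.mapMultimap f).pre (bs := []) (φ.app b))
      ((G.mapMultimap f).subst (.ofList (P := D.Multimap) (i := fun _ => .tight)
        (j := fun a => [F.obj a]) (k := G.obj) φ.multimapApp as)) := by
  match x, as, f with
  | .tight, a :: as, f =>
    refine Multimap.same_of_tight (C := D) ((List.append_nil _).trans
      (flatten_map_singleton_comp _ _).symm) ?_
    change eqToHom (act_append (F.obj a) (as.map F.obj) []) ≫ (F.mapAct a as ≫ F.map f) ≫ φ.app b =
      eqToHom _ ≫ eqToHom (act_append (F.obj a) [] _) ≫ actHom (φ.app a) _ ≫ _ ≫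
        G.mapAct a as ≫ G.map f
    rw [Category.assoc, φ.natural, reassoc_of% @mapAct_app,
      ← reassoc_of% (eqToHom_actHom _ (flatten_map_singleton_comp _ _).symm)]
    simp only [eqToHom_trans_assoc]
  | .loose, as, f =>
    refine Multimap.same_of_loose (C := D) ((List.append_nil _).trans
      (flatten_map_singleton_comp _ _).symm) ?_
    change eqToHom (act_append D.unit (as.map F.obj) []) ≫
        (actHom F.ε (as.map F.obj) ≫ F.mapAct C.unit as ≫ F.map f) ≫ φ.app b =
      eqToHom _ ≫ famExt _ D.unit ≫ actHom G.ε (as.map G.obj) ≫ G.mapAct C.unit as ≫ G.map f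
    rw [← φ.unit, ← reassoc_of% @famExt_natural]
    simp only [actHom_comp, Category.assoc]
    rw [φ.natural, reassoc_of% @mapAct_app,
      ← reassoc_of% (eqToHom_actHom _ (flatten_map_singleton_comp _ _).symm),
      ← reassoc_of% (eqToHom_actHom _ (flatten_map_singleton_comp _ _).symm)]
    simp only [eqToHom_trans_assoc]

/-- The 2-cell of skew multicategories induced by a monoidal transformation. -/
def toMulticat : SkewMulticat.Transformation F.toMorphism G.toMorphism where
  app := φ.multimapApp
  natural f := (Same.of_eq (congrArg (Multimap.pre (bs := []) (F.mapMultimap f))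
    (Category.id_comp _))).trans (φ.multimapApp_natural f)

end Transformation

/-! ### Strict functoriality of the construction -/

namespace LaxFunctor

/-- The maps `mapAct` of the identity functor. -/
def idMapAct (c : C.carrier) (as : List C.carrier) : C.act c (as.map fun a => a) ⟶ C.act c as :=
  (LaxFunctor.id C).mapAct c as

lemma idMapAct_eq (c : C.carrier) (as : List C.carrier) :
    idMapAct c as = eqToHom (act_congr c (List.map_id' as)) := by
  induction as generalizing c with
  | nil => rfl
  | cons a as ih =>
    change actHom (𝟙 _) (as.map fun a => a) ≫ idMapAct (C.tensorObj c a) as = _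
    rw [actHom_id, ih, Category.id_comp]

lemma mapMultimap_id {x : Tightness} {as : List C.carrier} {b : C.carrier}
    (f : C.Multimap x as b) : Same (H := C.Multimap) ((LaxFunctor.id C).mapMultimap f) f := by
  match x, as, f with
  | .tight, a :: as, f =>
    refine Multimap.same_of_tight (C := C) (List.map_id' as) ?_
    exact congrArg (· ≫ f) (idMapAct_eq a as)
  | .loose, as, f =>
    refine Multimap.same_of_loose (C := C) (List.map_id' as) ?_
    change actHom (𝟙 _) (as.map fun a => a) ≫ idMapAct C.unit as ≫ f = _
    rw [idMapAct_eq, actHom_id, Category.id_comp]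
    rfl

variable (F : LaxFunctor C D) (G : LaxFunctor D E)

/-- The maps `mapAct` of a composite functor. -/
def compMapAct (c : C.carrier) (as : List C.carrier) :
    E.act (G.obj (F.obj c)) (as.map fun a => G.obj (F.obj a)) ⟶ G.obj (F.obj (C.act c as)) :=
  (F.comp G).mapAct c as

lemma map_obj_obj (as : List C.carrier) :
    (as.map fun a => G.obj (F.obj a)) = (as.map F.obj).map G.obj :=
  List.map_map.symm

/-- Both functors' structure maps are interleaved in a composite; naturality of `G.mapAct` collects
those of `G` in front. -/
lemma compMapAct_eq (c : C.carrier) (as : List C.carrier) :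
    compMapAct F G c as = eqToHom (act_congr _ (map_obj_obj F G as)) ≫
      G.mapAct (F.obj c) (as.map F.obj) ≫ G.map (F.mapAct c as) := by
  induction as generalizing c with
  | nil =>
    change 𝟙 _ = 𝟙 _ ≫ 𝟙 _ ≫ G.map (𝟙 _)
    simp
  | cons a as ih =>
    change actHom (G.μ (F.obj c) (F.obj a) ≫ G.map (F.μ c a)) _ ≫
        compMapAct F G (C.tensorObj c a) as =
      eqToHom _ ≫ (actHom (G.μ (F.obj c) (F.obj a)) ((as.map F.obj).map G.obj) ≫ G.mapAct _ _) ≫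
        G.map (actHom (F.μ c a) (as.map F.obj) ≫ F.mapAct (C.tensorObj c a) as)
    rw [G.map_comp, Category.assoc, ← reassoc_of% @mapAct_natural,
      reassoc_of% @actHom_comp, reassoc_of% (eqToHom_actHom _ (map_obj_obj F G as)),
      reassoc_of% (eqToHom_actHom _ (map_obj_obj F G as)), ih]

lemma mapMultimap_comp {x : Tightness} {as : List C.carrier} {b : C.carrier}
    (f : C.Multimap x as b) :
    Same (H := E.Multimap) ((F.comp G).mapMultimap f) (G.mapMultimap (F.mapMultimap f)) := by
  match x, as, f with
  | .tight, a :: as, f =>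
    refine Multimap.same_of_tight (C := E) (a := G.obj (F.obj a)) (b := G.obj (F.obj _))
      (map_obj_obj F G as) ?_
    change compMapAct F G a as ≫ G.map (F.map f) =
      _ ≫ G.mapAct (F.obj a) (as.map F.obj) ≫ G.map (F.mapAct a as ≫ F.map f)
    rw [reassoc_of% @compMapAct_eq, G.map_comp]
  | .loose, as, f =>
    refine Multimap.same_of_loose (C := E) (b := G.obj (F.obj _)) (map_obj_obj F G as) ?_
    change actHom (G.ε ≫ G.map F.ε) _ ≫ compMapAct F G C.unit as ≫ G.map (F.map f) =
      _ ≫ actHom G.ε ((as.map F.obj).map G.obj) ≫ G.mapAct D.unit (as.map F.obj) ≫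
        G.map (actHom F.ε (as.map F.obj) ≫ F.mapAct C.unit as ≫ F.map f)
    rw [reassoc_of% @compMapAct_eq, G.map_comp, G.map_comp, ← reassoc_of% @mapAct_natural,
      reassoc_of% @actHom_comp, reassoc_of% (eqToHom_actHom _ (map_obj_obj F G as)),
      reassoc_of% (eqToHom_actHom _ (map_obj_obj F G as))]

lemma toMorphism_id : (LaxFunctor.id C).toMorphism = SkewMulticat.Morphism.id C.toMulticat :=
  SkewMulticat.Morphism.ext_heq (fun _ => rfl) fun f =>
    ((mapMultimap_id f).trans (same_cast _ _).symm).heq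

lemma toMorphism_comp : (F.comp G).toMorphism = F.toMorphism.comp G.toMorphism :=
  SkewMulticat.Morphism.ext_heq (fun _ => rfl) fun f =>
    ((mapMultimap_comp F G f).trans (same_cast _ _).symm).heq

end LaxFunctor

end SkewMonCat

/-- A 2-cell of left representable skew multicategories is determined, up to transport, by its
components. -/
lemma LeftRepSkewMulticat.eq_conj {A B : LeftRepSkewMulticat.{v, u}} {F F' G G' : A ⟶ B}
    (h : F = F') (h' : G' = G) (φ : F ⟶ G) (ψ : F' ⟶ G')
    (H : ∀ a, SkewMulticat.Transformation.app φ.hom a ≍ SkewMulticat.Transformation.app ψ.hom a) :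
    φ = eqToHom h ≫ ψ ≫ eqToHom h' := by
  subst h h'
  rw [eqToHom_refl, eqToHom_refl, Category.comp_id, Category.id_comp]
  exact Bicategory.InducedBicategory.hom₂_ext
    (SkewMulticat.Transformation.ext (funext fun a => eq_of_heq (H a)))

/-! ### The 2-functor to left representable skew multicategories -/

namespace SkewMonCat

/-- The 2-functor sending a skew monoidal category to its skew multicategory. -/
def multicatFunctor : StrictPseudofunctor SkewMonCat.{v, u} LeftRepSkewMulticat.{v, u} :=
  .mk'' {
    obj C := ⟨C.toMulticat, C.leftRepresentable_toMulticat⟩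
    map F := Bicategory.InducedBicategory.mkHom (LaxFunctor.toMorphism F)
    map₂ φ := ⟨Transformation.toMulticat φ⟩
    map₂_id F := Bicategory.InducedBicategory.hom₂_ext rfl
    map₂_comp φ ψ := Bicategory.InducedBicategory.hom₂_ext
      (SkewMulticat.Transformation.ext (funext fun a => by
        change φ.app a ≫ ψ.app a = 𝟙 _ ≫ φ.app a ≫ 𝟙 _ ≫ ψ.app a
        simp only [Category.id_comp]))
    map_id C := Bicategory.InducedBicategory.hom_ext LaxFunctor.toMorphism_id
    map_comp F G := Bicategory.InducedBicategory.hom_ext (LaxFunctor.toMorphism_comp F G)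
    map₂_whisker_left F G H φ := LeftRepSkewMulticat.eq_conj _ _ _ _ fun _ => HEq.rfl
    -- On a unary map `H.mapMultimap` composes with the structure map of the empty list, an identity
    -- that must be cancelled.
    map₂_whisker_right φ H := LeftRepSkewMulticat.eq_conj _ _ _ _ fun _ =>
      heq_of_eq (Category.id_comp _).symm }

end SkewMonCat

/-! ### Calculus of substitution and left universality -/

section

variable {I : Type u₁} {J : Type u₂} {K : Type v₁} {P : I → J → K → Type v₂}

/-- A tuple as a tuple of tuples of length one. -/
def Family.singles : ∀ {is : List I} {js : List J} {ks : List K}, Family P is js ks →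
    Family (Family P) (is.map fun i => [i]) (js.map fun j => [j]) (ks.map fun k => [k])
  | _, _, _, .nil => .nil
  | _, _, _, .cons f fs => .cons (.cons f .nil) fs.singles

lemma Family.flatten_singles {is : List I} {js : List J} {ks : List K} (fs : Family P is js ks) :
    FSame fs.singles.flatten fs := by
  induction fs with
  | nil => exact .refl
  | cons f fs ih => exact .cons' f ih

lemma FSame.append {is is' : List I} {js js' : List J} {ks ks' : List K} {f : Family P is js ks}
    {f' : Family P is' js' ks'} (h : FSame f f') {is₁ is₁' : List I} {js₁ js₁' : List J}
    {ks₁ ks₁' : List K} {g : Family P is₁ js₁ ks₁} {g' : Family P is₁' js₁' ks₁'}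
    (h' : FSame g g') : FSame (f.append g) (f'.append g') := by
  cases h; cases h'; exact .refl

end

namespace SkewMulticat

variable {A B : SkewMulticat.{v, u}}

lemma relax_congr {x y x' y' : Tightness} (h : x ≤ y) (h' : x' ≤ y') {as as' : List A.Obj}
    {b : A.Obj} {f : A.Hom x as b} {g : A.Hom x' as' b} (e : y = y')
    (hf : Same (H := A.Hom) f g) : Same (H := A.Hom) (A.relax h f) (A.relax h' g) := by
  cases hf; subst e; exact .refl

lemma ids_append (as bs : List A.Obj) :
    FSame ((Family.ids (H := A.Hom) A.one as).append (Family.ids (H := A.Hom) A.one bs))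
      (Family.ids (H := A.Hom) A.one (as ++ bs)) := by
  induction as with
  | nil => exact .refl
  | cons a as ih => exact .cons' _ ih

/-- With `flatten_singles`, this lets associativity of substitution apply when some inputs are
filled only by identities. -/
lemma ids_subst_singles {xs : List Tightness} {ass : List (List A.Obj)} {bs : List A.Obj}
    (fs : Family A.Hom xs ass bs) :
    FSame (Family.subst (H := A.Hom) A.subst (Family.ids (H := A.Hom) A.one bs) fs.singles) fs := by
  induction fs with
  | nil => exact .refl
  | cons f fs ih => exact .cons (A.one_subst f) ih

/-- `h ∘ k` for a tight unary multimap `h`. -/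
def post {x : Tightness} {as : List A.Obj} {b c : A.Obj} (h : A.Hom .tight [b] c)
    (k : A.Hom x as b) : A.Hom x (as ++ []) c :=
  A.subst h (.cons k .nil)

/-- `g(k, 1, …, 1)`. -/
def head {x : Tightness} {as : List A.Obj} {m : A.Obj} {bs : List A.Obj} {c : A.Obj}
    (g : A.Hom .tight (m :: bs) c) (k : A.Hom x as m) :
    A.Hom x (as ++ (bs.map fun b => [b]).flatten) c :=
  A.subst g (.cons k (.ids A.one bs))

lemma post_congr {x x' : Tightness} {as as' : List A.Obj} {b c : A.Obj} (h : A.Hom .tight [b] c)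
    {k : A.Hom x as b} {k' : A.Hom x' as' b} (hk : Same (H := A.Hom) k k') :
    Same (H := A.Hom) (post h k) (post h k') := by
  cases hk; exact .refl

lemma post_subst {x : Tightness} {bs : List A.Obj} {b c : A.Obj} (h : A.Hom .tight [b] c)
    (g : A.Hom x bs b) {xs : List Tightness} {ass : List (List A.Obj)}
    (fs : Family A.Hom xs ass bs) :
    Same (H := A.Hom) (post h (A.subst g fs)) (A.subst (post h g) (fs.append .nil)) :=
  (A.subst_assoc h (.cons g .nil) (.cons fs .nil)).symm

/-- `h ∘ g(f₁, …, fₙ) = (h ∘ g)(f₁, …, fₙ)`. -/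
lemma post_subst' {x y : Tightness} {bs bs' : List A.Obj} {b c : A.Obj} (h : A.Hom .tight [b] c)
    (g : A.Hom x bs b) {xs : List Tightness} {ass : List (List A.Obj)}
    (fs : Family A.Hom xs ass bs) {g' : A.Hom y bs' c} (e : Same (H := A.Hom) (post h g) g')
    {ys : List Tightness} {ass' : List (List A.Obj)}
    {fs' : Family A.Hom ys ass' bs'} (e' : FSame fs fs') :
    Same (H := A.Hom) (post h (A.subst g fs)) (A.subst g' fs') :=
  (post_subst h g fs).trans (subst_congr e ((Family.append_nil fs).trans e'))

lemma post_post {x : Tightness} {as : List A.Obj} {b c d : A.Obj} (h : A.Hom .tight [c] d)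
    (h' : A.Hom .tight [b] c) (k : A.Hom x as b) :
    Same (H := A.Hom) (post h (post h' k)) (post (post h h') k) :=
  post_subst h h' _

lemma one_post {x : Tightness} {as : List A.Obj} {b : A.Obj} (k : A.Hom x as b) :
    Same (H := A.Hom) (post (A.one b) k) k :=
  A.one_subst k

lemma post_one {b c : A.Obj} (h : A.Hom .tight [b] c) : post h (A.one b) = h :=
  (A.subst_one h).eq

/-- `(g(k, 1, …, 1))(h, f) = g(k(h), f)`. -/
lemma subst_head {x : Tightness} {as : List A.Obj} {m : A.Obj} {bs : List A.Obj} {c : A.Obj}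
    (g : A.Hom .tight (m :: bs) c) (k : A.Hom x as m)
    {xs : List Tightness} {ass : List (List A.Obj)} (hs : Family A.Hom xs ass as)
    {ys : List Tightness} {bss : List (List A.Obj)} (fs : Family A.Hom ys bss bs)
    {y : Tightness} {cs : List A.Obj} {g' : A.Hom y cs c} (e : Same (H := A.Hom) g' (head g k))
    {zs : List Tightness} {css : List (List A.Obj)} {fs' : Family A.Hom zs css cs}
    (e' : FSame fs' (hs.append fs)) :
    Same (H := A.Hom) (A.subst g' fs') (A.subst g (.cons (A.subst k hs) fs)) := by
  refine (subst_congr e (e'.trans (.append .refl (Family.flatten_singles fs).symm))).trans ?_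
  exact (A.subst_assoc g (.cons k (.ids A.one bs)) (.cons hs fs.singles)).trans
    (subst_congr .refl (.cons .refl (ids_subst_singles fs)))

/-- Associativity of substitution in the first input. The auxiliary `g'` is `g(κ,1,…,1)` with its
source list in a prescribed form. -/
lemma head_head {x : Tightness} {as : List A.Obj} {m n : A.Obj} {bs cs ds : List A.Obj} {d : A.Obj}
    (g : A.Hom .tight (n :: bs) d) (κ : A.Hom .tight (m :: cs) n) (θ : A.Hom x as m)
    {g' : A.Hom .tight (m :: ds) d} (e : Same (H := A.Hom) g' (head g κ)) (hd : ds = cs ++ bs) :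
    Same (H := A.Hom) (head g' θ) (head g (head κ θ)) := by
  subst hd
  exact subst_head g κ (.cons θ (.ids A.one cs)) (.ids A.one bs) e
    (.cons' _ (ids_append _ _).symm)

/-- Left universality, phrased up to transport along equalities of source lists. -/
structure LeftUniv {x : Tightness} {as : List A.Obj} {m : A.Obj} (θ : A.Hom x as m) : Prop where
  inj : ∀ {bs : List A.Obj} {c : A.Obj} {g g' : A.Hom .tight (m :: bs) c},
    Same (H := A.Hom) (head g θ) (head g' θ) → g = g'
  surj : ∀ {bs : List A.Obj} {c : A.Obj} (k : A.Hom x (as ++ bs) c),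
    ∃ g : A.Hom .tight (m :: bs) c, Same (H := A.Hom) (head g θ) k

lemma IsLeftUniversal.leftUniv {x : Tightness} {as : List A.Obj} {m : A.Obj} {θ : A.Hom x as m}
    (h : A.IsLeftUniversal θ) : LeftUniv θ where
  inj {bs c _ _} e := (h bs c).1 e.eq
  surj {bs c} k := by
    have hl : as ++ bs = as ++ (bs.map fun b => [b]).flatten := by
      rw [SkewMonCat.flatten_map_singleton]
    obtain ⟨g, hg⟩ := (h bs c).2 (castObjs (H := A.Hom) hl k)
    exact ⟨g, (Same.of_eq hg).trans (same_cast _ _)⟩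

/-- Factor first through `θ`, keeping the further inputs `cs` and `bs`, then through `κ`, keeping
`bs`. Because inputs have to be carried along, universality alone would not suffice for this
argument. -/
lemma LeftUniv.head {x : Tightness} {as : List A.Obj} {m n : A.Obj} {cs : List A.Obj}
    {κ : A.Hom .tight (m :: cs) n} {θ : A.Hom x as m} (hκ : LeftUniv κ) (hθ : LeftUniv θ) :
    LeftUniv (head κ θ) where
  inj {bs c g g'} e := by
    have hl : m :: (cs ++ (bs.map fun b => [b]).flatten) = m :: (cs ++ bs) := by
      rw [SkewMonCat.flatten_map_singleton]
    have hs (g : A.Hom .tight (n :: bs) c) :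
      Same (H := A.Hom) (castObjs hl (SkewMulticat.head g κ)) (SkewMulticat.head g κ) :=
      same_cast _ _
    refine hκ.inj ((hs g).symm.trans (Same.trans ?_ (hs g')))
    exact Same.of_eq (hθ.inj ((head_head g κ θ (hs g) rfl).trans
      (e.trans (head_head g' κ θ (hs g') rfl).symm)))
  surj {bs c} k := by
    have hl : as ++ (cs.map fun b => [b]).flatten ++ bs = as ++ (cs ++ bs) := by
      rw [SkewMonCat.flatten_map_singleton, List.append_assoc]
    obtain ⟨g₁, h₁⟩ := hθ.surj (castObjs (H := A.Hom) hl k)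
    obtain ⟨g, h⟩ := hκ.surj g₁
    exact ⟨g, (head_head g κ θ h.symm rfl).symm.trans (h₁.trans (same_cast _ _))⟩

lemma LeftUniv.of_same {x y : Tightness} {as as' : List A.Obj} {m : A.Obj} {θ : A.Hom x as m}
    {θ' : A.Hom y as' m} (e : Same (H := A.Hom) θ θ') (h : LeftUniv θ) : LeftUniv θ' := by
  cases e; exact h

lemma LeftUniv.post_inj {x : Tightness} {as : List A.Obj} {m : A.Obj} {θ : A.Hom x as m}
    (h : LeftUniv θ) {c : A.Obj} {g g' : A.Hom .tight [m] c}
    (e : Same (H := A.Hom) (post g θ) (post g' θ)) : g = g' :=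
  h.inj e

lemma LeftUniv.exists_post {x : Tightness} {as : List A.Obj} {m : A.Obj} {θ : A.Hom x as m}
    (h : LeftUniv θ) {c : A.Obj} (k : A.Hom x as c) :
    ∃ g : A.Hom .tight [m] c, Same (H := A.Hom) (post g θ) k := by
  obtain ⟨g, hg⟩ := h.surj (castObjs (H := A.Hom) (List.append_nil as).symm k)
  exact ⟨g, hg.trans (same_cast _ _)⟩

lemma leftUniv_one (a : A.Obj) : LeftUniv (A.one a) where
  inj {_ _ g g'} e := ((A.subst_one g).symm.trans (e.trans (A.subst_one g'))).eq
  surj k := ⟨k, A.subst_one k⟩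

/-- A choice of tensor products and a unit in a left representable skew multicategory. -/
structure Representation (A : SkewMulticat.{v, u}) where
  tensor : A.Obj → A.Obj → A.Obj
  pair : ∀ a b : A.Obj, A.Hom .tight [a, b] (tensor a b)
  unit : A.Obj
  point : A.Hom .loose [] unit
  leftUniv_pair : ∀ a b : A.Obj, LeftUniv (pair a b)
  leftUniv_point : LeftUniv point

/-- Only the tight binary and loose nullary universal multimaps are retained; longer products are
iterated from these. -/
lemma LeftRepresentable.nonempty_representation (h : A.LeftRepresentable) :
    Nonempty A.Representation := by
  choose m θ hθ using h.1
  exact ⟨{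
    tensor a b := m .tight [a, b] (by simp)
    pair a b := θ .tight [a, b] (by simp)
    unit := m .loose [] (fun _ => rfl)
    point := θ .loose [] (fun _ => rfl)
    leftUniv_pair a b := (h.2 _ _ _ _ (hθ .tight [a, b] (by simp))).leftUniv
    leftUniv_point := (h.2 _ _ _ _ (hθ .loose [] (fun _ => rfl))).leftUniv }⟩

/-- The multimap through which a given multimap factors along a left universal one. -/
noncomputable def LeftUniv.lift {x : Tightness} {as as' : List A.Obj} {m : A.Obj}
    {θ : A.Hom x as m} (h : LeftUniv θ) {c : A.Obj} (k : A.Hom x as' c)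
    (e : as' = as := by rfl) : A.Hom .tight [m] c :=
  (h.exists_post (castObjs (H := A.Hom) e k)).choose

lemma LeftUniv.post_lift {x : Tightness} {as as' : List A.Obj} {m : A.Obj} {θ : A.Hom x as m}
    (h : LeftUniv θ) {c : A.Obj} (k : A.Hom x as' c) (e : as' = as) :
    Same (H := A.Hom) (post (h.lift k e) θ) k :=
  (h.exists_post (castObjs (H := A.Hom) e k)).choose_spec.trans (same_cast _ _)

/-! ### The skew monoidal category of a left representable skew multicategory -/

namespace Representation

variable (R : A.Representation)

/-- The multimap `f ⊗ g : ā, b̄ → a ⊗ b` induced by `f : ā → a` and `g : b̄ → b`. -/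
def prod {x y : Tightness} {as bs : List A.Obj} {a b : A.Obj} (f : A.Hom x as a)
    (g : A.Hom y bs b) : A.Hom x (as ++ (bs ++ [])) (R.tensor a b) :=
  A.subst (R.pair a b) (.cons f (.cons g .nil))

lemma prod_congr {x y x' y' : Tightness} {as bs as' bs' : List A.Obj} {a b : A.Obj}
    {f : A.Hom x as a} {g : A.Hom y bs b} {f' : A.Hom x' as' a} {g' : A.Hom y' bs' b}
    (hf : Same (H := A.Hom) f f') (hg : Same (H := A.Hom) g g') :
    Same (H := A.Hom) (R.prod f g) (R.prod f' g') := by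
  cases hf; cases hg; exact .refl

lemma prod_one_one (a b : A.Obj) : R.prod (A.one a) (A.one b) = R.pair a b :=
  (A.subst_one (R.pair a b)).eq

/-- `(f ⊗ g)(hs, ks) = f(hs) ⊗ g(ks)`. -/
lemma prod_subst {x y : Tightness} {as bs : List A.Obj} {a b : A.Obj} (f : A.Hom x as a)
    (g : A.Hom y bs b) {xs ys : List Tightness} {ass bss : List (List A.Obj)}
    (hs : Family A.Hom xs ass as) (ks : Family A.Hom ys bss bs)
    {zs : List Tightness} {css : List (List A.Obj)}
    {fs : Family A.Hom zs css (as ++ (bs ++ []))} (e : FSame fs (hs.append (ks.append .nil))) :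
    Same (H := A.Hom) (A.subst (R.prod f g) fs) (R.prod (A.subst f hs) (A.subst g ks)) :=
  (subst_congr .refl e).trans
    (A.subst_assoc (R.pair a b) (.cons f (.cons g .nil)) (.cons hs (.cons ks .nil)))

/-- The tensor product of two tight unary maps. -/
noncomputable def tensorHom {a a' b b' : A.Obj} (f : A.Hom .tight [a] a')
    (g : A.Hom .tight [b] b') : A.Hom .tight [R.tensor a b] (R.tensor a' b') :=
  (R.leftUniv_pair a b).lift (R.prod f g)

lemma post_tensorHom_pair {a a' b b' : A.Obj} (f : A.Hom .tight [a] a')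
    (g : A.Hom .tight [b] b') :
    Same (H := A.Hom) (post (R.tensorHom f g) (R.pair a b)) (R.prod f g) :=
  (R.leftUniv_pair a b).post_lift (R.prod f g) _

lemma post_tensorHom {a a' b b' : A.Obj} (f : A.Hom .tight [a] a') (g : A.Hom .tight [b] b')
    {x y : Tightness} {as bs : List A.Obj} (h : A.Hom x as a) (k : A.Hom y bs b) :
    Same (H := A.Hom) (post (R.tensorHom f g) (R.prod h k)) (R.prod (post f h) (post g k)) :=
  (post_subst' _ _ _ (R.post_tensorHom_pair f g) .refl).trans
    (R.prod_subst f g (.cons h .nil) (.cons k .nil) .refl)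

lemma leftUniv_prod {x : Tightness} {as : List A.Obj} {a : A.Obj} {θ : A.Hom x as a}
    (h : LeftUniv θ) (b : A.Obj) : LeftUniv (R.prod θ (A.one b)) :=
  (R.leftUniv_pair a b).head h

/-- The associativity constraint. -/
noncomputable def assoc (a b c : A.Obj) :
    A.Hom .tight [R.tensor (R.tensor a b) c] (R.tensor a (R.tensor b c)) :=
  (R.leftUniv_prod (R.leftUniv_pair a b) c).lift (R.prod (A.one a) (R.pair b c))

lemma post_assoc_pair (a b c : A.Obj) :
    Same (H := A.Hom) (post (R.assoc a b c) (R.prod (R.pair a b) (A.one c)))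
      (R.prod (A.one a) (R.pair b c)) :=
  (R.leftUniv_prod (R.leftUniv_pair a b) c).post_lift _ _

/-- Substitute `f, g, h` into the defining equation of `α`. Having this for arbitrary multimaps of
any type lets the axioms be checked by rewriting products. -/
lemma post_assoc {a b c : A.Obj} {x y z : Tightness} {as bs cs : List A.Obj} (f : A.Hom x as a)
    (g : A.Hom y bs b) (h : A.Hom z cs c) :
    Same (H := A.Hom) (post (R.assoc a b c) (R.prod (R.prod f g) h))
      (R.prod f (R.prod g h)) := by
  have e : Same (H := A.Hom) (R.prod (R.prod f g) h)
      (A.subst (R.prod (R.pair a b) (A.one c)) (.cons f (.cons g (.cons h .nil)))) :=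
    ((R.prod_subst (R.pair a b) (A.one c) (.cons f (.cons g .nil)) (.cons h .nil) .refl).trans
      (R.prod_congr .refl (A.one_subst h))).symm
  refine (post_congr _ e).trans ?_
  refine (post_subst' _ _ _ (R.post_assoc_pair a b c) .refl).trans ?_
  exact (R.prod_subst (A.one a) (R.pair b c) (.cons f .nil) (.cons g (.cons h .nil)) .refl).trans
    (R.prod_congr (A.one_subst f) .refl)

/-- The left unit constraint. -/
noncomputable def left (a : A.Obj) : A.Hom .tight [R.tensor R.unit a] a :=
  (R.leftUniv_prod R.leftUniv_point a).lift (A.relax (Tightness.le_loose _) (A.one a))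

lemma post_left_point (a : A.Obj) :
    Same (H := A.Hom) (post (R.left a) (R.prod R.point (A.one a)))
      (A.relax (Tightness.le_loose _) (A.one a)) :=
  (R.leftUniv_prod R.leftUniv_point a).post_lift _ _

lemma relax_le_refl {x : Tightness} (h : x ≤ x) {as : List A.Obj} {b : A.Obj} (f : A.Hom x as b) :
    A.relax h f = f := A.relax_refl f

lemma family_relax_refl {xs : List Tightness} (hs : List.Forall₂ (· ≤ ·) xs xs)
    {ass : List (List A.Obj)} {bs : List A.Obj} (fs : Family A.Hom xs ass bs) :
    Family.relax (H := A.Hom) A.relax hs fs = fs := by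
  induction fs with
  | nil => rfl
  | cons f fs ih =>
    change Family.cons (A.relax _ f) (Family.relax (H := A.Hom) A.relax _ fs) = _
    rw [A.relax_refl, ih]

lemma relax_subst {x y : Tightness} (h : x ≤ y) {xs : List Tightness} {ass : List (List A.Obj)}
    {bs : List A.Obj} {c : A.Obj} (g : A.Hom x bs c) (fs : Family A.Hom xs ass bs)
    (h' : x.comp xs ≤ y.comp xs) :
    A.subst (A.relax h g) fs = A.relax h' (A.subst g fs) := by
  have hs : List.Forall₂ (· ≤ ·) xs xs := List.forall₂_refl xs
  have := A.subst_relax h hs g fs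
  rwa [family_relax_refl] at this

/-- Substitute `f` into the defining equation of `λ`; `point` is nullary, so it takes no share of
the inputs. -/
lemma post_left {a : A.Obj} {x : Tightness} {as : List A.Obj} (f : A.Hom x as a) :
    Same (H := A.Hom) (post (R.left a) (R.prod R.point f))
      (A.relax (Tightness.le_loose _) f) := by
  have e : Same (H := A.Hom) (R.prod R.point f)
      (A.subst (R.prod R.point (A.one a)) (.cons f .nil)) :=
    ((R.prod_subst R.point (A.one a) .nil (.cons f .nil) .refl).trans
      (R.prod_congr (A.subst_one _) (A.one_subst f))).symm
  refine (post_congr _ e).trans ?_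
  refine (post_subst' _ _ _ (R.post_left_point a) .refl).trans ?_
  exact (Same.of_eq (relax_subst _ _ _ (Tightness.le_loose _))).trans
    (relax_congr _ _ rfl (A.one_subst f))

lemma post_relax {x y : Tightness} {as : List A.Obj} {b c : A.Obj} (h : A.Hom .tight [b] c)
    (k : A.Hom x as b) (l l' : x ≤ y) :
    Same (H := A.Hom) (post h (A.relax l k)) (A.relax l' (post h k)) := by
  have := A.subst_relax (le_refl .tight) (.cons l .nil) h (.cons k .nil)
  rw [A.relax_refl] at this
  exact .of_eq this

/-- The right unit constraint. -/
def right (a : A.Obj) : A.Hom .tight [a] (R.tensor a R.unit) := R.prod (A.one a) R.point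

lemma post_right {a : A.Obj} {x : Tightness} {as : List A.Obj} (f : A.Hom x as a) :
    Same (H := A.Hom) (post (R.right a) f) (R.prod f R.point) :=
  (R.prod_subst (A.one a) R.point (.cons f .nil) .nil .refl).trans
    (R.prod_congr (A.one_subst f) (A.subst_one R.point))

/-- The type of a product is that of its first factor, since `t(x₁,x₂) = x₁`. Relaxing the second
factor therefore has no effect, which is the source of the triangle axiom; it is also why `right`,
with its loose second factor, is tight. -/
lemma prod_relax {x x' y y' : Tightness} (h : x ≤ x') (h' : y ≤ y') {as bs : List A.Obj}
    {a b : A.Obj} (f : A.Hom x as a) (g : A.Hom y bs b) :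
    R.prod (A.relax h f) (A.relax h' g) = A.relax h (R.prod f g) := by
  have := A.subst_relax (le_refl .tight) (.cons h (.cons h' .nil)) (R.pair a b)
    (.cons f (.cons g .nil))
  rw [A.relax_refl] at this
  exact this

/-- The skew monoidal category associated to a left representable skew multicategory. -/
noncomputable def toSkewMonCat : SkewMonCat.{v, u} where
  carrier := A.Obj
  category :=
    { Hom a b := A.Hom .tight [a] b
      id := A.one
      comp f g := post g f
      id_comp f := post_one f
      comp_id f := (one_post f).eq
      assoc f g h := (post_post h g f).eq }
  tensorObj := R.tensor
  tensorHom := R.tensorHom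
  unit := R.unit
  assoc := R.assoc
  left := R.left
  right := R.right
  tensor_id a b := (R.leftUniv_pair a b).post_inj <| (R.post_tensorHom_pair _ _).trans <|
    (Same.of_eq (R.prod_one_one a b)).trans (one_post _).symm
  tensor_comp {a a' a'' b b' b''} f f' g g' := (R.leftUniv_pair a b).post_inj <|
    (R.post_tensorHom_pair _ _).trans <|
      (R.post_tensorHom f' g' f g).symm.trans <|
      (post_congr _ (R.post_tensorHom_pair f g).symm).trans (post_post _ _ _)
  assoc_natural {a a' b b' c c'} f g h :=
    (R.leftUniv_prod (R.leftUniv_pair a b) c).post_inj <| by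
      refine (post_post _ _ _).symm.trans (Same.trans ?_ (post_post _ _ _))
      refine (post_congr _ ((R.post_tensorHom _ _ _ _).trans
        (R.prod_congr (R.post_tensorHom_pair f g) (.of_eq (post_one h))))).trans ?_
      refine (R.post_assoc f g h).trans ?_
      refine Same.symm ((post_congr _ (R.post_assoc_pair a b c)).trans ?_)
      exact (R.post_tensorHom _ _ _ _).trans
        (R.prod_congr (.of_eq (post_one f)) (R.post_tensorHom_pair g h))
  left_natural {a a'} f := (R.leftUniv_prod R.leftUniv_point a).post_inj <| by
      refine (post_post _ _ _).symm.trans (Same.trans ?_ (post_post _ _ _))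
      refine (post_congr _ ((R.post_tensorHom _ _ _ _).trans
        (R.prod_congr (one_post R.point) (.of_eq (post_one f))))).trans ?_
      refine (R.post_left f).trans (Same.symm ?_)
      refine (post_congr _ (R.post_left_point a)).trans ?_
      exact (post_relax f _ _ (Tightness.le_loose _)).trans (.of_eq (by rw [post_one]))
  right_natural {a a'} f := by
      refine ((R.post_right f).trans ?_).eq
      refine Same.symm ((R.post_tensorHom _ _ _ _).trans ?_)
      exact R.prod_congr (.of_eq (post_one f)) (one_post R.point)
  pentagon a b c d := by
    refine (R.leftUniv_prod (R.leftUniv_prod (R.leftUniv_pair a b) c) d).post_inj ?_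
    -- Writing the universal pair as a product of identities lets `post_assoc` evaluate every
    -- constraint; both sides become `1 ⊗ (1 ⊗ (1 ⊗ 1))`.
    rw [← R.prod_one_one a b]
    refine (post_post _ _ _).symm.trans ((post_congr _ (R.post_assoc _ _ _)).trans ?_)
    refine (R.post_assoc _ _ _).trans (Same.symm ?_)
    refine (post_post _ _ _).symm.trans ?_
    refine (post_post _ _ _).symm.trans ?_
    refine (post_congr _ (post_congr _ ((R.post_tensorHom _ _ _ _).trans
      (R.prod_congr (R.post_assoc _ _ _) (one_post _))))).trans ?_
    refine (post_congr _ (R.post_assoc _ _ _)).trans ?_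
    exact (R.post_tensorHom _ _ _ _).trans (R.prod_congr (one_post _) (R.post_assoc _ _ _))
  assoc_left a b := by
    refine (R.leftUniv_prod (R.leftUniv_prod R.leftUniv_point a) b).post_inj ?_
    refine (post_post _ _ _).symm.trans ((post_congr _ (R.post_assoc _ _ _)).trans ?_)
    refine (R.post_left _).trans (Same.symm ?_)
    refine (R.post_tensorHom _ _ _ _).trans ?_
    refine (R.prod_congr (R.post_left _) (one_post _)).trans ?_
    rw [← R.prod_relax _ (le_refl _), A.relax_refl]
    exact .refl
  triangle a b := by
    refine (R.leftUniv_pair a b).post_inj ?_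
    rw [← R.prod_one_one a b]
    refine (post_post _ _ _).symm.trans ?_
    refine (post_post _ _ _).symm.trans ?_
    refine (post_congr _ (post_congr _ ((R.post_tensorHom _ _ _ _).trans
      (R.prod_congr (R.post_right _) (one_post _))))).trans ?_
    refine (post_congr _ (R.post_assoc _ _ _)).trans ?_
    refine (R.post_tensorHom _ _ _ _).trans ?_
    refine (R.prod_congr (one_post _) (R.post_left _)).trans (Same.trans ?_ (one_post _).symm)
    -- What remains is `1_a ⊗ j(1_b)`, with the relaxation in the second factor only, hence `1_a ⊗
    -- 1_b`.
    have := R.prod_relax (le_refl .tight) (Tightness.le_loose _) (A.one a) (A.one b)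
    rw [A.relax_refl, A.relax_refl] at this
    exact .of_eq this
  right_assoc a b := by
    refine (R.leftUniv_pair a b).post_inj ?_
    rw [← R.prod_one_one a b]
    refine (post_post _ _ _).symm.trans ((post_congr _ (R.post_right _)).trans ?_)
    refine (R.post_assoc _ _ _).trans (Same.symm ?_)
    exact (R.post_tensorHom _ _ _ _).trans (R.prod_congr (one_post _) (R.post_right _))
  right_left := by
    refine R.leftUniv_point.post_inj ?_
    refine (post_post _ _ _).symm.trans ((post_congr _ (R.post_right _)).trans ?_)
    refine (R.post_left _).trans (Same.trans (.of_eq (relax_le_refl _ _)) (one_post _).symm)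

end Representation

/-! ### Morphisms and 2-cells induce lax functors and transformations -/

variable {C : SkewMulticat.{v, u}}

lemma Morphism.map_post (H : Morphism A B) {x : Tightness} {as : List A.Obj} {b c : A.Obj}
    (h : A.Hom .tight [b] c) (k : A.Hom x as b) :
    Same (H := B.Hom) (H.map (post h k)) (post (H.map h) (H.map k)) :=
  H.map_subst h (.cons k .nil)

lemma Morphism.id_map {x : Tightness} {as : List A.Obj} {b : A.Obj} (f : A.Hom x as b) :
    Same (H := A.Hom) ((Morphism.id A).map f) f :=
  same_cast _ _

lemma Morphism.comp_map (F : Morphism A B) (G : Morphism B C) {x : Tightness} {as : List A.Obj}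
    {b : A.Obj} (f : A.Hom x as b) :
    Same (H := C.Hom) ((F.comp G).map f) (G.map (F.map f)) :=
  same_cast _ _

namespace Representation

variable (R : A.Representation) (R' : B.Representation) (R'' : C.Representation)

/-- The unit constraint of the monoidal functor induced by a morphism. -/
noncomputable def mapUnit (H : Morphism A B) : B.Hom .tight [R'.unit] (H.obj R.unit) :=
  R'.leftUniv_point.lift (H.map R.point)

lemma post_mapUnit (H : Morphism A B) :
    Same (H := B.Hom) (post (R.mapUnit R' H) R'.point) (H.map R.point) :=
  R'.leftUniv_point.post_lift _ _

/-- The tensor constraint of the monoidal functor induced by a morphism. -/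
noncomputable def mapTensor (H : Morphism A B) (a b : A.Obj) :
    B.Hom .tight [R'.tensor (H.obj a) (H.obj b)] (H.obj (R.tensor a b)) :=
  (R'.leftUniv_pair (H.obj a) (H.obj b)).lift (H.map (R.pair a b))

lemma post_mapTensor_pair (H : Morphism A B) (a b : A.Obj) :
    Same (H := B.Hom) (post (R.mapTensor R' H a b) (R'.pair (H.obj a) (H.obj b)))
      (H.map (R.pair a b)) :=
  (R'.leftUniv_pair (H.obj a) (H.obj b)).post_lift _ _

lemma post_mapTensor (H : Morphism A B) {a b : A.Obj} {x y : Tightness} {as bs : List B.Obj}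
    (f : B.Hom x as (H.obj a)) (g : B.Hom y bs (H.obj b)) :
    Same (H := B.Hom) (post (R.mapTensor R' H a b) (R'.prod f g))
      (B.subst (H.map (R.pair a b)) (.cons f (.cons g .nil))) :=
  post_subst' _ _ _ (R.post_mapTensor_pair R' H a b) .refl

/-- Evaluates the tensor constraint on images under `H`, so that each axiom of a lax functor becomes
the image of an identity in `A`. -/
lemma post_mapTensor_map (H : Morphism A B) {a b : A.Obj} {x y x' y' : Tightness}
    {as bs : List A.Obj} {as' bs' : List B.Obj} {f : A.Hom x as a} {g : A.Hom y bs b}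
    {f' : B.Hom x' as' (H.obj a)} {g' : B.Hom y' bs' (H.obj b)}
    (hf : Same (H := B.Hom) f' (H.map f)) (hg : Same (H := B.Hom) g' (H.map g)) :
    Same (H := B.Hom) (post (R.mapTensor R' H a b) (R'.prod f' g')) (H.map (R.prod f g)) :=
  (post_congr _ (R'.prod_congr hf hg)).trans <| (R.post_mapTensor R' H _ _).trans
    (H.map_subst (R.pair a b) (.cons f (.cons g .nil))).symm

lemma same_one_map (H : Morphism A B) (a : A.Obj) :
    Same (H := B.Hom) (B.one (H.obj a)) (H.map (A.one a)) := .of_eq (H.map_one a).symm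

/-- The monoidal functor induced by a morphism of left representable skew multicategories. -/
noncomputable def laxFunctor (H : Morphism A B) :
    SkewMonCat.LaxFunctor R.toSkewMonCat R'.toSkewMonCat where
  obj := H.obj
  map {a b} f := H.map (x := .tight) (as := [a]) (b := b) f
  map_id a := H.map_one a
  map_comp f g := (H.map_subst (x := .tight) (bs := [_]) g (.cons f .nil)).eq
  ε := R.mapUnit R' H
  μ := R.mapTensor R' H
  μ_natural {a a' b b'} f g := (R'.leftUniv_pair _ _).post_inj <| by
    refine (post_post _ _ _).symm.trans (Same.trans ?_ (post_post _ _ _))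
    refine (post_congr _ (R'.post_tensorHom_pair _ _)).trans ?_
    refine (R.post_mapTensor_map R' H (x := .tight) (y := .tight) (as := [a]) (bs := [b])
      (f := f) (g := g) .refl .refl).trans (Same.symm ?_)
    refine (post_congr _ (R.post_mapTensor_pair R' H a b)).trans ?_
    exact (H.map_post _ _).symm.trans (H.map_same (R.post_tensorHom_pair f g))
  associativity a b c := (R'.leftUniv_prod (R'.leftUniv_pair _ _) _).post_inj <| by
    rw [← R'.prod_one_one]
    refine (post_post _ _ _).symm.trans ?_
    refine (post_post _ _ _).symm.trans (Same.symm ?_)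
    refine (post_post _ _ _).symm.trans ?_
    refine (post_post _ _ _).symm.trans (Same.symm ?_)
    have h (a : A.Obj) := same_one_map H a
    refine (post_congr _ (post_congr _ ((R'.post_tensorHom _ _ _ _).trans
      (R'.prod_congr (R.post_mapTensor_map R' H (h a) (h b)) (one_post _))))).trans ?_
    refine (post_congr _ (R.post_mapTensor_map R' H .refl (h c))).trans ?_
    refine (H.map_post _ _).symm.trans ?_
    refine (H.map_same (R.post_assoc _ _ _)).trans (Same.symm ?_)
    refine (post_congr _ (post_congr _ (R'.post_assoc _ _ _))).trans ?_
    refine (post_congr _ ((R'.post_tensorHom _ _ _ _).trans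
      (R'.prod_congr (one_post _) (R.post_mapTensor_map R' H (h b) (h c))))).trans ?_
    exact R.post_mapTensor_map R' H (h a) .refl
  left_unitality a := (R'.leftUniv_prod R'.leftUniv_point _).post_inj <| by
    refine (post_post _ _ _).symm.trans ?_
    refine (post_post _ _ _).symm.trans ?_
    refine (post_congr _ (post_congr _ ((R'.post_tensorHom _ _ _ _).trans
      (R'.prod_congr (R.post_mapUnit R' H) (one_post _))))).trans ?_
    refine (post_congr _ (R.post_mapTensor_map R' H .refl (same_one_map H a))).trans ?_
    refine (H.map_post _ _).symm.trans ?_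
    refine (H.map_same (R.post_left _)).trans (Same.symm ?_)
    exact (R'.post_left _).trans (.of_eq ((congrArg _ (H.map_one a).symm).trans
      (H.map_relax _ _).symm))
  right_unitality a := by
    refine Same.eq ?_
    refine (post_post _ _ _).symm.trans ?_
    refine (post_congr _ ((R'.post_tensorHom _ _ _ _).trans
      (R'.prod_congr (one_post _) (R.post_mapUnit R' H)))).trans ?_
    exact R.post_mapTensor_map R' H (same_one_map H a) .refl

/-- The monoidal transformation induced by a 2-cell of left representable skew multicategories. -/
noncomputable def transformation {F G : Morphism A B} (φ : Transformation F G) :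
    SkewMonCat.Transformation (R.laxFunctor R' F) (R.laxFunctor R' G) where
  app := φ.app
  natural {a b} f := (φ.natural (x := .tight) (as := [a]) f).eq
  unit := R'.leftUniv_point.post_inj <| by
    refine (post_post _ _ _).symm.trans ?_
    refine (post_congr _ (R.post_mapUnit R' F)).trans ?_
    refine (φ.natural R.point).trans ?_
    -- Naturality at a nullary map substitutes the empty tuple on the right, so no component of `φ`
    -- survives there.
    exact (B.subst_one (G.map R.point)).trans (R.post_mapUnit R' G).symm
  tensor a b := (R'.leftUniv_pair _ _).post_inj <| by
    refine (post_post _ _ _).symm.trans (Same.trans ?_ (post_post _ _ _))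
    refine (post_congr _ (R.post_mapTensor_pair R' F a b)).trans ?_
    refine (φ.natural (R.pair a b)).trans (Same.symm ?_)
    refine (post_congr _ (R'.post_tensorHom_pair _ _)).trans ?_
    exact R.post_mapTensor R' G _ _

lemma laxFunctor_id : R.laxFunctor R (Morphism.id A) = SkewMonCat.LaxFunctor.id _ := by
  refine SkewMonCat.laxFunctor_ext rfl (heq_of_eq ?_) (heq_of_eq ?_)
  · refine R.leftUniv_point.post_inj ?_
    exact (R.post_mapUnit R _).trans ((Morphism.id_map _).trans (one_post R.point).symm)
  · funext a b
    refine (R.leftUniv_pair a b).post_inj ?_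
    exact (R.post_mapTensor_pair R _ a b).trans
      ((Morphism.id_map _).trans (one_post (R.pair a b)).symm)

/-- Constraints are determined by their values on universal maps. Arbitrary representations at the
three places are allowed, so the lemma also governs changes of representation. -/
lemma laxFunctor_comp (F : Morphism A B) (G : Morphism B C) :
    R.laxFunctor R'' (F.comp G) = (R.laxFunctor R' F).comp (R'.laxFunctor R'' G) := by
  refine SkewMonCat.laxFunctor_ext rfl (heq_of_eq ?_) (heq_of_eq ?_)
  · refine R''.leftUniv_point.post_inj ?_
    refine (R.post_mapUnit R'' _).trans ((F.comp_map G _).trans (Same.symm ?_))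
    refine (post_post (G.map (R.mapUnit R' F)) (R'.mapUnit R'' G) R''.point).symm.trans ?_
    refine (post_congr _ (R'.post_mapUnit R'' G)).trans ?_
    exact (G.map_post _ _).symm.trans (G.map_same (R.post_mapUnit R' F))
  · funext (a : A.Obj) (b : A.Obj)
    refine (R''.leftUniv_pair (G.obj (F.obj a)) (G.obj (F.obj b))).post_inj ?_
    refine (R.post_mapTensor_pair R'' _ a b).trans ((F.comp_map G _).trans (Same.symm ?_))
    refine (post_post (G.map (R.mapTensor R' F a b)) (R'.mapTensor R'' G _ _)
      (R''.pair _ _)).symm.trans ?_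
    refine (post_congr _ (R'.post_mapTensor_pair R'' G _ _)).trans ?_
    exact (G.map_post _ _).symm.trans (G.map_same (R.post_mapTensor_pair R' F a b))

end Representation

end SkewMulticat

/-- A chosen representation of a left representable skew multicategory. -/
noncomputable def LeftRepSkewMulticat.representation (A : LeftRepSkewMulticat.{v, u}) :
    SkewMulticat.Representation (Subtype.val A) :=
  (SkewMulticat.LeftRepresentable.nonempty_representation (Subtype.property A)).some

/-- The 2-functor sending a left representable skew multicategory to its skew monoidal category. -/
noncomputable def LeftRepSkewMulticat.skewMonFunctor :
    StrictPseudofunctor LeftRepSkewMulticat.{v, u} SkewMonCat.{v, u} :=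
  .mk'' {
    obj A := A.representation.toSkewMonCat
    map {A B} F := A.representation.laxFunctor B.representation F.hom
    map₂ {A B _ _} φ := A.representation.transformation B.representation φ.hom
    map₂_id _ := rfl
    map₂_comp _ _ := rfl
    map_id A := A.representation.laxFunctor_id
    map_comp {A B C} F G :=
      A.representation.laxFunctor_comp B.representation C.representation F.hom G.hom
    map₂_whisker_left _ _ _ _ := SkewMonCat.eq_conj _ _ _ _ fun _ => HEq.rfl
    map₂_whisker_right _ _ := SkewMonCat.eq_conj _ _ _ _ fun _ => HEq.rfl }

/-! ### The unit: recovering a skew monoidal category -/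

namespace SkewMonCat

variable (C : SkewMonCat.{v, u}) {D : SkewMonCat.{v, u}}

lemma isUniversal_id_loose (as : List C.carrier) :
    C.toMulticat.IsUniversal (x := .loose) (as := as) (m := C.act C.unit as) (𝟙 _) :=
  fun (b : C.carrier) => (precomp_bijective (eqToHom (act_append C.unit as [])) _).comp
    ((precomp_bijective (𝟙 (C.act C.unit as)) _).comp (precomp_bijective (𝟙 _) b))

lemma isUniversal_id_tight (a : C.carrier) (as : List C.carrier) :
    C.toMulticat.IsUniversal (x := .tight) (as := a :: as) (m := C.act a as) (𝟙 _) :=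
  fun (b : C.carrier) => (precomp_bijective (eqToHom (act_append a as [])) _).comp
    ((precomp_bijective (𝟙 (C.act a as)) _).comp (precomp_bijective (𝟙 _) b))

/-- The skew multicategory of a skew monoidal category is represented by the given tensor
product and unit. -/
def representation : C.toMulticat.Representation where
  tensor := C.tensorObj
  pair a b := 𝟙 (C.tensorObj a b)
  unit := C.unit
  point := 𝟙 C.unit
  leftUniv_pair a b := SkewMulticat.IsLeftUniversal.leftUniv
    (Multimap.isLeftUniversal _ (C.isUniversal_id_tight a [b]))
  leftUniv_point := SkewMulticat.IsLeftUniversal.leftUniv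
    (Multimap.isLeftUniversal _ (C.isUniversal_id_loose []))

variable {C}

/-- The recovered composition inserts a transport and the action of the empty tuple. Both are
identities, but this makes the recovered structure only propositionally equal to `C`. -/
lemma post_eq {a b c : C.carrier} (f : a ⟶ b) (g : b ⟶ c) :
    SkewMulticat.post (A := C.toMulticat) (x := .tight) (as := [a]) (b := b) (c := c) g f =
      f ≫ g := by
  change 𝟙 _ ≫ f ≫ 𝟙 _ ≫ g = _
  simp

lemma representation_tensorHom {a a' b b' : C.carrier} (f : a ⟶ a') (g : b ⟶ b') :
    C.representation.tensorHom (a := a) (a' := a') (b := b) (b' := b') f g =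
      C.tensorHom f g := by
  refine ((C.representation.leftUniv_pair a b).post_inj
    ((C.representation.post_tensorHom_pair _ _).trans (.of_eq ?_)))
  change 𝟙 _ ≫ C.tensorHom f (𝟙 b) ≫
    (𝟙 _ ≫ (𝟙 _ ≫ C.tensorHom (𝟙 a') g) ≫ 𝟙 _) ≫ 𝟙 (C.tensorObj a' b') =
      𝟙 _ ≫ 𝟙 (C.tensorObj a b) ≫ 𝟙 _ ≫ C.tensorHom f g
  simp [← C.tensor_comp]

/-- The universal multimaps here are identities, so the equation characterising the recovered
constraint says that it is the original one. -/
lemma representation_assoc (a b c : C.carrier) :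
    C.representation.assoc a b c = C.assoc a b c := by
  refine ((C.representation.leftUniv_prod (C.representation.leftUniv_pair a b) c).post_inj
    ((C.representation.post_assoc_pair a b c).trans (.of_eq ?_)))
  change 𝟙 _ ≫ C.tensorHom (C.tensorHom (𝟙 a) (𝟙 b)) (𝟙 c) ≫ (𝟙 _ ≫ ((C.assoc a b c ≫ 𝟙 _) ≫
    C.tensorHom (𝟙 a) (𝟙 (C.tensorObj b c))) ≫ 𝟙 _) ≫ 𝟙 _ =
      𝟙 _ ≫ (𝟙 _ ≫ C.tensorHom (𝟙 (C.tensorObj a b)) (𝟙 c) ≫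
        (𝟙 _ ≫ (𝟙 _ ≫ C.tensorHom (𝟙 _) (𝟙 c)) ≫ 𝟙 _) ≫ 𝟙 _) ≫
        𝟙 _ ≫ C.assoc a b c
  simp [C.tensor_id]

lemma representation_left (a : C.carrier) :
    C.representation.left a = C.left a := by
  refine ((C.representation.leftUniv_prod C.representation.leftUniv_point a).post_inj
    ((C.representation.post_left_point a).trans (.of_eq ?_)))
  change C.left a ≫ 𝟙 a = 𝟙 _ ≫ (𝟙 _ ≫ C.tensorHom (𝟙 C.unit) (𝟙 a) ≫
    (𝟙 _ ≫ (𝟙 _ ≫ C.tensorHom (𝟙 _) (𝟙 a)) ≫ 𝟙 _) ≫ 𝟙 _) ≫ 𝟙 _ ≫ C.left a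
  simp [C.tensor_id]

lemma representation_right (a : C.carrier) :
    C.representation.right a = C.right a := by
  change 𝟙 _ ≫ 𝟙 _ ≫ (𝟙 _ ≫ (C.right a ≫ 𝟙 _ ≫ C.tensorHom (𝟙 a) (𝟙 C.unit)) ≫ 𝟙 _) ≫ 𝟙 _ = _
  simp [C.tensor_id]

lemma id_comp_id_comp {K : Type u₁} [Category.{v₁} K] {a b : K} {f g : a ⟶ a} {h : a ⟶ b}
    (hf : f = 𝟙 a) (hg : g = 𝟙 a) : f ≫ g ≫ h = h := by
  subst hf hg; simp

lemma comp_id_comp_id {K : Type u₁} [Category.{v₁} K] {a b : K} {f g : b ⟶ b} {h : a ⟶ b}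
    (hf : f = 𝟙 b) (hg : g = 𝟙 b) : h ≫ f ≫ g = h := by
  subst hf hg; simp

variable (C)

/-- The comparison from a skew monoidal category to the one recovered from its multimaps. -/
noncomputable def toRepresented : LaxFunctor C C.representation.toSkewMonCat where
  obj a := a
  map f := f
  map_id _ := rfl
  map_comp f g := (post_eq f g).symm
  ε := 𝟙 C.unit
  μ a b := 𝟙 (C.tensorObj a b)
  μ_natural f g := (post_eq _ _).trans <| (Category.comp_id _).trans <|
    (representation_tensorHom f g).trans <| (Category.id_comp _).symm.trans (post_eq _ _).symm
  associativity a b c :=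
    (id_comp_id_comp (K := C.representation.toSkewMonCat.carrier)
      (C.representation.toSkewMonCat.tensor_id _ _) rfl).trans <|
    (representation_assoc a b c).symm.trans
    (comp_id_comp_id (K := C.representation.toSkewMonCat.carrier)
      (C.representation.toSkewMonCat.tensor_id _ _) rfl).symm
  left_unitality a :=
    (id_comp_id_comp (K := C.representation.toSkewMonCat.carrier)
      (C.representation.toSkewMonCat.tensor_id _ _) rfl).trans (representation_left a).symm
  right_unitality a :=
    (comp_id_comp_id (K := C.representation.toSkewMonCat.carrier)
      (C.representation.toSkewMonCat.tensor_id _ _) rfl).trans (representation_right a)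

/-- The comparison to a skew monoidal category from the one recovered from its multimaps. -/
noncomputable def ofRepresented : LaxFunctor C.representation.toSkewMonCat C where
  obj a := a
  map f := f
  map_id _ := rfl
  map_comp f g := post_eq (C := C) f g
  ε := 𝟙 C.unit
  μ a b := 𝟙 (C.tensorObj a b)
  μ_natural f g := (Category.comp_id _).trans <|
    (representation_tensorHom (C := C) f g).symm.trans (Category.id_comp (obj := C.carrier) _).symm
  associativity a b c :=
    (id_comp_id_comp (K := C.carrier) (C.tensor_id _ _) rfl).trans <|
    (representation_assoc (C := C) a b c).trans
    (comp_id_comp_id (K := C.carrier) (C.tensor_id _ _) rfl).symm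
  left_unitality a :=
    (id_comp_id_comp (K := C.carrier) (C.tensor_id _ _) rfl).trans (representation_left (C := C) a)
  right_unitality a :=
    (comp_id_comp_id (K := C.carrier) (C.tensor_id _ _) rfl).trans
      (representation_right (C := C) a).symm

lemma toRepresented_comp_ofRepresented :
    C.toRepresented.comp C.ofRepresented = LaxFunctor.id C :=
  laxFunctor_ext rfl (heq_of_eq (Category.comp_id (𝟙 C.unit)))
    (heq_of_eq (funext fun _ => funext fun _ => Category.comp_id (𝟙 (C.tensorObj _ _))))

lemma ofRepresented_comp_toRepresented :
    C.ofRepresented.comp C.toRepresented = LaxFunctor.id _ :=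
  laxFunctor_ext rfl
    (heq_of_eq (Category.comp_id (obj := C.representation.toSkewMonCat.carrier) (𝟙 _)))
    (heq_of_eq (funext fun _ => funext fun _ =>
      Category.comp_id (obj := C.representation.toSkewMonCat.carrier) (𝟙 _)))

variable {C}

lemma representation_mapUnit (F : LaxFunctor C D) :
    C.representation.mapUnit D.representation F.toMorphism = F.ε := by
  refine D.representation.leftUniv_point.post_inj
    ((C.representation.post_mapUnit D.representation F.toMorphism).trans (.of_eq ?_))
  change F.ε ≫ 𝟙 _ ≫ F.map (𝟙 _) = 𝟙 _ ≫ 𝟙 _ ≫ 𝟙 _ ≫ F.ε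
  simp

lemma representation_mapTensor (F : LaxFunctor C D) (a b : C.carrier) :
    C.representation.mapTensor D.representation F.toMorphism a b = F.μ a b := by
  refine (D.representation.leftUniv_pair _ _).post_inj
    ((C.representation.post_mapTensor_pair D.representation F.toMorphism a b).trans (.of_eq ?_))
  change (F.μ a b ≫ 𝟙 _) ≫ F.map (𝟙 _) = 𝟙 _ ≫ 𝟙 _ ≫ 𝟙 _ ≫ F.μ a b
  simp

lemma comp_map_id {K L : Type*} [Category* K] [Category* L] (F : K ⥤ L) {a : L} {b : K}
    (f : a ⟶ F.obj b) : f ≫ F.map (𝟙 b) = f := by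
  simp

namespace LaxFunctor

lemma comp_assoc {E E' : SkewMonCat.{v, u}} (F : LaxFunctor C D) (G : LaxFunctor D E)
    (H : LaxFunctor E E') : (F.comp G).comp H = F.comp (G.comp H) :=
  assoc' F G H

lemma id_comp (F : LaxFunctor C D) : (LaxFunctor.id C).comp F = F := id_comp' F

end LaxFunctor

/-- For the canonical representations the induced lax functor has the constraints of `F`, and the
comparisons contribute only identities. -/
lemma comp_toRepresented (F : LaxFunctor C D) :
    F.comp D.toRepresented = C.toRepresented.comp
      (C.representation.laxFunctor D.representation F.toMorphism) := by
  refine laxFunctor_ext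
    (Functor.hext (fun _ => rfl) fun _ _ f => heq_of_eq (Category.id_comp (F.map f)).symm)
    (heq_of_eq ?_) (heq_of_eq (funext fun a => funext fun b => ?_))
  · refine (post_eq (𝟙 _) F.ε).trans ((Category.id_comp _).trans (Eq.symm ?_))
    exact (comp_map_id _ _).trans (representation_mapUnit F)
  · refine (post_eq (𝟙 _) (F.μ a b)).trans ((Category.id_comp _).trans (Eq.symm ?_))
    exact (comp_map_id _ _).trans (representation_mapTensor F a b)

/-- The isomorphism from a skew monoidal category to the one obtained from its skew
multicategory by choosing a representation. -/
noncomputable def unitHom (R : C.toMulticat.Representation) : LaxFunctor C R.toSkewMonCat :=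
  C.toRepresented.comp (C.representation.laxFunctor R (SkewMulticat.Morphism.id _))

/-- The inverse of `unitHom`. -/
noncomputable def unitInv (R : C.toMulticat.Representation) : LaxFunctor R.toSkewMonCat C :=
  (R.laxFunctor C.representation (SkewMulticat.Morphism.id _)).comp C.ofRepresented

/-- Passing from the canonical representation to `R` and back is induced by the identity morphism,
so it cancels by functoriality of `laxFunctor`. -/
lemma unitHom_comp_unitInv (R : C.toMulticat.Representation) :
    (unitHom R).comp (unitInv R) = LaxFunctor.id C := by
  have h := C.representation.laxFunctor_comp R C.representation (SkewMulticat.Morphism.id _)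
    (SkewMulticat.Morphism.id _)
  have e : (SkewMulticat.Morphism.id C.toMulticat).comp (SkewMulticat.Morphism.id _) =
    SkewMulticat.Morphism.id _ := SkewMulticat.comp_id' _
  rw [e, SkewMulticat.Representation.laxFunctor_id] at h
  rw [unitHom, unitInv, LaxFunctor.comp_assoc, ← LaxFunctor.comp_assoc _ _ C.ofRepresented, ← h,
    LaxFunctor.id_comp, toRepresented_comp_ofRepresented]

lemma unitInv_comp_unitHom (R : C.toMulticat.Representation) :
    (unitInv R).comp (unitHom R) = LaxFunctor.id R.toSkewMonCat := by
  have h := R.laxFunctor_comp C.representation R (SkewMulticat.Morphism.id _)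
    (SkewMulticat.Morphism.id _)
  have e : (SkewMulticat.Morphism.id C.toMulticat).comp (SkewMulticat.Morphism.id _) =
    SkewMulticat.Morphism.id _ := SkewMulticat.comp_id' _
  rw [e, SkewMulticat.Representation.laxFunctor_id] at h
  rw [unitHom, unitInv, LaxFunctor.comp_assoc, ← LaxFunctor.comp_assoc C.ofRepresented,
    ofRepresented_comp_toRepresented, LaxFunctor.id_comp, ← h]

lemma comp_unitHom (F : LaxFunctor C D) (R : C.toMulticat.Representation)
    (R' : D.toMulticat.Representation) :
    F.comp (unitHom R') = (unitHom R).comp (R.laxFunctor R' F.toMorphism) := by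
  have h := C.representation.laxFunctor_comp D.representation R' F.toMorphism
    (SkewMulticat.Morphism.id _)
  have h' := C.representation.laxFunctor_comp R R' (SkewMulticat.Morphism.id _) F.toMorphism
  have e : F.toMorphism.comp (SkewMulticat.Morphism.id _) = F.toMorphism :=
    SkewMulticat.comp_id' (A := C.toMulticat) _
  have e' : (SkewMulticat.Morphism.id _).comp F.toMorphism = F.toMorphism :=
    SkewMulticat.id_comp' (A := C.toMulticat) _
  rw [e] at h
  rw [e', h] at h'
  rw [unitHom, unitHom, LaxFunctor.comp_assoc, ← LaxFunctor.comp_assoc, comp_toRepresented,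
    LaxFunctor.comp_assoc, h']

lemma comp_eqToHom {F F' G G' : C ⟶ D} (h : F = F') (h' : G = G') (φ : F ⟶ G) (ψ : F' ⟶ G')
    (H : ∀ a, Transformation.app φ a ≍ Transformation.app ψ a) :
    φ ≫ eqToHom h' = eqToHom h ≫ ψ := by
  rw [eq_conj h h'.symm φ ψ H]
  simp

/-- A skew monoidal category is recovered from its skew multicategory. -/
noncomputable def unitIso : TwoNatIso (StrictPseudofunctor.id SkewMonCat.{v, u})
    (multicatFunctor.comp LeftRepSkewMulticat.skewMonFunctor) where
  hom C := unitHom (LeftRepSkewMulticat.representation (multicatFunctor.obj C))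
  inv C := unitInv (LeftRepSkewMulticat.representation (multicatFunctor.obj C))
  hom_inv _ := unitHom_comp_unitInv _
  inv_hom _ := unitInv_comp_unitHom _
  naturality F := comp_unitHom F _ _
  -- The comparison is the identity on objects and arrows, so the components agree definitionally.
  naturality₂ {_ _ F G} _ := comp_eqToHom (comp_unitHom F _ _) (comp_unitHom G _ _) _ _
    fun _ => HEq.rfl

end SkewMonCat

/-! ### Comparing multimaps of the recovered category with the original ones -/

section

variable {I : Type u₁} {J : Type u₂} {K : Type v₁} {P Q : I → J → K → Type v₂}

/-- Apply a map preserving indices to each entry of a tuple. -/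
def Family.mapHom (m : ∀ {i j k}, P i j k → Q i j k) : ∀ {is : List I} {js : List J} {ks : List K},
    Family P is js ks → Family Q is js ks
  | _, _, _, .nil => .nil
  | _, _, _, .cons f fs => .cons (m f) (Family.mapHom m fs)

lemma Family.append_append {is is' is'' : List I} {js js' js'' : List J} {ks ks' ks'' : List K}
    (f : Family P is js ks) (g : Family P is' js' ks') (h : Family P is'' js'' ks'') :
    FSame ((f.append g).append h) (f.append (g.append h)) := by
  induction f with
  | nil => exact .refl
  | cons p f ih => exact .cons' p ih

end

namespace SkewMulticat

variable {A B : SkewMulticat.{v, u}}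

namespace Representation

variable (R : A.Representation) (R' : B.Representation)

/-- The multimap `X ⊗ 1 ⊗ … ⊗ 1` with values in `c ⊗ a₁ ⊗ … ⊗ aₙ`, for `X` with values in `c`. -/
noncomputable def run : ∀ {x : Tightness} {xs : List A.Obj} {c : A.Obj} (_ : A.Hom x xs c)
    (as : List A.Obj), A.Hom x (xs ++ as) (R.toSkewMonCat.act c as)
  | _, xs, _, X, [] => castObjs (List.append_nil xs).symm X
  | _, xs, _, X, a :: as =>
    castObjs (List.append_assoc xs [a] as) (run (R.prod X (A.one a)) as)

variable {x y : Tightness} {xs ys : List A.Obj} {c : A.Obj}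

lemma run_nil (X : A.Hom x xs c) : Same (H := A.Hom) (R.run X []) X := same_cast _ _

lemma run_cons (X : A.Hom x xs c) (a : A.Obj) (as : List A.Obj) :
    Same (H := A.Hom) (R.run X (a :: as)) (R.run (R.prod X (A.one a)) as) := same_cast _ _

lemma run_congr {X : A.Hom x xs c} {Y : A.Hom y ys c} (h : Same (H := A.Hom) X Y)
    (as : List A.Obj) : Same (H := A.Hom) (R.run X as) (R.run Y as) := by
  cases h; exact .refl

/-- Each factor `⊗ 1` preserves left universality. Applied to an identity or to `point`, this gives
universal maps into all left-bracketed products. -/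
lemma leftUniv_run {X : A.Hom x xs c} (h : LeftUniv X) (as : List A.Obj) :
    LeftUniv (R.run X as) := by
  induction as generalizing xs c with
  | nil => exact h.of_same (R.run_nil X).symm
  | cons a as ih => exact (ih (R.leftUniv_prod h a)).of_same (R.run_cons X a as).symm

lemma run_relax (l : x ≤ y) (X : A.Hom x xs c) (as : List A.Obj) :
    Same (H := A.Hom) (R.run (A.relax l X) as) (A.relax l (R.run X as)) := by
  induction as generalizing xs c with
  | nil => exact (R.run_nil _).trans (relax_congr _ _ rfl (R.run_nil X).symm)
  | cons a as ih =>
    refine (R.run_cons _ a as).trans (Same.trans ?_ (relax_congr l l rfl (R.run_cons X a as).symm))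
    refine (R.run_congr (.of_eq ?_) as).trans (ih _)
    have := R.prod_relax l (le_refl .tight) X (A.one a)
    rwa [A.relax_refl] at this

lemma post_actHom {c' : A.Obj} (h : A.Hom .tight [c] c') (X : A.Hom x xs c) (as : List A.Obj) :
    Same (H := A.Hom) (post (SkewMonCat.actHom (C := R.toSkewMonCat) h as) (R.run X as))
      (R.run (post h X) as) := by
  induction as generalizing xs c c' with
  | nil => exact (post_congr _ (R.run_nil X)).trans (R.run_nil _).symm
  | cons a as ih =>
    refine (post_congr _ (R.run_cons X a as)).trans ((ih _ _).trans ?_)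
    refine (R.run_congr ?_ as).trans (R.run_cons _ a as).symm
    exact (R.post_tensorHom _ _ _ _).trans (R.prod_congr .refl (one_post _))

lemma post_eqToHom_run (X : A.Hom x xs c) (as bs : List A.Obj) :
    Same (H := A.Hom) (post (eqToHom (C := R.toSkewMonCat.carrier)
      (SkewMonCat.act_append (C := R.toSkewMonCat) c as bs)) (R.run X (as ++ bs)))
        (R.run (R.run X as) bs) := by
  induction as generalizing xs c with
  | nil => exact (one_post _).trans (R.run_congr (R.run_nil X).symm bs)
  | cons a as ih =>
    exact (post_congr _ (R.run_cons X a (as ++ bs))).trans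
      ((ih _).trans (R.run_congr (R.run_cons X a as).symm bs))

/-- Rebrackets `(f ⊗ k) ⊗ 1 ⊗ … ⊗ 1` one factor at a time by `post_assoc`. -/
lemma post_assocAct {a : A.Obj} (f : A.Hom x xs c) (k : A.Hom y ys a) (as : List A.Obj) :
    Same (H := A.Hom) (post (R.toSkewMonCat.assocAct c a as) (R.run (R.prod f k) as))
      (R.prod f (R.run k as)) := by
  induction as generalizing ys a with
  | nil => exact (one_post _).trans ((R.run_nil _).trans (R.prod_congr .refl (R.run_nil k).symm))
  | cons b as ih =>
    refine (post_congr _ (R.run_cons _ b as)).trans ?_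
    refine (post_post _ _ _).symm.trans ?_
    refine (post_congr _ ((R.post_actHom _ _ as).trans
      (R.run_congr (R.post_assoc _ _ _) as))).trans ?_
    exact (ih _).trans (R.prod_congr .refl (R.run_cons k b as).symm)

/-- The multimap `X ⊗ f₁ ⊗ … ⊗ fₙ`. -/
noncomputable def runFam : ∀ {x : Tightness} {xs : List A.Obj} {c : A.Obj} (_ : A.Hom x xs c)
    {ys : List Tightness} {ass : List (List A.Obj)} {bs : List A.Obj}
    (_ : Family A.Hom ys ass bs), A.Hom x (xs ++ ass.flatten) (R.toSkewMonCat.act c bs)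
  | _, xs, _, X, _, _, _, .nil => castObjs (List.append_nil xs).symm X
  | _, _, _, X, _, _, _, .cons f fs =>
    castObjs (by rw [List.append_nil, List.append_assoc]; rfl) (runFam (R.prod X f) fs)

section

variable {zs : List Tightness} {ass : List (List A.Obj)} {bs : List A.Obj}

lemma runFam_nil (X : A.Hom x xs c) : Same (H := A.Hom) (R.runFam X .nil) X := same_cast _ _

lemma runFam_cons (X : A.Hom x xs c) {b : A.Obj} (f : A.Hom y ys b) (fs : Family A.Hom zs ass bs) :
    Same (H := A.Hom) (R.runFam X (.cons f fs)) (R.runFam (R.prod X f) fs) := same_cast _ _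

lemma runFam_congr {X : A.Hom x xs c} {Y : A.Hom y ys c} (h : Same (H := A.Hom) X Y)
    (fs : Family A.Hom zs ass bs) : Same (H := A.Hom) (R.runFam X fs) (R.runFam Y fs) := by
  cases h; exact .refl

/-- The induction moves the head of `fs` to the end of `F` while replacing `X` by `X ⊗ 1`; hence
both must stay general. -/
lemma run_subst (X : A.Hom x xs c) {xs' : List Tightness} {ass' : List (List A.Obj)}
    (F : Family A.Hom xs' ass' xs) (fs : Family A.Hom zs ass bs) :
    Same (H := A.Hom) (A.subst (R.run X bs) (F.append fs)) (R.runFam (A.subst X F) fs) := by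
  induction fs generalizing x xs c xs' ass' with
  | nil =>
    exact (subst_congr (R.run_nil X) (Family.append_nil F)).trans (R.runFam_nil _).symm
  | @cons y as b zs ass bs f fs ih =>
    refine (subst_congr (R.run_cons X b bs)
      (Family.append_append F (.cons f .nil) fs).symm).trans ?_
    refine (ih (R.prod X (A.one b)) (F.append (.cons f .nil))).trans ?_
    refine (R.runFam_congr ((R.prod_subst X (A.one b) F (.cons f .nil) .refl).trans
      (R.prod_congr .refl (A.one_subst f))) fs).trans ?_
    exact (R.runFam_cons _ f fs).symm

end

/-- The multimap of a left representable skew multicategory corresponding to a multimap of its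
skew monoidal category. -/
noncomputable def toHom : ∀ {x : Tightness} {as : List A.Obj} {b : A.Obj},
    R.toSkewMonCat.Multimap x as b → A.Hom x as b
  | .tight, a :: as, _, f => castObjs (List.append_nil _) (post f (R.run (A.one a) as))
  | .loose, as, _, f => castObjs (List.append_nil _) (post f (R.run R.point as))

lemma toHom_tight {a : A.Obj} {as : List A.Obj} {b : A.Obj}
    (f : A.Hom .tight [R.toSkewMonCat.act a as] b) :
    Same (H := A.Hom) (R.toHom (x := .tight) (as := a :: as) f) (post f (R.run (A.one a) as)) :=
  same_cast _ _

lemma toHom_loose {as : List A.Obj} {b : A.Obj}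
    (f : A.Hom .tight [R.toSkewMonCat.act R.unit as] b) :
    Same (H := A.Hom) (R.toHom (x := .loose) (as := as) f) (post f (R.run R.point as)) :=
  same_cast _ _

/-- Precomposition with a left universal map, by `leftUniv_run`; in the tight nullary case both
sides are empty. -/
lemma toHom_bijective (x : Tightness) (as : List A.Obj) (b : A.Obj) :
    Function.Bijective (R.toHom (x := x) (as := as) (b := b)) := by
  match x, as with
  | .tight, [] => exact ⟨fun f => f.elim, fun f => ((A.isEmpty_tight_nil b).false f).elim⟩
  | .tight, a :: as =>
    have h := R.leftUniv_run (leftUniv_one a) as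
    refine ⟨fun f g e => h.post_inj ((R.toHom_tight f).symm.trans ((Same.of_eq e).trans
      (R.toHom_tight g))), fun k => ?_⟩
    obtain ⟨g, hg⟩ := h.exists_post k
    exact ⟨g, ((R.toHom_tight g).trans hg).eq⟩
  | .loose, as =>
    have h := R.leftUniv_run R.leftUniv_point as
    refine ⟨fun f g e => h.post_inj ((R.toHom_loose f).symm.trans ((Same.of_eq e).trans
      (R.toHom_loose g))), fun k => ?_⟩
    obtain ⟨g, hg⟩ := h.exists_post k
    exact ⟨g, ((R.toHom_loose g).trans hg).eq⟩

lemma toHom_relax {x y : Tightness} (l : x ≤ y) {as : List A.Obj} {b : A.Obj}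
    (f : R.toSkewMonCat.Multimap x as b) :
    R.toHom (f.relax l) = A.relax l (R.toHom f) := by
  match x, y, as, f, l with
  | .tight, .tight, _ :: _, f, _ => exact (A.relax_refl _).symm
  | .loose, .loose, _, f, _ => exact (A.relax_refl _).symm
  | .tight, .loose, a :: as, f, _ =>
    refine Same.eq ?_
    refine (R.toHom_loose _).trans ?_
    refine (post_post _ _ _).symm.trans ?_
    refine (post_congr _ ((post_congr _ (R.run_cons _ a as)).trans (R.post_actHom _ _ as))).trans ?_
    refine (post_congr _ ((R.run_congr (R.post_left _) as).trans (R.run_relax _ _ as))).trans ?_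
    exact (post_relax _ _ _ (Tightness.le_loose _)).trans
      (relax_congr _ _ rfl (R.toHom_tight f).symm)
  | .loose, .tight, _, _, h => exact absurd (h rfl) (by simp)

/-- Explains the action `ext` inside `A`: it converts `X ⊗ 1 ⊗ … ⊗ 1` into `X` tensored with the
multimap that `f` represents. For loose `f` the second factor starts from the `point` introduced by
`ρ`. -/
lemma post_ext (X : A.Hom x xs c) {as : List A.Obj} {b : A.Obj}
    (f : R.toSkewMonCat.Multimap y as b) :
    Same (H := A.Hom) (post (f.ext c) (R.run X as)) (R.prod X (R.toHom f)) := by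
  match y, as, f with
  | .tight, a :: as, f =>
    refine (post_congr _ (R.run_cons X a as)).trans ((post_post _ _ _).symm.trans ?_)
    refine (post_congr _ (R.post_assocAct _ _ as)).trans ?_
    exact (R.post_tensorHom _ _ _ _).trans (R.prod_congr (one_post _) (R.toHom_tight f).symm)
  | .loose, as, f =>
    refine (post_post _ _ _).symm.trans ((post_post _ _ _).symm.trans ?_)
    refine (post_congr _ (post_congr _ ((R.post_actHom _ _ as).trans
      (R.run_congr (R.post_right X) as)))).trans ?_
    refine (post_congr _ (R.post_assocAct _ _ as)).trans ?_
    exact (R.post_tensorHom _ _ _ _).trans (R.prod_congr (one_post _) (R.toHom_loose f).symm)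

lemma post_famExt (X : A.Hom x xs c) {zs : List Tightness} {ass : List (List A.Obj)}
    {bs : List A.Obj} (fs : Family R.toSkewMonCat.Multimap zs ass bs) :
    Same (H := A.Hom) (post (SkewMonCat.famExt fs c) (R.run X ass.flatten))
      (R.runFam X (fs.mapHom (Q := A.Hom) R.toHom)) := by
  induction fs generalizing xs c with
  | nil => exact (one_post _).trans ((R.run_nil X).trans (R.runFam_nil X).symm)
  | cons f fs ih =>
    refine (post_post _ _ _).symm.trans ((post_post _ _ _).symm.trans ?_)
    refine (post_congr _ (post_congr _ (R.post_eqToHom_run X _ _))).trans ?_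
    refine (post_congr _ ((R.post_actHom _ _ _).trans (R.run_congr (R.post_ext X f) _))).trans ?_
    exact (ih _).trans (R.runFam_cons X _ _).symm

lemma toHom_pre {as bs : List A.Obj} {b c : A.Obj} (f : R.toSkewMonCat.Multimap x as b)
    (k : A.Hom .tight [R.toSkewMonCat.act b bs] c) :
    Same (H := A.Hom) (R.toHom (f.pre (bs := bs) (c := c) k)) (post k (R.run (R.toHom f) bs)) := by
  match x, as, f with
  | .tight, a :: as, f =>
    refine (R.toHom_tight _).trans ?_
    refine (post_post _ _ _).symm.trans ((post_post _ _ _).symm.trans ?_)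
    refine (post_congr _ (post_congr _ (R.post_eqToHom_run _ as bs))).trans ?_
    exact (post_congr _ ((R.post_actHom _ _ _).trans (R.run_congr (R.toHom_tight f).symm _)))
  | .loose, as, f =>
    refine (R.toHom_loose _).trans ?_
    refine (post_post _ _ _).symm.trans ((post_post _ _ _).symm.trans ?_)
    refine (post_congr _ (post_congr _ (R.post_eqToHom_run _ as bs))).trans ?_
    exact (post_congr _ ((R.post_actHom _ _ _).trans (R.run_congr (R.toHom_loose f).symm _)))

/-- Both sides are `g` after one multimap: `point ⊗ f₁ ⊗ … ⊗ fₙ` for loose `g`, and `f₁ ⊗ … ⊗ fₙ`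
for tight `g`. `post_famExt` obtains it from the action, `run_subst` from substitution in `A`. -/
lemma toHom_subst {zs : List Tightness} {ass : List (List A.Obj)} {bs : List A.Obj}
    (g : R.toSkewMonCat.Multimap x bs c) (fs : Family R.toSkewMonCat.Multimap zs ass bs) :
    Same (H := A.Hom) (R.toHom (g.subst fs))
      (A.subst (R.toHom g) (fs.mapHom (Q := A.Hom) R.toHom)) := by
  match x, zs, ass, bs, g, fs with
  | .loose, zs, ass, bs, g, fs =>
    refine (R.toHom_loose _).trans ((post_post _ _ _).symm.trans ?_)
    refine (post_congr _ (R.post_famExt R.point fs)).trans (Same.symm ?_)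
    refine (post_subst' g (R.run R.point bs) _ (R.toHom_loose g).symm .refl).symm.trans ?_
    exact post_congr _ ((R.run_subst R.point .nil _).trans
      (R.runFam_congr (A.subst_one R.point) _))
  | .tight, _, _, b :: bs, g, .cons f fs =>
    refine (R.toHom_pre f _).trans ((post_post _ _ _).symm.trans ?_)
    refine (post_congr _ (R.post_famExt _ fs)).trans (Same.symm ?_)
    refine (post_subst' g (R.run (A.one b) bs) _ (R.toHom_tight g).symm .refl).symm.trans ?_
    have h := R.run_subst (A.one b) (.cons (R.toHom f) .nil) (fs.mapHom (Q := A.Hom) R.toHom)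
    exact post_congr _ (h.trans (R.runFam_congr (A.one_subst _) _))

end Representation

end SkewMulticat

lemma FSame.of_eq {I : Type u₁} {J : Type u₂} {K : Type v₁} {P : I → J → K → Type v₂}
    {is : List I} {js : List J} {ks : List K} {f g : Family P is js ks} (h : f = g) :
    FSame f g := by
  cases h; exact .refl

lemma Family.mapHom_mapHom {I : Type u₁} {J : Type u₂} {K : Type v₁} {P Q : I → J → K → Type v₂}
    (m : ∀ {i j k}, P i j k → Q i j k) (m' : ∀ {i j k}, Q i j k → P i j k)
    (h : ∀ {i j k} (f : P i j k), m' (m f) = f) {is : List I} {js : List J} {ks : List K}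
    (fs : Family P is js ks) : (fs.mapHom (Q := Q) m).mapHom (Q := P) m' = fs := by
  induction fs with
  | nil => rfl
  | cons f fs ih => exact congrArg₂ Family.cons (h f) ih

lemma Family.same_mapHom {O : Type u} {P Q : Tightness → List O → O → Type v}
    (m : ∀ {x as b}, P x as b → Q x as b) {xs : List Tightness} {ass : List (List O)} {bs : List O}
    (fs : Family P xs ass bs) :
    FSame (fs.mapHom (Q := Q) m) (fs.map (Q := Q) (List.map fun a => a) (fun a => a)
      (fun {_ as _} f => castObjs (H := Q) (List.map_id' as).symm (m f))) := by
  induction fs with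
  | nil => exact .refl
  | cons f fs ih => exact .cons (same_cast _ _).symm ih

/-! ### The counit: recovering a left representable skew multicategory -/

namespace SkewMulticat

variable {A B : SkewMulticat.{v, u}}

namespace Representation

variable (R : A.Representation) (R' : B.Representation)

/-- The multimap of the skew monoidal category corresponding to a multimap of a left representable
skew multicategory. -/
noncomputable def ofHom {x : Tightness} {as : List A.Obj} {b : A.Obj} (f : A.Hom x as b) :
    R.toSkewMonCat.Multimap x as b :=
  (Equiv.ofBijective _ (R.toHom_bijective x as b)).symm f

lemma toHom_ofHom {x : Tightness} {as : List A.Obj} {b : A.Obj} (f : A.Hom x as b) :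
    R.toHom (R.ofHom f) = f :=
  (Equiv.ofBijective _ (R.toHom_bijective x as b)).apply_symm_apply f

lemma ofHom_toHom {x : Tightness} {as : List A.Obj} {b : A.Obj}
    (f : R.toSkewMonCat.Multimap x as b) : R.ofHom (R.toHom f) = f :=
  (Equiv.ofBijective _ (R.toHom_bijective x as b)).symm_apply_apply f

lemma same_ofHom {x y : Tightness} {as as' : List A.Obj} {b : A.Obj} {f : A.Hom x as b}
    {g : A.Hom y as' b} (h : Same (H := A.Hom) f g) :
    Same (H := R.toSkewMonCat.Multimap) (R.ofHom f) (R.ofHom g) := by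
  cases h; exact .refl

lemma ofHom_subst {x : Tightness} {xs : List Tightness} {ass : List (List A.Obj)}
    {bs : List A.Obj} {c : A.Obj} (g : A.Hom x bs c) (fs : Family A.Hom xs ass bs) :
    Same (H := R.toSkewMonCat.Multimap) (R.ofHom (A.subst g fs))
      ((R.ofHom g).subst (fs.mapHom (Q := R.toSkewMonCat.Multimap) R.ofHom)) := by
  have h := R.toHom_subst (R.ofHom g) (fs.mapHom (Q := R.toSkewMonCat.Multimap) R.ofHom)
  have e := h.trans (subst_congr (.of_eq (R.toHom_ofHom g))
    (.of_eq (Family.mapHom_mapHom (Q := R.toSkewMonCat.Multimap) R.ofHom R.toHom R.toHom_ofHom fs)))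
  exact (R.same_ofHom e).symm.trans (.of_eq (R.ofHom_toHom _))

lemma toHom_unary {a b : A.Obj} (f : A.Hom .tight [a] b) :
    R.toHom (x := .tight) (as := [a]) (b := b) f = f :=
  ((R.toHom_tight (as := []) f).trans ((post_congr f (R.run_nil (A.one a))).trans
    (.of_eq (post_one f)))).eq

lemma toHom_one (a : A.Obj) :
    R.toHom (x := .tight) (as := [a]) (b := a) (A.one a) = A.one a :=
  R.toHom_unary (A.one a)

/-- The comparison from the skew multicategory of the skew monoidal category of a left
representable skew multicategory. -/
noncomputable def counitHom : Morphism R.toSkewMonCat.toMulticat A where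
  obj (a : A.Obj) := a
  map {_ as _} f := castObjs (H := A.Hom) (List.map_id' as).symm (R.toHom f)
  map_relax h f := (congrArg _ (R.toHom_relax h f)).trans (castObjs_relax (A := A) _ h (R.toHom f))
  map_one (a : A.Obj) := R.toHom_one a
  map_subst g f := (same_cast _ _).trans ((R.toHom_subst g f).trans
    (subst_congr (A := A) (same_cast _ _).symm (Family.same_mapHom (Q := A.Hom) R.toHom f)))

/-- The inverse of `counitHom`. -/
noncomputable def counitInv : Morphism A R.toSkewMonCat.toMulticat where
  obj a := a
  map {_ as _} f := castObjs (H := R.toSkewMonCat.Multimap) (List.map_id' as).symm (R.ofHom f)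
  map_relax h f := by
    refine Eq.trans (congrArg _ ?_)
      (castObjs_relax (A := R.toSkewMonCat.toMulticat) _ h (R.ofHom f))
    refine (R.toHom_bijective _ _ _).1 ((R.toHom_ofHom _).trans ?_)
    exact Eq.symm ((R.toHom_relax h (R.ofHom f)).trans (by rw [toHom_ofHom]))
  map_one a := by
    refine (R.toHom_bijective _ _ _).1 ((R.toHom_ofHom _).trans ?_)
    exact (R.toHom_one a).symm
  map_subst g f := (same_cast _ _).trans ((R.ofHom_subst g f).trans
    (subst_congr (A := R.toSkewMonCat.toMulticat) (same_cast _ _).symm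
      (Family.same_mapHom (Q := R.toSkewMonCat.Multimap) R.ofHom f)))

lemma counitHom_map {x : Tightness} {as : List A.Obj} {b : A.Obj}
    (f : R.toSkewMonCat.Multimap x as b) :
    Same (H := A.Hom) (b := b) (R.counitHom.map f) (R.toHom (b := b) f) := same_cast _ _

lemma counitInv_map {x : Tightness} {as : List A.Obj} {b : A.Obj} (f : A.Hom x as b) :
    Same (H := R.toSkewMonCat.Multimap) (R.counitInv.map f) (R.ofHom f) := same_cast _ _

lemma counitHom_comp_counitInv : R.counitHom.comp R.counitInv = Morphism.id _ :=
  Morphism.ext_heq (fun _ => rfl) fun f =>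
    ((Morphism.comp_map R.counitHom R.counitInv f).trans
      ((Morphism.map_same R.counitInv (R.counitHom_map f)).trans
        ((R.counitInv_map _).trans ((Same.of_eq (R.ofHom_toHom f)).trans
          (Morphism.id_map (A := R.toSkewMonCat.toMulticat) f).symm)))).heq

lemma counitInv_comp_counitHom : R.counitInv.comp R.counitHom = Morphism.id _ :=
  Morphism.ext_heq (fun _ => rfl) fun f =>
    ((Morphism.comp_map R.counitInv R.counitHom f).trans
      ((Morphism.map_same R.counitHom (R.counitInv_map f)).trans
        ((R.counitHom_map _).trans ((Same.of_eq (R.toHom_ofHom f)).trans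
          (Morphism.id_map f).symm)))).heq

/-- Iterates `post_mapTensor_map`. The map `Y` is only `Same` as `H.map X` so as to cover identities
as well as `point` composed with the unit constraint. -/
lemma post_mapAct (H : Morphism A B) {x y : Tightness} {xs : List A.Obj} {xs' : List B.Obj}
    {c : A.Obj} (X : A.Hom x xs c) (Y : B.Hom y xs' (H.obj c)) (h : Same (H := B.Hom) Y (H.map X))
    (as : List A.Obj) :
    Same (H := B.Hom) (post ((R.laxFunctor R' H).mapAct c as) (R'.run Y (as.map H.obj)))
      (H.map (R.run X as)) := by
  induction as generalizing x y xs xs' c with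
  | nil => exact (one_post _).trans ((R'.run_nil Y).trans
      (h.trans (H.map_same (R.run_nil X)).symm))
  | cons a as ih =>
    refine (post_congr _ (R'.run_cons Y (H.obj a) (as.map H.obj))).trans ?_
    refine (post_post _ _ _).symm.trans ?_
    refine (post_congr _ (R'.post_actHom _ _ _)).trans ?_
    refine (ih (R.prod X (A.one a)) _ ?_).trans (H.map_same (R.run_cons X a as).symm)
    exact R.post_mapTensor_map R' H h (same_one_map H a)

lemma toHom_mapMultimap (H : Morphism A B) {x : Tightness} {as : List A.Obj} {b : A.Obj}
    (f : R.toSkewMonCat.Multimap x as b) :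
    Same (H := B.Hom) (R'.toHom ((R.laxFunctor R' H).mapMultimap f)) (H.map (R.toHom f)) := by
  match x, as, f with
  | .tight, a :: as, f =>
    refine (R'.toHom_tight _).trans ((post_post _ _ _).symm.trans ?_)
    refine (post_congr _ (R.post_mapAct R' H (A.one a) _ (same_one_map H a) as)).trans ?_
    exact (H.map_post _ _).symm.trans (H.map_same (R.toHom_tight f).symm)
  | .loose, as, f =>
    refine (R'.toHom_loose _).trans ((post_post _ _ _).symm.trans ?_)
    refine (post_congr _ (R'.post_actHom _ _ _)).trans ((post_post _ _ _).symm.trans ?_)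
    refine (post_congr _ (R.post_mapAct R' H R.point _ (R.post_mapUnit R' H) as)).trans ?_
    exact (H.map_post _ _).symm.trans (H.map_same (R.toHom_loose f).symm)

lemma toMorphism_comp_counitHom (H : Morphism A B) :
    (R.laxFunctor R' H).toMorphism.comp R'.counitHom = R.counitHom.comp H :=
  Morphism.ext_heq (fun _ => rfl) fun f =>
    ((Morphism.comp_map (R.laxFunctor R' H).toMorphism R'.counitHom f).trans
      ((R'.counitHom_map _).trans ((R.toHom_mapMultimap R' H f).trans
        ((H.map_same (R.counitHom_map f)).symm.trans
          (Morphism.comp_map R.counitHom H f).symm)))).heq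

end Representation

end SkewMulticat

namespace LeftRepSkewMulticat

lemma comp_eqToHom {A B : LeftRepSkewMulticat.{v, u}} {F F' G G' : A ⟶ B} (h : F = F')
    (h' : G = G') (φ : F ⟶ G) (ψ : F' ⟶ G')
    (H : ∀ a, SkewMulticat.Transformation.app φ.hom a ≍ SkewMulticat.Transformation.app ψ.hom a) :
    φ ≫ eqToHom h' = eqToHom h ≫ ψ := by
  rw [LeftRepSkewMulticat.eq_conj h h'.symm φ ψ H]
  simp

/-- A left representable skew multicategory is recovered from its skew monoidal category. -/
noncomputable def counitIso : TwoNatIso (skewMonFunctor.comp SkewMonCat.multicatFunctor)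
    (StrictPseudofunctor.id LeftRepSkewMulticat.{v, u}) where
  hom A := Bicategory.InducedBicategory.mkHom (representation A).counitHom
  inv A := Bicategory.InducedBicategory.mkHom (representation A).counitInv
  hom_inv A := Bicategory.InducedBicategory.hom_ext (representation A).counitHom_comp_counitInv
  inv_hom A := Bicategory.InducedBicategory.hom_ext (representation A).counitInv_comp_counitHom
  naturality {A B} F := Bicategory.InducedBicategory.hom_ext
    ((representation A).toMorphism_comp_counitHom (representation B) F.hom)
  -- The counit applies `toHom` to the unary component `φ_a`, and `toHom` is the identity on tight
  -- unary maps.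
  naturality₂ {A B F G} φ := comp_eqToHom _ _ _ _ fun a => by
    change (representation B).counitHom.map (x := .tight) (as := [F.hom.obj a])
      (b := G.hom.obj a) (φ.hom.app a) ≍ φ.hom.app a
    exact heq_of_eq ((representation B).toHom_unary (φ.hom.app a))

end LeftRepSkewMulticat

theorem theorem5p1 :
    Nonempty (TwoEquivalence SkewMonCat.{v, u} LeftRepSkewMulticat.{v, u}) :=
  ⟨⟨SkewMonCat.multicatFunctor, LeftRepSkewMulticat.skewMonFunctor, SkewMonCat.unitIso,
    LeftRepSkewMulticat.counitIso⟩⟩
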